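/- **Theorem 1.1 (mean-field limit).** Let $\hbar>0$ and $t\ge 0$ be fixed, and let $w\in L^\infty(\mathbb R^3)$ be real-valued and even, $w(-x)=w(x)$ for a.e. $x$. Let $L^2_S(\mathbb R^{3N})$ be the subspace of $L^2(\mathbb R^{3N})$ of functions $\Psi(x_1,\dots,x_N)$, $x_i\in\mathbb R^3$, that are invariant under all permutations of $x_1,\dots,x_N$, let $P_S$ be the orthogonal projection onto it, and consider on $L^2_S(\mathbb R^{3N})$ the operator $$H_N=-\sum_{i=1}^N\frac{\hbar^2}{2}\Delta_i+\frac1N\sum_{1\le i<j\le N}w(x_i-x_j)$$ with domain the symmetrized Sobolev space $H^2_S(\mathbb R^{3N})=H^2(\mathbb R^{3N})\cap L^2_S(\mathbb R^{3N})$. There is exactly one strongly continuous one-parameter unitary group on $L^2_S(\mathbb R^{3N})$ with generator $-\frac{i}{\hbar}H_N$ (with exactly this domain); it is denoted $(e^{-iH_Nt/\hbar})_{t\in\mathbb R}$. Let $p\ge 0$ be an integer, let $a^{(p)}$ be a bounded operator on $L^2_S(\mathbb R^{3p})$, and for $N\ge p$ define the bounded operator $$A^{(p)}_N=\frac{N(N-1)\cdots(N-p+1)}{N^p}\,P_S\,(a^{(p)}\otimes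 I^{(N-p)})\,P_S$$ on $L^2_S(\mathbb R^{3N})$, where $a^{(p)}$ acts on the variables $x_1,\dots,x_p$ and $I^{(N-p)}$ is the identity in the variables $x_{p+1},\dots,x_N$. (For $p=0$ the prefactor is $1$.) Let $\psi\in L^2(\mathbb R^3)$, $\|\psi\|=1$, and $\Psi_{N,0}(x_1,\dots,x_N)=\psi(x_1)\cdots\psi(x_N)$. Then there is a solution $s\mapsto\psi_s$ in $C([0,t];L^2(\mathbb R^3))$ of the Hartree equation $$i\hbar\,\partial_s\psi_s=-\frac{\hbar^2}{2}\Delta\psi_s+(w*|\psi_s|^2)\psi_s,\qquad \psi_{s=0}=\psi,$$ understood in the sense of tempered distributions on $\mathbb R^3$, pointwise in $s\in[0,t]$ (one-sided derivatives at the end points). For every such solution, with $\Psi_{N,t}(x_1,\dots,x_N)=\psi_t(x_1)\cdots\psi_t(x_N)$, $$\lim_{N\to\infty}\langle\Psi_{N,0},e^{iH_Nt/\hbar}A^{(p)}_Ne^{-iH_Nt/\hbar}\Psi_{N,0}\rangle=\lim_{N\to\infty}\langle\Psi_{N,t},A^{(p)}_N\Psi_{N,t}\rangle=\langle\Psi_{p,t},a^{(p)}\Psi_{p,t}\rangle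 ,$$ that is, both limits exist and equal the right-hand side. -/

import Mathlib

open MeasureTheory Filter Topology
open scoped ENNReal SchwartzMap Laplacian TensorProduct

noncomputable section
set_option linter.unusedSectionVars false

namespace MeanField

/-- Complex-valued square-integrable functions, modulo almost everywhere equality. -/
abbrev L2 {α : Type*} [MeasurableSpace α] (μ : Measure α) : Type _ := Lp ℂ 2 μ

/-- The physical space `ℝ³`. -/
abbrev Space : Type := EuclideanSpace ℝ (Fin 3)
/-- The configuration space `ℝ^{3N}` of `N` particles; `x (i, k)` is the `k`-th coordinate of the
`i`-th particle. -/
abbrev Config (N : ℕ) : Type := EuclideanSpace ℝ (Fin N × Fin 3)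

/-- `L²(ℝ³)`. -/
abbrev L2Space : Type := L2 (volume : Measure Space)

/-- `L²(ℝ^{3N})`. -/
abbrev L2Config (N : ℕ) : Type := L2 (volume : Measure (Config N))

/-- The position `x_i ∈ ℝ³` of the `i`-th particle. -/
def particle {N : ℕ} (i : Fin N) (x : Config N) : Space := WithLp.toLp 2 fun k => x (i, k)

/-! ### The Hilbert tensor product `L²(μ) ⊗ L²(ν) = L²(μ × ν)` -/

section prod
variable {α β : Type*} [MeasurableSpace α] [MeasurableSpace β] {μ : Measure α} {ν : Measure β}
  [SigmaFinite μ] [SigmaFinite ν]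

theorem memLp_mul_prod {f : α → ℂ} {g : β → ℂ} (hf : MemLp f 2 μ)
    (hg : MemLp g 2 ν) : MemLp (fun z : α × β => f z.1 * g z.2) 2 (μ.prod ν) := by
  have hm : AEStronglyMeasurable (fun z : α × β => f z.1 * g z.2) (μ.prod ν) :=
    hf.1.comp_fst.mul hg.1.comp_snd
  rw [memLp_two_iff_integrable_sq_norm hm]
  have := ((memLp_two_iff_integrable_sq_norm hf.1).1 hf).mul_prod
    ((memLp_two_iff_integrable_sq_norm hg.1).1 hg)
  refine this.congr (Eventually.of_forall fun z => ?_)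
  simp [mul_pow]

/-- The function `f ⊗ g : (x, y) ↦ f x * g y` in `L²(μ × ν)`. -/
def mulProd (f : L2 μ) (g : L2 ν) : L2 (μ.prod ν) := (memLp_mul_prod (Lp.memLp f) (Lp.memLp g)).toLp _

theorem coeFn_mulProd (f : L2 μ) (g : L2 ν) :
    mulProd f g =ᵐ[μ.prod ν] fun z : α × β => f z.1 * g z.2 := MemLp.coeFn_toLp _

theorem ae_fst {P : α → Prop} (h : ∀ᵐ x ∂μ, P x) : ∀ᵐ z ∂(μ.prod ν), P z.1 :=
  Measure.quasiMeasurePreserving_fst.ae h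

theorem ae_snd {P : β → Prop} (h : ∀ᵐ x ∂ν, P x) : ∀ᵐ z ∂(μ.prod ν), P z.2 :=
  Measure.quasiMeasurePreserving_snd.ae h

/-- `mulProd` as a bilinear map. -/
def mulProdₗ : L2 μ →ₗ[ℂ] L2 ν →ₗ[ℂ] L2 (μ.prod ν) :=
  LinearMap.mk₂ ℂ mulProd
    (fun f₁ f₂ g => by
      apply Lp.ext
      filter_upwards [coeFn_mulProd (f₁ + f₂) g, coeFn_mulProd f₁ g, coeFn_mulProd f₂ g,
        Lp.coeFn_add (mulProd f₁ g) (mulProd f₂ g), ae_fst (ν := ν) (Lp.coeFn_add f₁ f₂)]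
        with z h1 h2 h3 h4 h5
      rw [h1, h4, h5, Pi.add_apply, Pi.add_apply, h2, h3, add_mul])
    (fun c f g => by
      apply Lp.ext
      filter_upwards [coeFn_mulProd (c • f) g, coeFn_mulProd f g,
        Lp.coeFn_smul c (mulProd f g), ae_fst (ν := ν) (Lp.coeFn_smul c f)]
        with z h1 h2 h3 h4
      simp [h1, h2, h3, h4, mul_assoc])
    (fun f g₁ g₂ => by
      apply Lp.ext
      filter_upwards [coeFn_mulProd f (g₁ + g₂), coeFn_mulProd f g₁, coeFn_mulProd f g₂,
        Lp.coeFn_add (mulProd f g₁) (mulProd f g₂), ae_snd (μ := μ) (Lp.coeFn_add g₁ g₂)]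
        with z h1 h2 h3 h4 h5
      rw [h1, h4, h5, Pi.add_apply, Pi.add_apply, h2, h3, mul_add])
    (fun c f g => by
      apply Lp.ext
      filter_upwards [coeFn_mulProd f (c • g), coeFn_mulProd f g,
        Lp.coeFn_smul c (mulProd f g), ae_snd (μ := μ) (Lp.coeFn_smul c g)]
        with z h1 h2 h3 h4
      simp [h1, h2, h3, h4, mul_left_comm])

theorem inner_mulProd (f f' : L2 μ) (g g' : L2 ν) :
    inner ℂ (mulProd f g) (mulProd f' g') = inner ℂ f f' * inner ℂ g g' := by
  simp only [L2.inner_def]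
  rw [← integral_prod_mul]
  apply integral_congr_ae
  filter_upwards [coeFn_mulProd f g, coeFn_mulProd f' g'] with z h1 h2
  simp [h1, h2]
  ring

/-- The canonical isometry from the algebraic tensor product of the two Hilbert spaces into
`L²(μ × ν)`, sending `f ⊗ g` to `(x, y) ↦ f x * g y`. Its range is dense. -/
def tensorProd : L2 μ ⊗[ℂ] L2 ν →ₗᵢ[ℂ] L2 (μ.prod ν) :=
  (TensorProduct.lift mulProdₗ).isometryOfInner fun x y => by
    induction x with
    | zero => simp
    | add x₁ x₂ h₁ h₂ => simp [inner_add_left, h₁, h₂]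
    | tmul f g =>
      induction y with
      | zero => simp
      | add y₁ y₂ h₁ h₂ => simp only [map_add, inner_add_right, h₁, h₂]
      | tmul f' g' => simpa [mulProdₗ] using inner_mulProd f f' g g'

theorem tensorProd_tmul (f : L2 μ) (g : L2 ν) : tensorProd (f ⊗ₜ[ℂ] g) = mulProd f g := by
  simp [tensorProd, mulProdₗ]

theorem denseRange_tensorProd : DenseRange (tensorProd : L2 μ ⊗[ℂ] L2 ν →ₗᵢ[ℂ] L2 (μ.prod ν)) := by
  have key : (LinearMap.range (tensorProd : L2 μ ⊗[ℂ] L2 ν →ₗᵢ[ℂ] L2 (μ.prod ν)).toLinearMap)ᗮ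
      = ⊥ := by
    rw [Submodule.eq_bot_iff]
    intro h hh
    -- integrals over rectangles vanish
    have hrect : ∀ (s : Set α) (t : Set β), MeasurableSet s → MeasurableSet t →
        μ s ≠ ∞ → ν t ≠ ∞ → ∫ z in s ×ˢ t, h z ∂(μ.prod ν) = 0 := by
      intro s t hs ht hs' ht'
      have h0 := (Submodule.mem_orthogonal _ _).1 hh
        (tensorProd (indicatorConstLp 2 hs hs' (1 : ℂ) ⊗ₜ indicatorConstLp 2 ht ht' (1 : ℂ)))
        ⟨_, rfl⟩
      rw [tensorProd_tmul, L2.inner_def] at h0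
      rw [← integral_indicator (hs.prod ht), ← h0]
      apply integral_congr_ae
      filter_upwards [coeFn_mulProd (indicatorConstLp 2 hs hs' (1 : ℂ))
        (indicatorConstLp 2 ht ht' (1 : ℂ)),
        ae_fst (ν := ν) (indicatorConstLp_coeFn (p := 2) (hs := hs) (hμs := hs') (c := (1 : ℂ))),
        ae_snd (μ := μ) (indicatorConstLp_coeFn (p := 2) (hs := ht) (hμs := ht') (c := (1 : ℂ)))]
        with z h1 h2 h3
      rw [h1, h2, h3]
      by_cases a1 : z.1 ∈ s <;> by_cases a2 : z.2 ∈ t <;> simp [Set.indicator, a1, a2]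
    have hint : ∀ (s : Set (α × β)), (μ.prod ν) s ≠ ∞ → IntegrableOn h s (μ.prod ν) := fun s hs => by
      have : IsFiniteMeasure ((μ.prod ν).restrict s) :=
        ⟨by simpa using lt_top_iff_ne_top.2 hs⟩
      exact ((Lp.memLp h).restrict s).integrable (by norm_num)
    have hS : ∀ n, (μ.prod ν) (spanningSets μ n
        ×ˢ spanningSets ν n) ≠ ∞ := fun n => by
      rw [Measure.prod_prod]
      exact ENNReal.mul_ne_top (measure_spanningSets_lt_top _ n).ne
        (measure_spanningSets_lt_top _ n).ne
    have hloc : ∀ n, ∀ᵐ z ∂((μ.prod ν).restrict (spanningSets μ n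
        ×ˢ spanningSets ν n)), h z = 0 := by
      intro n
      set A := spanningSets μ n with hA
      set B := spanningSets ν n with hB
      have mA : MeasurableSet A := measurableSet_spanningSets _ n
      have mB : MeasurableSet B := measurableSet_spanningSets _ n
      have hi : Integrable h ((μ.prod ν).restrict (A ×ˢ B)) := hint _ (hS n)
      refine hi.ae_eq_zero_of_forall_setIntegral_eq_zero fun s hs hfin => ?_
      clear hfin
      induction s, hs using MeasurableSpace.induction_on_inter generateFrom_prod.symm
        isPiSystem_prod with
      | empty => simp
      | basic u hu =>
        obtain ⟨s, hs, t, ht, rfl⟩ := hu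
        simp only [Set.mem_ofPred_eq] at hs ht
        rw [Measure.restrict_restrict (hs.prod ht), Set.prod_inter_prod]
        exact hrect _ _ (hs.inter mA) (ht.inter mB)
          (measure_ne_top_of_subset Set.inter_subset_right (measure_spanningSets_lt_top _ n).ne)
          (measure_ne_top_of_subset Set.inter_subset_right (measure_spanningSets_lt_top _ n).ne)
      | compl u hu ih =>
        have h1 := integral_add_compl hu hi
        rwa [ih, zero_add, hrect A B mA mB (measure_spanningSets_lt_top _ n).ne
          (measure_spanningSets_lt_top _ n).ne] at h1
      | iUnion f hd hm ih =>
        rw [integral_iUnion hm hd hi.integrableOn]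
        simp [ih]
    have : ∀ᵐ z ∂(μ.prod ν), h z = 0 := by
      have h1 := ae_all_iff.2 fun n => (ae_restrict_iff' ((measurableSet_spanningSets _ n).prod
        (measurableSet_spanningSets _ n))).1 (hloc n)
      filter_upwards [h1] with z hz
      have e1 := mem_spanningSetsIndex μ z.1
      have e2 := mem_spanningSetsIndex ν z.2
      exact hz (max (spanningSetsIndex μ z.1)
        (spanningSetsIndex ν z.2))
        ⟨monotone_spanningSets _ (le_max_left _ _) e1,
          monotone_spanningSets _ (le_max_right _ _) e2⟩
    exact (Lp.eq_zero_iff_ae_eq_zero).2 this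
  have := (Submodule.topologicalClosure_eq_top_iff).2 key
  have h2 := (Submodule.dense_iff_topologicalClosure_eq_top).2 this
  exact h2

/-- The bounded operator `a ⊗ I` on `L²(μ × ν)`: the continuous extension of the operator
`f ⊗ g ↦ (a f) ⊗ g` from the dense algebraic tensor product. -/
def amplifyProd (a : L2 μ →L[ℂ] L2 μ) : L2 (μ.prod ν) →L[ℂ] L2 (μ.prod ν) :=
  ((tensorProd (μ := μ) (ν := ν)).toContinuousLinearMap ∘L a.rTensor (L2 ν)).extend
    (tensorProd (μ := μ) (ν := ν)).toContinuousLinearMap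

theorem amplifyProd_mulProd (a : L2 μ →L[ℂ] L2 μ) (f : L2 μ) (g : L2 ν) :
    amplifyProd a (mulProd f g) = mulProd (a f) g := by
  rw [← tensorProd_tmul, ← tensorProd_tmul]
  exact ContinuousLinearMap.extend_eq _ (e := (tensorProd (μ := μ) (ν := ν)).toContinuousLinearMap)
    denseRange_tensorProd
    (tensorProd (μ := μ) (ν := ν)).isometry.isUniformInducing (f ⊗ₜ[ℂ] g)
end prod

/-! ### Bosons -/

/-- Relabelling of the particles: the `i`-th particle of `permute σ x` is at `x_{σ i}`. -/
def permute {N : ℕ} (σ : Equiv.Perm (Fin N)) (x : Config N) : Config N :=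
  WithLp.toLp 2 fun ik => x (σ ik.1, ik.2)

theorem measurePreserving_permute {N : ℕ} (σ : Equiv.Perm (Fin N)) :
    MeasurePreserving (permute σ) :=
  (LinearIsometryEquiv.piLpCongrLeft 2 ℝ ℝ
    ((σ.prodCongr (Equiv.refl (Fin 3))).symm)).measurePreserving

/-- `L²_S(ℝ^{3N})`: the functions with `f(x_{σ 1}, …, x_{σ N}) = f(x_1, …, x_N)` almost everywhere,
for all permutations `σ`. -/
def L2S (N : ℕ) : Submodule ℂ (L2Config N) where
  carrier := {f | ∀ σ : Equiv.Perm (Fin N),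
    Lp.compMeasurePreserving (permute σ) (measurePreserving_permute σ) f = f}
  add_mem' hf hg σ := by rw [map_add, hf σ, hg σ]
  zero_mem' σ := map_zero _
  smul_mem' c f hf σ := by
    have := (Lp.compMeasurePreservingₗ ℂ (permute σ) (measurePreserving_permute σ)
      (E := ℂ) (p := 2)).map_smul c f
    exact this.trans (congrArg (c • ·) (hf σ))

instance (N : ℕ) : CompleteSpace (L2S N) := by
  refine IsClosed.completeSpace_coe (hs := ?_)
  have : (L2S N : Set (L2Config N)) = ⋂ σ : Equiv.Perm (Fin N),
      {f | Lp.compMeasurePreserving (permute σ) (measurePreserving_permute σ) f = f} := by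
    ext f; rw [Set.mem_iInter]; rfl
  rw [this]
  exact isClosed_iInter fun σ => isClosed_eq
    (Lp.isometry_compMeasurePreserving (measurePreserving_permute σ)).continuous continuous_id

/-- The orthogonal projection `P_S` of `L²(ℝ^{3N})` onto `L²_S(ℝ^{3N})`. -/
def symProj (N : ℕ) : L2Config N →L[ℂ] L2S N := (L2S N).orthogonalProjectionOnto

/-- The identification `ℝ^{3(p+m)} = ℝ^{3p} × ℝ^{3m}`: the first `p` particles and the last `m`
particles. -/
def splitConfig (p m : ℕ) : Config (p + m) ≃ᵐ Config p × Config m where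
  toFun x := (WithLp.toLp 2 fun ik => x (Fin.castAdd m ik.1, ik.2),
    WithLp.toLp 2 fun jk => x (Fin.natAdd p jk.1, jk.2))
  invFun z := WithLp.toLp 2 fun lk =>
    Fin.addCases (fun i => z.1 (i, lk.2)) (fun j => z.2 (j, lk.2)) lk.1
  left_inv x := by
    ext ⟨l, k⟩
    refine Fin.addCases (fun i => ?_) (fun j => ?_) l <;> simp
  right_inv z := by
    ext <;> simp
  measurable_toFun := by
    simp only [Equiv.coe_fn_mk]
    fun_prop
  measurable_invFun := by
    simp only [Equiv.coe_fn_symm_mk]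
    refine (WithLp.measurable_toLp 2 _).comp (measurable_pi_lambda _ fun ⟨l, k⟩ => ?_)
    refine Fin.addCases (fun i => ?_) (fun j => ?_) l <;> simp <;> fun_prop

theorem measurePreserving_splitConfig (p m : ℕ) : MeasurePreserving (splitConfig p m) := by
  have h1 := (LinearIsometryEquiv.piLpCongrLeft 2 ℝ ℝ
    (((Equiv.sumProdDistrib (Fin p) (Fin m) (Fin 3)).symm.trans
      (finSumFinEquiv.prodCongr (Equiv.refl (Fin 3)))).symm)).measurePreserving
  have h2 := (PiLp.sumPiLpEquivProdLpPiLp 2 (𝕜 := ℝ)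
    (fun _ : (Fin p × Fin 3) ⊕ (Fin m × Fin 3) => ℝ)).measurePreserving
  exact (WithLp.volume_preserving_ofLp _ _).comp (h2.comp h1)

theorem measurePreserving_splitConfig_symm (p m : ℕ) : MeasurePreserving (splitConfig p m).symm :=
  (measurePreserving_splitConfig p m).symm

/-- The operator `a ⊗ I^{(m)}` on `L²(ℝ^{3(p+m)})`, with `a` acting on the first `p` particles. -/
def amplify (p m : ℕ) (a : L2Config p →L[ℂ] L2Config p) :
    L2Config (p + m) →L[ℂ] L2Config (p + m) :=
  (Lp.compMeasurePreservingₗᵢ ℂ (splitConfig p m) (measurePreserving_splitConfig p m)).toContinuousLinearMap ∘L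
    amplifyProd a ∘L
    (Lp.compMeasurePreservingₗᵢ ℂ (splitConfig p m).symm
      (measurePreserving_splitConfig_symm p m)).toContinuousLinearMap

/-- For `a` bounded on `L²_S(ℝ^{3p})` and `N = p + m`, the operator
`A_N = (N (N-1) ⋯ (N-p+1) / N^p) P_S (a ⊗ I^{(N-p)}) P_S` on `L²_S(ℝ^{3N})`. Here `a` is extended by
zero to the orthogonal complement of `L²_S(ℝ^{3p})`; this choice is immaterial, because a symmetric
function of `N` particles is symmetric in the first `p`. -/
def observable (p m : ℕ) (a : L2S p →L[ℂ] L2S p) : L2S (p + m) →L[ℂ] L2S (p + m) :=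
  (((p + m).descFactorial p : ℂ) / ((p + m : ℕ) : ℂ) ^ p) •
    (symProj (p + m) ∘L amplify p m ((L2S p).subtypeL ∘L a ∘L symProj p) ∘L (L2S (p + m)).subtypeL)

theorem measurePreserving_particle_one :
    MeasurePreserving (particle (0 : Fin 1)) :=
  (LinearIsometryEquiv.piLpCongrLeft 2 ℝ ℝ (Equiv.uniqueProd (Fin 3) (Fin 1))).measurePreserving

theorem memLp_productState (ψ : L2Space) (N : ℕ) :
    MemLp (fun x : Config N => ∏ i, ψ (particle i x)) 2 volume := by
  induction N with
  | zero =>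
    have : IsFiniteMeasure (volume : Measure (Config 0)) := by
      rw [volume_euclideanSpace_eq_dirac]; infer_instance
    simp
  | succ n ih =>
    have h := (memLp_mul_prod ih ((Lp.memLp ψ).comp_measurePreserving
      measurePreserving_particle_one)).comp_measurePreserving (measurePreserving_splitConfig n 1)
    refine h.ae_eq (Eventually.of_forall fun x => ?_)
    symm
    dsimp only
    rw [Fin.prod_univ_castSucc]
    rfl

/-- The product state `ψ^{⊗N}`, `(x_1, …, x_N) ↦ ψ(x_1) ⋯ ψ(x_N)`. -/
def productState (ψ : L2Space) (N : ℕ) : L2S N :=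
  ⟨(memLp_productState ψ N).toLp _, fun σ => by
    rw [Lp.toLp_compMeasurePreserving]
    congr 1
    funext x
    exact Equiv.prod_comp σ fun i => ψ (particle i x)⟩

/-! ### The dynamics -/

/-- `W_N(x) = (1/N) ∑_{i<j} w(x_i - x_j)`. -/
def interaction (w : Space → ℝ) (N : ℕ) (x : Config N) : ℝ :=
  (1 / N : ℝ) * ∑ i, ∑ j ∈ Finset.Ioi i, w (particle i x - particle j x)

/-- `HamiltonianGraph ħ w N f g` says that `f` is in the domain of `H_N` and `H_N f = g`, where
`H_N = -(ħ²/2) ∑_i Δ_i + W_N` is the operator in `L²_S(ℝ^{3N})` with domain the symmetrized Sobolev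
space `H²_S(ℝ^{3N})`. The function `k` is the distributional Laplacian of `f` on `ℝ^{3N}`. -/
def HamiltonianGraph (ħ : ℝ) (w : Space → ℝ) (N : ℕ) (f g : L2S N) : Prop :=
  TemperedDistribution.MemSobolev 2 2 ((f : L2Config N) : 𝓢'(Config N, ℂ)) ∧
  ∃ k : L2Config N, (k : 𝓢'(Config N, ℂ)) = Δ ((f : L2Config N) : 𝓢'(Config N, ℂ)) ∧
    ∀ᵐ x, (g : L2Config N) x =
      -(ħ ^ 2 / 2 : ℝ) * k x + interaction w N x * (f : L2Config N) x

/-- `U` is the unitary group `U t = exp(-i t H_N / ħ)` on `L²_S(ℝ^{3N})`: a strongly continuous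
one-parameter unitary group whose generator is exactly `-(i/ħ) H_N`, domain included. -/
structure IsSchrodingerGroup (ħ : ℝ) (w : Space → ℝ) (N : ℕ) (U : ℝ → L2S N →L[ℂ] L2S N) :
    Prop where
  mem_unitary : ∀ t, U t ∈ unitary (L2S N →L[ℂ] L2S N)
  group_law : ∀ s t, U (s + t) = U s ∘L U t
  strong_continuity : ∀ f, Continuous fun t => U t f
  generator : ∀ f g, HamiltonianGraph ħ w N f g ↔
    HasDerivAt (fun t => U t f) ((-Complex.I / ħ) • g) 0

/-- `(w ∗ |f|²)(x)`. -/
def hartreePotential (w : Space → ℝ) (f : L2Space) (x : Space) : ℝ :=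
  ∫ y, w (x - y) * ‖f y‖ ^ 2

/-- `u` is a solution on the time interval `[0, T]`, continuous with values in `L²(ℝ³)`, of the
Hartree equation `iħ ∂ₜ u = -(ħ²/2) Δ u + (w ∗ |u|²) u` with `u 0 = ψ`. The equation is understood in the
sense of (tempered) distributions in `x`, pointwise in time. -/
structure IsHartreeSolution (ħ : ℝ) (w : Space → ℝ) (ψ : L2Space) (T : ℝ)
    (u : ℝ → L2Space) : Prop where
  continuousOn : ContinuousOn u (Set.Icc 0 T)
  initial : u 0 = ψ
  equation : ∀ φ : 𝓢(Space, ℂ), ∀ s ∈ Set.Icc 0 T,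
    HasDerivWithinAt (fun r => Complex.I * ħ * ∫ x, φ x * u r x)
      (-(ħ ^ 2 / 2 : ℝ) * (∫ x, Δ φ x * u s x) + ∫ x, φ x * (hartreePotential w (u s) x * u s x))
      (Set.Icc 0 T) s

end MeanField

end

open MeanField

/-! The argument counts the particles outside the condensate. Let u_s be the Hartree solution, let
Ψ_s be the N-body state evolved from ψ^{⊗N}, let p_j be the projection |u_s⟩⟨u_s| acting on particle
j, and let q_j = 1 - p_j. Put β(s) = ∑_j ‖q_j Ψ_s‖². In β' the kinetic energies cancel. What remains
is the interaction W_N minus the mean-field potential V_j = (w ∗ |u_s|²)(x_j), taken between q_j Ψ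
and p_j Ψ. Since V_j is exactly the average of w(x_j - x_k) over the condensate in x_k, the leading
part cancels, and every other contribution either carries a further factor q_k or is of relative
order 1/N. The result is |β'| ≤ (8M/ħ)(β + 1), where M is a bound for |w|
(`PairSystem.abs_sum_im_inner_le`). As β(0) = 0, Gronwall's inequality bounds β(t) uniformly in N
(`sum_norm_sq_sub_condensate_le`).

By symmetry ‖q_j Ψ_t‖² ≤ C/N for each j, so Ψ_t is within p√(C/N) of the range of the projection
onto u_t^{⊗p} in the first p particles. Compressed to that range, a ⊗ 1 is the scalar ⟨u_t^{⊗p}, a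
u_t^{⊗p}⟩. The combinatorial prefactor tends to 1, which gives both limits
(`tendsto_inner_observable`); for the product state of u_t itself the count is zero.

The data ψ are only in L², so neither Ψ_s nor u_s need lie in the domain of the Laplacian. All time
derivatives are therefore taken in the interaction picture, after removing the free flow, where only
bounded operators appear. The free flow is a Fourier multiplier with generator (iħ/2)Δ on H²
(`hasDerivAt_freeGroup_iff`), and it factorises over particles (`freeGroup_prodFun`). The N-body
group arises from it by a bounded skew perturbation (`IsUnitaryGroup.exists_perturbation`) and is
determined by its generator (`IsUnitaryGroup.eq_of_generator`). For the Hartree equation the same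
global existence theorem for norm-preserving equations gives a solution (`exists_skew_solution`),
and every distributional solution is shown to be differentiable in norm in the interaction picture
(`IsHartreeSolution.hasDerivWithinAt`). -/

noncomputable section
set_option linter.unusedSectionVars false

namespace MeanField

/-! ### Skew ordinary differential equations in Hilbert spaces -/

section skewODE
variable {H : Type*} [NormedAddCommGroup H] [InnerProductSpace ℂ H]

/-- The radial retraction onto the closed ball of radius `R`. -/
def radialProj (R : ℝ) (x : H) : H := (R / max R ‖x‖) • x

theorem radialProj_of_le {R : ℝ} (hR : 0 < R) {x : H} (hx : ‖x‖ ≤ R) : radialProj R x = x := by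
  rw [radialProj, max_eq_left hx, div_self hR.ne', one_smul]

theorem norm_radialProj_le {R : ℝ} (hR : 0 < R) (x : H) : ‖radialProj R x‖ ≤ R := by
  have hm : 0 < max R ‖x‖ := lt_max_of_lt_left hR
  rw [radialProj, norm_smul, Real.norm_of_nonneg (by positivity), div_mul_eq_mul_div,
    div_le_iff₀ hm]
  exact mul_le_mul_of_nonneg_left (le_max_right _ _) hR.le

/-- The constant 2 has one unit from moving the vector at a fixed scaling factor and one from the
change of the factor, since x ↦ max R ‖x‖ is 1-Lipschitz. -/
theorem lipschitzWith_radialProj {R : ℝ} (hR : 0 < R) :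
    LipschitzWith 2 (radialProj R : H → H) := by
  refine LipschitzWith.of_dist_le_mul fun x y => ?_
  rw [dist_eq_norm, dist_eq_norm]
  have hm : 0 < max R ‖x‖ := lt_max_of_lt_left hR
  have hn : 0 < max R ‖y‖ := lt_max_of_lt_left hR
  have key : radialProj R x - radialProj R y
      = (R / max R ‖x‖) • (x - y)
        + ((R / max R ‖x‖) * ((max R ‖y‖ - max R ‖x‖) / max R ‖y‖)) • y := by
    rw [radialProj, radialProj, smul_sub, sub_add, sub_right_inj, ← sub_smul]
    congr 1
    field_simp
    ring
  have h1 : R / max R ‖x‖ ≤ 1 := (div_le_one hm).2 (le_max_left _ _)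
  have h0 : 0 ≤ R / max R ‖x‖ := by positivity
  have h2 : |max R ‖y‖ - max R ‖x‖| ≤ ‖x - y‖ := by
    refine (abs_max_sub_max_le_max _ _ _ _).trans ?_
    rw [sub_self, abs_zero]
    refine max_le (norm_nonneg _) ?_
    rw [abs_sub_comm]
    exact abs_norm_sub_norm_le x y
  have h3 : ‖y‖ / max R ‖y‖ ≤ 1 := (div_le_one hn).2 (le_max_right _ _)
  rw [key]
  calc _ ≤ ‖(R / max R ‖x‖) • (x - y)‖
        + ‖((R / max R ‖x‖) * ((max R ‖y‖ - max R ‖x‖) / max R ‖y‖)) • y‖ := norm_add_le _ _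
    _ = (R / max R ‖x‖) * ‖x - y‖
        + (R / max R ‖x‖) * |max R ‖y‖ - max R ‖x‖| * (‖y‖ / max R ‖y‖) := by
      rw [norm_smul, norm_smul, norm_mul, Real.norm_of_nonneg h0, norm_div,
        Real.norm_of_nonneg hn.le, Real.norm_eq_abs]
      ring
    _ ≤ 1 * ‖x - y‖ + 1 * ‖x - y‖ * 1 := by gcongr
    _ = _ := by rw [NNReal.coe_ofNat]; ring

theorem hasDerivWithinAt_norm_sq {v : ℝ → H} {v' : H} {s : Set ℝ} {t : ℝ}
    (h : HasDerivWithinAt v v' s t) :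
    HasDerivWithinAt (fun r => ‖v r‖ ^ 2) (2 * (inner ℂ (v t) v').re) s t := by
  have h1 := (Complex.reCLM.hasFDerivAt.comp_hasDerivWithinAt t (h.inner ℂ h))
  have e : (fun r => ‖v r‖ ^ 2) = Complex.reCLM ∘ fun r => inner ℂ (v r) (v r) := by
    funext r
    simp [← inner_self_eq_norm_sq (𝕜 := ℂ)]
  rw [e]
  refine h1.congr_deriv ?_
  have := inner_re_symm (𝕜 := ℂ) (v t) v'
  simp only [RCLike.re_to_complex] at this
  change (inner ℂ (v t) v' + inner ℂ v' (v t)).re = _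
  rw [Complex.add_re, ← this, two_mul]

/-- Along a solution of a skew equation the norm is constant. -/
theorem norm_eq_of_skew {v v' : ℝ → H} {a b t₀ : ℝ} (ht₀ : t₀ ∈ Set.Icc a b)
    (h : ∀ t ∈ Set.Icc a b, HasDerivWithinAt v (v' t) (Set.Icc a b) t)
    (hs : ∀ t ∈ Set.Icc a b, (inner ℂ (v t) (v' t)).re = 0) {t : ℝ} (ht : t ∈ Set.Icc a b) :
    ‖v t‖ = ‖v t₀‖ := by
  have key := (convex_Icc a b).norm_image_sub_le_of_norm_hasDerivWithin_le (C := 0)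
    (fun t ht => hasDerivWithinAt_norm_sq (h t ht)) (fun t ht => by simp [hs t ht]) ht₀ ht
  rw [zero_mul, norm_le_zero_iff, sub_eq_zero] at key
  exact (pow_left_inj₀ (norm_nonneg _) (norm_nonneg _) two_ne_zero).1 key

variable [CompleteSpace H]

/-- Local-in-time version of `exists_skew_solution`, on an interval of arbitrary length. -/
theorem exists_skew_solution_Icc {F : ℝ → H → H} {R : ℝ} {K : NNReal} (hR : 0 < R)
    (hcont : ∀ x, Continuous fun t => F t x)
    (hlip : ∀ t, LipschitzOnWith K (F t) (Metric.closedBall 0 R))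
    (hskew : ∀ t x, (inner ℂ x (F t x)).re = 0) {x₀ : H} (hx₀ : ‖x₀‖ ≤ R) {T : ℝ} (hT : 0 ≤ T) :
    ∃ v : ℝ → H, v 0 = x₀ ∧ ∀ t ∈ Set.Icc (-T) T,
      HasDerivWithinAt v (F t (v t)) (Set.Icc (-T) T) t ∧ ‖v t‖ = ‖x₀‖ := by
  have hmem : ∀ x : H, radialProj R x ∈ Metric.closedBall (0 : H) R := fun x => by
    simpa using norm_radialProj_le hR x
  have hlip' : ∀ t, LipschitzWith (K * 2) fun x => F t (radialProj R x) := fun t => by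
    have := (hlip t).comp (lipschitzWith_radialProj hR).lipschitzOnWith (s := Set.univ)
      (fun x _ => hmem x)
    exact lipschitzOnWith_univ.1 this
  obtain ⟨C, hC⟩ : ∃ C, ∀ t ∈ Set.Icc (-T) T, ‖F t 0‖ ≤ C :=
    isCompact_Icc.exists_bound_of_continuousOn (hcont 0).continuousOn
  have hC0 : 0 ≤ C := (norm_nonneg _).trans (hC 0 ⟨by linarith, hT⟩)
  have h0 : (0 : ℝ) ∈ Set.Icc (-T) T := ⟨by linarith, hT⟩
  -- After composition with the retraction the field is bounded by K R plus its size at 0. A global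
  -- bound lets Picard–Lindelöf run on the whole interval, in a ball of radius L T.
  let L : NNReal := K * ⟨R, hR.le⟩ + ⟨C, hC0⟩
  have hPL : IsPicardLindelof (fun t x => F t (radialProj R x)) (⟨0, h0⟩ : Set.Icc (-T) T) x₀
      (L * ⟨T, hT⟩) 0 L (K * 2) := by
    refine ⟨fun t _ => (hlip' t).lipschitzOnWith, fun x _ => (hcont _).continuousOn, ?_, ?_⟩
    · intro t ht x _
      have h1 := (hlip t).dist_le_mul _ (hmem x) 0 (by simp [hR.le])
      rw [dist_eq_norm, dist_zero_right] at h1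
      calc ‖F t (radialProj R x)‖ ≤ ‖F t (radialProj R x) - F t 0‖ + ‖F t 0‖ := by
            simpa using norm_add_le (F t (radialProj R x) - F t 0) (F t 0)
        _ ≤ K * R + C := add_le_add (h1.trans
            (mul_le_mul_of_nonneg_left (norm_radialProj_le hR x) K.2)) (hC t ht)
    · simp only [sub_zero, zero_sub, neg_neg, max_self, NNReal.coe_zero]
      exact le_rfl
  obtain ⟨v, hv0, hv⟩ := hPL.exists_eq_forall_mem_Icc_hasDerivWithinAt₀
  -- Truncation keeps the field skew because v t is a positive multiple of its retraction. Hence the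
  -- norm is conserved, the solution stays in the ball, and the truncation was never active.
  have hsk : ∀ t ∈ Set.Icc (-T) T, (inner ℂ (v t) (F t (radialProj R (v t)))).re = 0 := by
    intro t _
    have hm : 0 < max R ‖v t‖ := lt_max_of_lt_left hR
    have e : v t = (max R ‖v t‖ / R) • radialProj R (v t) := by
      rw [radialProj, smul_smul, div_mul_div_cancel₀ hR.ne', div_self hm.ne', one_smul]
    have h1 := hskew t (radialProj R (v t))
    generalize F t (radialProj R (v t)) = Y at h1
    rw [e, RCLike.real_smul_eq_coe_smul (K := ℂ), inner_smul_real_left, Complex.real_smul,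
      Complex.re_ofReal_mul, h1, mul_zero]
  have hn : ∀ t ∈ Set.Icc (-T) T, ‖v t‖ = ‖x₀‖ := fun t ht => by
    rw [norm_eq_of_skew h0 hv hsk ht]; exact congrArg _ hv0
  refine ⟨v, hv0, fun t ht => ⟨?_, hn t ht⟩⟩
  have := hv t ht
  rwa [radialProj_of_le hR ((hn t ht).trans_le hx₀)] at this

/-- Global solutions of a skew ordinary differential equation that is Lipschitz on balls. -/
theorem exists_skew_solution {F : ℝ → H → H} {R : ℝ} {K : NNReal} (hR : 0 < R)
    (hcont : ∀ x, Continuous fun t => F t x)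
    (hlip : ∀ t, LipschitzOnWith K (F t) (Metric.closedBall 0 R))
    (hskew : ∀ t x, (inner ℂ x (F t x)).re = 0) {x₀ : H} (hx₀ : ‖x₀‖ ≤ R) :
    ∃ v : ℝ → H, v 0 = x₀ ∧ ∀ t, HasDerivAt v (F t (v t)) t ∧ ‖v t‖ = ‖x₀‖ := by
  choose v hv0 hv using fun n : ℕ =>
    exists_skew_solution_Icc hR hcont hlip hskew hx₀ (T := n + 1) (by positivity)
  have hv' : ∀ (n : ℕ), ∀ t ∈ Set.Ioo (-(n + 1) : ℝ) (n + 1), HasDerivAt (v n) (F t (v n t)) t :=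
    fun n t ht => (hv n t (Set.Ioo_subset_Icc_self ht)).1.hasDerivAt (Icc_mem_nhds ht.1 ht.2)
  have hball : ∀ (n : ℕ), ∀ t ∈ Set.Ioo (-(n + 1) : ℝ) (n + 1),
      v n t ∈ Metric.closedBall (0 : H) R := fun n t ht => by
    simpa using (hv n t (Set.Ioo_subset_Icc_self ht)).2.trans_le hx₀
  have heq : ∀ m n : ℕ, m ≤ n → ∀ t ∈ Set.Ioo (-(m + 1) : ℝ) (m + 1), v m t = v n t := by
    intro m n hmn
    have hmn' : (m : ℝ) ≤ n := by exact_mod_cast hmn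
    refine ODE_solution_unique_of_mem_Ioo (v := F) (s := fun _ => Metric.closedBall 0 R) (K := K)
      (t₀ := 0) (fun t _ => hlip t) ⟨by linarith, by positivity⟩
      (fun t ht => ⟨hv' m t ht, hball m t ht⟩) (fun t ht => ?_) ((hv0 m).trans (hv0 n).symm)
    have ht' : t ∈ Set.Ioo (-(n + 1) : ℝ) (n + 1) := ⟨by linarith [ht.1], by linarith [ht.2]⟩
    exact ⟨hv' n t ht', hball n t ht'⟩
  have hin : ∀ t : ℝ, t ∈ Set.Ioo (-(⌈|t|⌉₊ + 1) : ℝ) (⌈|t|⌉₊ + 1) := fun t => by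
    have := abs_le.1 (Nat.le_ceil |t|)
    exact ⟨by linarith, by linarith⟩
  -- For |s - t| < 1 the index ⌈|s|⌉ is at most ⌈|t|⌉ + 1, so the diagonal family coincides near t
  -- with one fixed solution.
  have hev : ∀ t : ℝ, (fun s => v ⌈|s|⌉₊ s) =ᶠ[𝓝 t] v (⌈|t|⌉₊ + 1) := fun t => by
    have : Set.Ioo (t - 1) (t + 1) ∈ 𝓝 t := Ioo_mem_nhds (by linarith) (by linarith)
    filter_upwards [this] with s hs
    refine heq _ _ (Nat.ceil_le.2 ?_) s (hin s)
    have h1 := Nat.le_ceil |t|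
    push_cast
    have h2 : |s| ≤ |t| + |s - t| := by simpa using abs_add_le t (s - t)
    have h3 : |s - t| ≤ 1 := abs_le.2 ⟨by linarith [hs.1], by linarith [hs.2]⟩
    linarith
  refine ⟨fun s => v ⌈|s|⌉₊ s, hv0 _, fun t => ⟨?_, ?_⟩⟩
  · have hin' : t ∈ Set.Ioo (-((⌈|t|⌉₊ + 1 : ℕ) + 1) : ℝ) ((⌈|t|⌉₊ + 1 : ℕ) + 1) := by
      have := hin t
      push_cast
      exact ⟨by linarith [this.1], by linarith [this.2]⟩
    have h1 := (hv' (⌈|t|⌉₊ + 1) t hin').congr_of_eventuallyEq (hev t)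
    have h2 := (hev t).self_of_nhds
    simp only at h2
    simpa only [h2] using h1
  · exact (hv _ t (Set.Ioo_subset_Icc_self (hin t))).2

end skewODE

/-! ### Strongly continuous unitary groups -/

section groups
variable {H : Type*} [NormedAddCommGroup H] [InnerProductSpace ℂ H] [CompleteSpace H]

/-- Strongly continuous one-parameter unitary groups. -/
structure IsUnitaryGroup (U : ℝ → H →L[ℂ] H) : Prop where
  mem_unitary : ∀ t, U t ∈ unitary (H →L[ℂ] H)
  group_law : ∀ s t, U (s + t) = U s ∘L U t
  strong_continuity : ∀ f, Continuous fun t => U t f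

namespace IsUnitaryGroup
variable {U V : ℝ → H →L[ℂ] H}

theorem norm_map (hU : IsUnitaryGroup U) (t : ℝ) (f : H) : ‖U t f‖ = ‖f‖ :=
  ((ContinuousLinearMap.inner_map_map_iff_adjoint_comp_self (U t)).2
    (Unitary.mem_iff.1 (hU.mem_unitary t)).1 |> fun h => by
      rw [@norm_eq_sqrt_re_inner ℂ, @norm_eq_sqrt_re_inner ℂ _ _ _ _ f, h f f])

theorem inner_map_map (hU : IsUnitaryGroup U) (t : ℝ) (f g : H) :
    inner ℂ (U t f) (U t g) = inner ℂ f g :=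
  (ContinuousLinearMap.inner_map_map_iff_adjoint_comp_self (U t)).2
    (Unitary.mem_iff.1 (hU.mem_unitary t)).1 f g

theorem add_apply (hU : IsUnitaryGroup U) (s t : ℝ) (f : H) : U (s + t) f = U s (U t f) := by
  rw [hU.group_law]; rfl

theorem zero_apply (hU : IsUnitaryGroup U) (f : H) : U 0 f = f := by
  have h := hU.add_apply 0 0 f
  rw [add_zero, ← sub_eq_zero, ← map_sub] at h
  have h1 := hU.norm_map 0 (f - U 0 f)
  rw [h, norm_zero, eq_comm, norm_eq_zero, sub_eq_zero] at h1
  exact h1.symm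

theorem neg_apply_apply (hU : IsUnitaryGroup U) (t : ℝ) (f : H) : U (-t) (U t f) = f := by
  rw [← hU.add_apply, neg_add_cancel, hU.zero_apply]

theorem apply_neg_apply (hU : IsUnitaryGroup U) (t : ℝ) (f : H) : U t (U (-t) f) = f := by
  rw [← hU.add_apply, add_neg_cancel, hU.zero_apply]

theorem inner_apply_left (hU : IsUnitaryGroup U) (t : ℝ) (f g : H) :
    inner ℂ (U t f) g = inner ℂ f (U (-t) g) := by
  rw [← hU.inner_map_map t f, hU.apply_neg_apply]

theorem inner_apply_right (hU : IsUnitaryGroup U) (t : ℝ) (f g : H) :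
    inner ℂ f (U t g) = inner ℂ (U (-t) f) g := by
  rw [hU.inner_apply_left, neg_neg]

/-- The group law supplies the inverse U (-t), which for an isometry is the adjoint; so only norm
preservation has to be checked. -/
theorem of_isometry (h0 : ∀ f, U 0 f = f) (hn : ∀ t f, ‖U t f‖ = ‖f‖)
    (ha : ∀ s t f, U (s + t) f = U s (U t f)) (hc : ∀ f, Continuous fun t => U t f) :
    IsUnitaryGroup U := by
  have hi : ∀ t f g, inner ℂ (U t f) (U t g) = inner ℂ f g := fun t =>
    (LinearMap.norm_map_iff_inner_map_map (U t).toLinearMap).1 (hn t)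
  have hinv : ∀ t f, U t (U (-t) f) = f := fun t f => by rw [← ha, add_neg_cancel, h0]
  have hinv' : ∀ t f, U (-t) (U t f) = f := fun t f => by rw [← ha, neg_add_cancel, h0]
  have hadj : ∀ t, ContinuousLinearMap.adjoint (U t) = U (-t) := fun t => by
    symm
    rw [ContinuousLinearMap.eq_adjoint_iff]
    intro x y
    rw [← hi t, hinv]
  refine ⟨fun t => Unitary.mem_iff.2 ⟨?_, ?_⟩, fun s t => ?_, hc⟩
  · rw [ContinuousLinearMap.star_eq_adjoint, hadj]; ext f; exact hinv' t f
  · rw [ContinuousLinearMap.star_eq_adjoint, hadj]; ext f; exact hinv t f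
  · ext f; exact ha s t f

/-- Strong continuity handles a fixed vector, and the isometry property makes the error from moving
the vector small uniformly in time. -/
theorem continuous_apply₂ (hU : IsUnitaryGroup U) {X : Type*} [TopologicalSpace X] {τ : X → ℝ}
    {y : X → H} {s : Set X} (hτ : ContinuousOn τ s) (hy : ContinuousOn y s) :
    ContinuousOn (fun x => U (τ x) (y x)) s := by
  intro x hx
  have h1 : ContinuousWithinAt (fun z => U (τ z) (y x)) s x :=
    (hU.strong_continuity (y x)).continuousAt.comp_continuousWithinAt (hτ x hx)
  have h2 : Tendsto (fun z => U (τ z) (y z - y x)) (𝓝[s] x) (𝓝 0) := by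
    rw [tendsto_zero_iff_norm_tendsto_zero]
    simp only [hU.norm_map]
    have := ((hy x hx).sub continuousWithinAt_const : ContinuousWithinAt (fun z => y z - y x) s x)
    simpa [ContinuousWithinAt] using this.norm
  have := h2.add h1
  simpa [ContinuousWithinAt, map_sub] using this

theorem continuous_apply (hU : IsUnitaryGroup U) {X : Type*} [TopologicalSpace X] {τ : X → ℝ}
    {y : X → H} (hτ : Continuous τ) (hy : Continuous y) : Continuous fun x => U (τ x) (y x) := by
  rw [← continuousOn_univ] at *
  exact hU.continuous_apply₂ hτ hy

theorem hasDerivAt_apply (hU : IsUnitaryGroup U) {f g : H}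
    (h : HasDerivAt (fun t => U t f) g 0) (t : ℝ) : HasDerivAt (fun t => U t f) (U t g) t := by
  have h1 : HasDerivAt (fun s => U t (U s f)) (U t g) 0 := by
    have := ((U t).restrictScalars ℝ).hasFDerivAt.comp_hasDerivAt (0 : ℝ) h
    exact this
  have h2 := HasDerivAt.comp_sub_const (f := fun s => U t (U s f)) t t (by simpa using h1)
  refine h2.congr_of_eventuallyEq (Eventually.of_forall fun s => ?_)
  simp only [← hU.add_apply]
  congr 2
  ring

/-- The generator of a unitary group commutes with the group. -/
theorem hasDerivAt_apply_apply (hU : IsUnitaryGroup U) {f g : H}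
    (h : HasDerivAt (fun t => U t f) g 0) (t : ℝ) :
    HasDerivAt (fun s => U s (U t f)) (U t g) 0 := by
  have := ((U t).restrictScalars ℝ).hasFDerivAt.comp_hasDerivAt (0 : ℝ) h
  refine HasDerivAt.congr_of_eventuallyEq (f₁ := fun s => U s (U t f)) this
    (Eventually.of_forall fun s => ?_)
  simp only [Function.comp, ContinuousLinearMap.coe_restrictScalars', ← hU.add_apply, add_comm]

/-- The domain of the generator is dense. -/
theorem dense_domain (hU : IsUnitaryGroup U) :
    Dense {f : H | ∃ g, HasDerivAt (fun t => U t f) g 0} := by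
  intro f
  have hint : ∀ a b, IntervalIntegrable (fun s => U s f) volume a b := fun a b =>
    (hU.strong_continuity f).intervalIntegrable a b
  have hder : HasDerivAt (fun h : ℝ => ∫ s in (0:ℝ)..h, U s f) f 0 := by
    have := intervalIntegral.integral_hasDerivAt_right (hint 0 0)
      (hU.strong_continuity f).aestronglyMeasurable.stronglyMeasurableAtFilter
      (hU.strong_continuity f).continuousAt
    rwa [hU.zero_apply] at this
  have hlim := hder.tendsto_slope_zero
  simp only [zero_add, intervalIntegral.integral_same, sub_zero] at hlim
  -- The averages h⁻¹ ∫₀ʰ U_s f tend to f. Each lies in the domain, because U_t only shifts the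
  -- window of integration, and the endpoints can be differentiated.
  refine mem_closure_of_tendsto hlim (Eventually.of_forall fun h => ?_)
  refine ⟨h⁻¹ • (U h f - U 0 f), ?_⟩
  have hrw : ∀ t, U t (h⁻¹ • ∫ s in (0:ℝ)..h, U s f) = h⁻¹ • ∫ s in t..(h + t), U s f := by
    intro t
    have e1 : U t (h⁻¹ • ∫ s in (0:ℝ)..h, U s f) = h⁻¹ • U t (∫ s in (0:ℝ)..h, U s f) := by
      exact ((U t).restrictScalars ℝ).map_smul _ _
    rw [e1, ← ContinuousLinearMap.intervalIntegral_comp_comm _ (hint 0 h)]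
    congr 1
    have := intervalIntegral.integral_comp_add_right (a := 0) (b := h) (fun s => U s f) t
    rw [zero_add] at this
    rw [← this]
    refine intervalIntegral.integral_congr fun s _ => ?_
    simp only [← hU.add_apply, add_comm]
  simp only [hrw]
  refine HasDerivAt.const_smul _ ?_
  have hsplit : (fun t => ∫ s in t..(h + t), U s f)
      = fun t => (∫ s in (0:ℝ)..(h + t), U s f) - ∫ s in (0:ℝ)..t, U s f := by
    funext t
    rw [intervalIntegral.integral_interval_sub_left (hint _ _) (hint _ _)]
  rw [hsplit]
  have hF : ∀ x, HasDerivAt (fun y : ℝ => ∫ s in (0:ℝ)..y, U s f) (U x f) x := fun x =>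
    intervalIntegral.integral_hasDerivAt_right (hint 0 x)
      (hU.strong_continuity f).aestronglyMeasurable.stronglyMeasurableAtFilter
      (hU.strong_continuity f).continuousAt
  refine HasDerivAt.sub ?_ (hF 0)
  have := HasDerivAt.comp_const_add (f := fun y : ℝ => ∫ s in (0:ℝ)..y, U s f) h 0 (hF (h + 0))
  simpa using this

/-- A unitary group is determined by its generator. -/
theorem eq_of_generator (hU : IsUnitaryGroup U) (hV : IsUnitaryGroup V)
    (h : ∀ f g, HasDerivAt (fun t => U t f) g 0 → HasDerivAt (fun t => V t f) g 0) : U = V := by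
  have key : ∀ f g, HasDerivAt (fun t => U t f) g 0 → ∀ t, V (-t) (U t f) = f := by
    intro f g hf t
    have hd : ∀ t, HasDerivAt (fun t => V (-t) (U t f)) 0 t := by
      intro t
      have hU' := hU.hasDerivAt_apply_apply hf t
      have hV' := h _ _ hU'
      have hdiff := (hU'.sub hV').tendsto_slope_zero
      rw [hasDerivAt_iff_tendsto_slope_zero]
      rw [sub_self] at hdiff
      rw [tendsto_zero_iff_norm_tendsto_zero] at hdiff ⊢
      refine hdiff.congr fun s => ?_
      -- The increment of V(-t) U(t) f is an isometric image of (U_s - V_s) U_t f, and both groups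
      -- have the same derivative at 0 on U_t f.
      have e : V (-(t + s)) (U (t + s) f) - V (-t) (U t f)
         = V (-(t + s)) (U s (U t f) - V s (U t f)) := by
       rw [map_sub, ← hV.add_apply, ← hU.add_apply, neg_add, neg_add_cancel_right,
         add_comm s t]
      rw [e, norm_smul, norm_smul, hV.norm_map]
      simp [hU.zero_apply, hV.zero_apply]
    have hc := is_const_of_deriv_eq_zero (fun t => (hd t).differentiableAt)
      (fun t => (hd t).deriv) t 0
    simpa [hU.zero_apply, hV.zero_apply] using hc
  funext t
  ext f
  have hcl : IsClosed {f | U t f = V t f} := isClosed_eq (U t).continuous (V t).continuous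
  have : closure {f : H | ∃ g, HasDerivAt (fun t => U t f) g 0} ⊆ {f | U t f = V t f} := by
    refine hcl.closure_subset_iff.2 ?_
    rintro f ⟨g, hg⟩
    have := congrArg (V t) (key f g hg t)
    rwa [hV.apply_neg_apply] at this
  exact this (hU.dense_domain f)

end IsUnitaryGroup
end groups

/-! ### Bounded skew perturbations of generators -/

section perturbation
variable {H : Type*} [NormedAddCommGroup H] [InnerProductSpace ℂ H] [CompleteSpace H]
namespace IsUnitaryGroup
variable {U : ℝ → H →L[ℂ] H}

/-- Bounded skew-adjoint perturbations of the generator of a unitary group, by means of the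
interaction picture. -/
theorem exists_perturbation (hU : IsUnitaryGroup U) (B : H →L[ℂ] H)
    (hB : ∀ x, (inner ℂ x (B x)).re = 0) :
    ∃ V : ℝ → H →L[ℂ] H, IsUnitaryGroup V ∧
      (∀ f g, HasDerivAt (fun t => V t f) g 0 ↔ HasDerivAt (fun t => U t f) (g - B f) 0) ∧
      ∀ f t, HasDerivAt (fun s => U (-s) (V s f)) (U (-t) (B (V t f))) t := by
  have hskew : ∀ t x, (inner ℂ x (U (-t) (B (U t x)))).re = 0 := fun t x => by
    rw [hU.inner_apply_right, neg_neg, hB]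
  have hcont : ∀ x, Continuous fun t => U (-t) (B (U t x)) := fun x =>
    hU.continuous_apply continuous_neg (B.continuous.comp (hU.strong_continuity x))
  -- The interaction-picture equation v' = U(-t) B U(t) v is Lipschitz with constant ‖B‖, however
  -- unbounded the generator of U is. The radius ‖x₀‖ + 1 is positive also for x₀ = 0.
  have hex : ∀ x₀ : H, ∃ v : ℝ → H, v 0 = x₀ ∧
      ∀ t, HasDerivAt v (U (-t) (B (U t (v t)))) t ∧ ‖v t‖ = ‖x₀‖ := fun x₀ => by
    refine exists_skew_solution (F := fun t x => U (-t) (B (U t x))) (R := ‖x₀‖ + 1) (K := ‖B‖₊)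
      (by positivity) hcont (fun t => LipschitzWith.lipschitzOnWith ?_) hskew (by linarith)
    refine LipschitzWith.of_dist_le_mul fun x y => ?_
    rw [dist_eq_norm, dist_eq_norm, ← map_sub, ← map_sub, ← map_sub, hU.norm_map]
    refine (B.le_opNorm _).trans_eq ?_
    rw [hU.norm_map]; rfl
  choose v hv0 hv using hex
  -- The equation is linear and skew, so the difference of two solutions has constant norm.
  -- Linearity in the initial value and the group law both follow from this uniqueness.
  have huniq : ∀ (x : H) (w : ℝ → H), w 0 = x →
      (∀ t, HasDerivAt w (U (-t) (B (U t (w t)))) t) → ∀ t, w t = v x t := by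
    intro x w hw0 hw t
    have hd : ∀ t, HasDerivAt (fun t => w t - v x t) (U (-t) (B (U t (w t - v x t)))) t :=
      fun t => by simp only [map_sub]; exact (hw t).sub (hv x t).1
    have ht : t ∈ Set.Icc (-|t|) |t| := abs_le.1 le_rfl
    have h0 : (0:ℝ) ∈ Set.Icc (-|t|) |t| := ⟨by simp, abs_nonneg t⟩
    have := norm_eq_of_skew h0 (fun t _ => (hd t).hasDerivWithinAt) (fun t _ => hskew t _) ht
    rwa [hw0, hv0, sub_self, norm_zero, norm_eq_zero, sub_eq_zero] at this
  have hadd : ∀ x y t, v (x + y) t = v x t + v y t := fun x y t => by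
    refine (huniq _ (fun t => v x t + v y t) (by rw [hv0, hv0]) (fun t => ?_) t).symm
    simp only [map_add]; exact (hv x t).1.add (hv y t).1
  have hsmul : ∀ (c : ℂ) x t, v (c • x) t = c • v x t := fun c x t => by
    refine (huniq _ (fun t => c • v x t) (by rw [hv0]) (fun t => ?_) t).symm
    simp only [map_smul]; exact (hv x t).1.const_smul c
  let V : ℝ → H →L[ℂ] H := fun t => U t ∘L LinearMap.mkContinuous
    { toFun := fun x => v x t, map_add' := fun x y => hadd x y t, map_smul' := fun c x => hsmul c x t}
    1 (fun x => by simpa using (hv x t).2.le)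
  have hV : ∀ t x, V t x = U t (v x t) := fun t x => rfl
  have hVg : IsUnitaryGroup V := by
    refine of_isometry (fun f => ?_) (fun t f => ?_) (fun s t f => ?_) (fun f => ?_)
    · rw [hV, hv0, hU.zero_apply]
    · rw [hV, hU.norm_map, (hv f t).2]
    -- The shifted curve s ↦ U_t v(s + t) solves the same equation, started from V_t f.
    · have := huniq (V t f) (fun s => U t (v f (s + t))) (by simp only [zero_add]; rfl)
        (fun r => ?_) s
      · rw [hV s, ← this, hV, ← hU.add_apply]
      · have h1 : HasDerivAt (fun s => v f (s + t)) (U (-(r + t)) (B (U (r + t) (v f (r + t))))) r :=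
          HasDerivAt.comp_add_const r t (hv f (r + t)).1
        have h2 := ((U t).restrictScalars ℝ).hasFDerivAt.comp_hasDerivAt r h1
        refine HasDerivAt.congr_deriv (f := fun s => U t (v f (s + t))) h2 ?_
        rw [ContinuousLinearMap.coe_restrictScalars', ← hU.add_apply, ← hU.add_apply]
        congr 2
        ring
    · exact hU.continuous_apply continuous_id
        (continuous_iff_continuousAt.2 fun t => (hv f t).1.continuousAt)
  refine ⟨V, hVg, fun f g => ?_, fun f t => ?_⟩
  -- The slope of V at 0 is that of U plus a term tending to B f for every f. One slope converges
  -- exactly when the other does, so the two domains agree.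
  · have hlim : Tendsto (fun t => U t (t⁻¹ • (v f t - v f 0))) (𝓝[≠] 0) (𝓝 (B f)) := by
      have h1 := (hv f 0).1.tendsto_slope_zero
      simp only [zero_add, neg_zero, hU.zero_apply, hv0] at h1
      have h2 : Tendsto (fun t => U t (t⁻¹ • (v f t - f) - B f)) (𝓝[≠] 0) (𝓝 0) := by
        rw [tendsto_zero_iff_norm_tendsto_zero]
        simp only [hU.norm_map]
        exact tendsto_iff_norm_sub_tendsto_zero.1 h1
      have h3 : Tendsto (fun t => U t (B f)) (𝓝[≠] 0) (𝓝 (B f)) := by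
        have := ((hU.strong_continuity (B f)).tendsto 0).mono_left
          (nhdsWithin_le_nhds (s := {0}ᶜ))
        rwa [hU.zero_apply] at this
      have h4 := h2.add h3
      simpa [hv0] using h4
    have hid : ∀ t : ℝ, t⁻¹ • (V (0 + t) f - V 0 f)
        = U t (t⁻¹ • (v f t - v f 0)) + t⁻¹ • (U (0 + t) f - U 0 f) := by
      intro t
      have : U t (t⁻¹ • (v f t - v f 0)) = t⁻¹ • U t (v f t - v f 0) :=
        ((U t).restrictScalars ℝ).map_smul _ _
      rw [this, ← smul_add, map_sub, zero_add, hV, hVg.zero_apply, hU.zero_apply, hv0,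
        sub_add_sub_cancel]
    rw [hasDerivAt_iff_tendsto_slope_zero, hasDerivAt_iff_tendsto_slope_zero]
    simp only [hid]
    constructor
    · intro h
      simpa using h.sub hlim
    · intro h
      simpa using hlim.add h
  · simp only [hV, hU.neg_apply_apply]
    exact (hv f t).1

end IsUnitaryGroup
end perturbation

/-! ### Multiplication operators -/

section mulOp
variable {α : Type*} [MeasurableSpace α] {μ : Measure α}

/-- Multiplication by an essentially bounded function on `L²`. -/
def mulOp (F : α → ℂ) (hF : MemLp F ∞ μ) : L2 μ →L[ℂ] L2 μ :=
  LinearMap.mkContinuous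
    { toFun := fun f => ((Lp.memLp f).mul hF : MemLp (F * (f : α → ℂ)) 2 μ).toLp _
      map_add' := fun f g => by
        apply Lp.ext
        filter_upwards [MemLp.coeFn_toLp ((Lp.memLp (f + g)).mul hF : MemLp (F * _) 2 μ),
          MemLp.coeFn_toLp ((Lp.memLp f).mul hF : MemLp (F * _) 2 μ),
          MemLp.coeFn_toLp ((Lp.memLp g).mul hF : MemLp (F * _) 2 μ), Lp.coeFn_add f g,
          Lp.coeFn_add (((Lp.memLp f).mul hF : MemLp (F * _) 2 μ).toLp _)
            (((Lp.memLp g).mul hF : MemLp (F * _) 2 μ).toLp _)] with x h1 h2 h3 h4 h5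
        rw [h1, h5, Pi.add_apply, h2, h3, Pi.mul_apply, h4]
        simp [mul_add]
      map_smul' := fun c f => by
        apply Lp.ext
        filter_upwards [MemLp.coeFn_toLp ((Lp.memLp (c • f)).mul hF : MemLp (F * _) 2 μ),
          MemLp.coeFn_toLp ((Lp.memLp f).mul hF : MemLp (F * _) 2 μ), Lp.coeFn_smul c f,
          Lp.coeFn_smul c (((Lp.memLp f).mul hF : MemLp (F * _) 2 μ).toLp _)] with x h1 h2 h3 h4
        simp only [RingHom.id_apply]
        rw [h1, h4, Pi.smul_apply, h2, Pi.mul_apply, h3]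
        simp [mul_left_comm] }
    (eLpNorm F ∞ μ).toReal fun f => by
      refine Lp.norm_le_mul_norm_of_ae_le_mul ?_
      filter_upwards [MemLp.coeFn_toLp ((Lp.memLp f).mul hF : MemLp (F * _) 2 μ),
        ae_le_eLpNormEssSup (f := F) (μ := μ)] with x h1 h2
      have h3 : ‖F x‖ ≤ (eLpNorm F ∞ μ).toReal := by
        rw [← toReal_enorm]
        exact ENNReal.toReal_mono hF.2.ne (by simpa using h2)
      simp only [LinearMap.coe_mk, AddHom.coe_mk]
      rw [h1, Pi.mul_apply, norm_mul]
      exact mul_le_mul_of_nonneg_right h3 (norm_nonneg _)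

theorem coeFn_mulOp (F : α → ℂ) (hF : MemLp F ∞ μ) (f : L2 μ) :
    mulOp F hF f =ᵐ[μ] fun x => F x * f x :=
  MemLp.coeFn_toLp ((Lp.memLp f).mul hF : MemLp (F * _) 2 μ)

theorem norm_mulOp_apply_le {F : α → ℂ} (hF : MemLp F ∞ μ) {M : ℝ} (hM : ∀ᵐ x ∂μ, ‖F x‖ ≤ M)
    (f : L2 μ) : ‖mulOp F hF f‖ ≤ M * ‖f‖ := by
  refine Lp.norm_le_mul_norm_of_ae_le_mul ?_
  filter_upwards [coeFn_mulOp F hF f, hM] with x h1 h2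
  rw [h1, norm_mul]
  exact mul_le_mul_of_nonneg_right h2 (norm_nonneg _)

theorem mulOp_congr {F G : α → ℂ} (hF : MemLp F ∞ μ) (hG : MemLp G ∞ μ) (h : F =ᵐ[μ] G) :
    mulOp F hF = mulOp G hG := by
  ext1 f
  apply Lp.ext
  filter_upwards [coeFn_mulOp F hF f, coeFn_mulOp G hG f, h] with x h1 h2 h3
  rw [h1, h2, h3]

theorem inner_mulOp_ofReal {F : α → ℝ} (hF : MemLp (fun x => (F x : ℂ)) ∞ μ) (f g : L2 μ) :
    inner ℂ (mulOp _ hF f) g = inner ℂ f (mulOp _ hF g) := by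
  rw [L2.inner_def, L2.inner_def]
  apply integral_congr_ae
  filter_upwards [coeFn_mulOp _ hF f, coeFn_mulOp _ hF g] with x h1 h2
  rw [h1, h2]
  simp
  ring

end mulOp

/-! ### Operators acting on one tensor factor -/

section pull
variable {α β γ : Type*} [MeasurableSpace α] [MeasurableSpace β] [MeasurableSpace γ]
  {μ : Measure α} {ν : Measure β} {ρ : Measure γ}

/-- The unitary `f ↦ f ∘ e` for a measure preserving equivalence `e`. -/
def pull (e : α ≃ᵐ β) (he : MeasurePreserving e μ ν) : L2 ν ≃ₗᵢ[ℂ] L2 μ :=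
  { Lp.compMeasurePreservingₗᵢ ℂ e he with
    invFun := Lp.compMeasurePreservingₗᵢ ℂ e.symm he.symm
    left_inv := fun f => by
      apply Lp.ext
      have h1 := Lp.coeFn_compMeasurePreserving (Lp.compMeasurePreserving e he f) he.symm
      have h2 := he.symm.quasiMeasurePreserving.ae (Lp.coeFn_compMeasurePreserving f he)
      filter_upwards [h1, h2] with x h1 h2
      refine h1.trans (h2.trans ?_)
      simp
    right_inv := fun f => by
      apply Lp.ext
      have h1 := Lp.coeFn_compMeasurePreserving (Lp.compMeasurePreserving e.symm he.symm f) he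
      have h2 := he.quasiMeasurePreserving.ae (Lp.coeFn_compMeasurePreserving f he.symm)
      filter_upwards [h1, h2] with x h1 h2
      refine h1.trans (h2.trans ?_)
      simp }

theorem coeFn_pull (e : α ≃ᵐ β) (he : MeasurePreserving e μ ν) (f : L2 ν) :
    pull e he f =ᵐ[μ] fun x => f (e x) := Lp.coeFn_compMeasurePreserving f he

theorem pull_mulOp (e : α ≃ᵐ β) (he : MeasurePreserving e μ ν) {F : β → ℂ} (hF : MemLp F ∞ ν)
    (hF' : MemLp (fun x => F (e x)) ∞ μ) (f : L2 ν) :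
    pull e he (mulOp F hF f) = mulOp _ hF' (pull e he f) := by
  apply Lp.ext
  filter_upwards [coeFn_pull e he (mulOp F hF f), coeFn_mulOp _ hF' (pull e he f),
    coeFn_pull e he f, he.quasiMeasurePreserving.ae (coeFn_mulOp F hF f)] with x h1 h2 h3 h4
  rw [h1, h2, h3, h4]

variable [SigmaFinite ν] [SigmaFinite ρ]

theorem ext_mulProd {X : Type*} [NormedAddCommGroup X] [NormedSpace ℂ X]
    {S T : L2 (ν.prod ρ) →L[ℂ] X} (h : ∀ f g, S (mulProd f g) = T (mulProd f g)) : S = T := by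
  refine ContinuousLinearMap.coeFn_injective
    (denseRange_tensorProd.equalizer S.continuous T.continuous (funext fun x => ?_))
  induction x with
  | zero => simp
  | add x y hx hy => simpa using congrArg₂ (· + ·) hx hy
  | tmul f g => simpa [tensorProd_tmul] using h f g

variable (e : α ≃ᵐ β × γ) (he : MeasurePreserving e μ (ν.prod ρ))

/-- The function `x ↦ f (e x).1 * g (e x).2`. -/
def tens (f : L2 ν) (g : L2 ρ) : L2 μ := pull e he (mulProd f g)

theorem coeFn_tens (f : L2 ν) (g : L2 ρ) :
    tens e he f g =ᵐ[μ] fun x => f (e x).1 * g (e x).2 := by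
  filter_upwards [coeFn_pull e he (mulProd f g),
    he.quasiMeasurePreserving.ae (coeFn_mulProd f g)] with x h1 h2
  exact h1.trans h2

theorem inner_tens (f f' : L2 ν) (g g' : L2 ρ) :
    inner ℂ (tens e he f g) (tens e he f' g') = inner ℂ f f' * inner ℂ g g' := by
  rw [tens, tens, LinearIsometryEquiv.inner_map_map, inner_mulProd]

theorem norm_tens (f : L2 ν) (g : L2 ρ) : ‖tens e he f g‖ = ‖f‖ * ‖g‖ := by
  have h := inner_tens e he f f g g
  simp only [inner_self_eq_norm_sq_to_K] at h
  have h2 : ‖tens e he f g‖ ^ 2 = (‖f‖ * ‖g‖) ^ 2 := by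
    rw [mul_pow]; exact_mod_cast h
  exact (pow_left_inj₀ (norm_nonneg _) (by positivity) two_ne_zero).1 h2

theorem tens_add_left (f f' : L2 ν) (g : L2 ρ) :
    tens e he (f + f') g = tens e he f g + tens e he f' g := by
  rw [tens, tens, tens, ← map_add]; congr 1; exact LinearMap.map_add₂ mulProdₗ f f' g

theorem tens_add_right (f : L2 ν) (g g' : L2 ρ) :
    tens e he f (g + g') = tens e he f g + tens e he f g' := by
  rw [tens, tens, tens, ← map_add]; congr 1; exact (mulProdₗ f).map_add g g'

theorem tens_smul_left (c : ℂ) (f : L2 ν) (g : L2 ρ) :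
    tens e he (c • f) g = c • tens e he f g := by
  rw [tens, tens, ← map_smul]; congr 1; exact LinearMap.map_smul₂ mulProdₗ c f g

theorem tens_smul_right (c : ℂ) (f : L2 ν) (g : L2 ρ) :
    tens e he f (c • g) = c • tens e he f g := by
  rw [tens, tens, ← map_smul]; congr 1; exact (mulProdₗ f).map_smul c g

/-- `tens` as a continuous bilinear map. -/
def tensL : L2 ν →L[ℂ] L2 ρ →L[ℂ] L2 μ :=
  LinearMap.mkContinuous₂ (LinearMap.mk₂ ℂ (tens e he) (tens_add_left e he) (tens_smul_left e he)
    (tens_add_right e he) (tens_smul_right e he)) 1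
    (fun f g => by rw [one_mul]; exact (norm_tens e he f g).le)

theorem tensL_apply (f : L2 ν) (g : L2 ρ) : tensL e he f g = tens e he f g := rfl

theorem ext_tens {X : Type*} [NormedAddCommGroup X] [NormedSpace ℂ X]
    {S T : L2 μ →L[ℂ] X} (h : ∀ f g, S (tens e he f g) = T (tens e he f g)) : S = T := by
  have h1 : S ∘L (pull e he).toContinuousLinearEquiv.toContinuousLinearMap
      = T ∘L (pull e he).toContinuousLinearEquiv.toContinuousLinearMap := ext_mulProd h
  ext1 x
  have h2 := DFunLike.congr_fun h1 ((pull e he).symm x)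
  simpa using h2

/-- The operator `b ⊗ 1` on `L²(μ)`, where `μ` is identified with `ν × ρ`. -/
def ampl (b : L2 ν →L[ℂ] L2 ν) : L2 μ →L[ℂ] L2 μ :=
  (pull e he).toContinuousLinearEquiv.toContinuousLinearMap ∘L amplifyProd b ∘L
    (pull e he).symm.toContinuousLinearEquiv.toContinuousLinearMap

theorem ampl_tens (b : L2 ν →L[ℂ] L2 ν) (f : L2 ν) (g : L2 ρ) :
    ampl e he b (tens e he f g) = tens e he (b f) g := by
  simp [ampl, tens, amplifyProd_mulProd]

/-- The bound holds on the algebraic tensor product, and it survives the extension by density and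
the unitary change of variables. -/
theorem norm_ampl_apply_le (b : L2 ν →L[ℂ] L2 ν) (x : L2 μ) : ‖ampl e he b x‖ ≤ ‖b‖ * ‖x‖ := by
  have h : ‖amplifyProd (ν := ρ) b‖ ≤ ‖b‖ := by
    have h1 := ContinuousLinearMap.opNorm_extend_le (N := 1)
      ((tensorProd (μ := ν) (ν := ρ)).toContinuousLinearMap ∘L b.rTensor (L2 ρ))
      (e := (tensorProd (μ := ν) (ν := ρ)).toContinuousLinearMap) denseRange_tensorProd
      (fun x => by simp)
    refine h1.trans ?_
    rw [NNReal.coe_one, one_mul]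
    refine (ContinuousLinearMap.opNorm_le_bound _ (norm_nonneg _) fun x => ?_)
    simp only [ContinuousLinearMap.comp_apply, LinearIsometry.coe_toContinuousLinearMap,
      LinearIsometry.norm_map]
    exact (ContinuousLinearMap.le_opNorm _ _).trans
      (mul_le_mul_of_nonneg_right (ContinuousLinearMap.norm_rTensor_le (L2 ρ) b) (norm_nonneg _))
  have h2 : ‖ampl e he b x‖ = ‖amplifyProd b ((pull e he).symm x)‖ :=
    (pull e he).norm_map _
  rw [h2]
  refine (ContinuousLinearMap.le_opNorm _ _).trans ?_
  rw [LinearIsometryEquiv.norm_map]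
  exact mul_le_mul_of_nonneg_right h (norm_nonneg _)

theorem ampl_add (b c : L2 ν →L[ℂ] L2 ν) : ampl e he (b + c) = ampl e he b + ampl e he c := by
  refine ext_tens e he fun f g => ?_
  simp [ampl_tens, tens_add_left]

theorem ampl_smul (k : ℂ) (b : L2 ν →L[ℂ] L2 ν) : ampl e he (k • b) = k • ampl e he b := by
  refine ext_tens e he fun f g => ?_
  simp [ampl_tens, tens_smul_left]

theorem ampl_comp (b c : L2 ν →L[ℂ] L2 ν) : ampl e he (b ∘L c) = ampl e he b ∘L ampl e he c := by
  refine ext_tens e he fun f g => ?_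
  simp [ampl_tens]

theorem inner_ampl_left (b : L2 ν →L[ℂ] L2 ν) (x y : L2 μ) :
    inner ℂ (ampl e he b x) y = inner ℂ x (ampl e he (ContinuousLinearMap.adjoint b) y) := by
  have h1 : ContinuousLinearMap.adjoint (ampl e he b)
      = ampl e he (ContinuousLinearMap.adjoint b) := by
    refine ext_tens e he fun f g => ext_inner_right ℂ fun y => ?_
    have : innerSL ℂ (ContinuousLinearMap.adjoint (ampl e he b) (tens e he f g))
        = innerSL ℂ (ampl e he (ContinuousLinearMap.adjoint b) (tens e he f g)) := by
      refine ext_tens e he fun f' g' => ?_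
      simp [ContinuousLinearMap.adjoint_inner_left, ampl_tens, inner_tens]
    simpa using DFunLike.congr_fun this y
  rw [← h1, ContinuousLinearMap.adjoint_inner_right]

/-- `ampl` as a continuous linear map. -/
def amplL : (L2 ν →L[ℂ] L2 ν) →L[ℂ] (L2 μ →L[ℂ] L2 μ) :=
  LinearMap.mkContinuous
    { toFun := ampl e he, map_add' := ampl_add e he, map_smul' := ampl_smul e he } 1
    (fun b => by
      rw [one_mul]
      exact ContinuousLinearMap.opNorm_le_bound _ (norm_nonneg _) (norm_ampl_apply_le e he b))

/-- `b ⊗ 1` commutes with multiplication by functions of the second variable. -/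
theorem ampl_mulOp_comm (b : L2 ν →L[ℂ] L2 ν) {G : γ → ℂ} (hG : MemLp G ∞ ρ)
    (hG' : MemLp (fun x => G (e x).2) ∞ μ) (x : L2 μ) :
    ampl e he b (mulOp _ hG' x) = mulOp _ hG' (ampl e he b x) := by
  have h : ∀ f g, mulOp _ hG' (tens e he f g) = tens e he f (mulOp G hG g) := fun f g => by
    apply Lp.ext
    have h5 := he.quasiMeasurePreserving.ae (ae_snd (μ := ν) (coeFn_mulOp G hG g))
    filter_upwards [coeFn_mulOp _ hG' (tens e he f g), coeFn_tens e he f g,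
      coeFn_tens e he f (mulOp G hG g), h5] with x h1 h2 h3 h4
    rw [h1, h2, h3, h4]; ring
  have : ampl e he b ∘L mulOp _ hG' = mulOp _ hG' ∘L ampl e he b := by
    refine ext_tens e he fun f g => ?_
    simp [ampl_tens, h]
  exact DFunLike.congr_fun this x

theorem ampl_mulOp {V : β → ℂ} (hV : MemLp V ∞ ν) (hV' : MemLp (fun x => V (e x).1) ∞ μ) :
    ampl e he (mulOp V hV) = mulOp _ hV' := by
  refine ext_tens e he fun f g => ?_
  rw [ampl_tens]
  apply Lp.ext
  have h5 := he.quasiMeasurePreserving.ae (ae_fst (ν := ρ) (coeFn_mulOp V hV f))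
  filter_upwards [coeFn_mulOp _ hV' (tens e he f g), coeFn_tens e he f g,
    coeFn_tens e he (mulOp V hV f) g, h5] with x h1 h2 h3 h4
  rw [h1, h2, h3, h4]; ring

open InnerProductSpace in
/-- `(|u⟩⟨u| ⊗ 1) F (|u⟩⟨u| ⊗ 1)` is the multiplication by the average of `F` over `|u|²` in the
first variable, times `|u⟩⟨u| ⊗ 1`. -/
theorem ampl_rankOne_mulOp_ampl_rankOne (u : L2 ν) {F : β × γ → ℂ} {G : γ → ℂ}
    (hF : MemLp F ∞ (ν.prod ρ)) (hF' : MemLp (fun x => F (e x)) ∞ μ) (hG : MemLp G ∞ ρ)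
    (hG' : MemLp (fun x => G (e x).2) ∞ μ)
    (hFG : ∀ z, G z = ∫ y, F (y, z) * (‖u y‖ ^ 2 : ℝ) ∂ν) (x : L2 μ) :
    ampl e he (rankOne ℂ u u) (mulOp _ hF' (ampl e he (rankOne ℂ u u) x))
      = mulOp _ hG' (ampl e he (rankOne ℂ u u) x) := by
  -- Fubini, integrating first over the first variable: there |u|² meets F and produces G.
  have key : ∀ g g', inner ℂ (mulProd u g') (mulOp F hF (mulProd u g))
      = inner ℂ g' (mulOp G hG g) := fun g g' => by
    have hae : (fun z : β × γ => inner ℂ (mulProd u g' z) (mulOp F hF (mulProd u g) z))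
        =ᵐ[ν.prod ρ] fun z => F z * (‖u z.1‖ ^ 2 : ℝ) * (inner ℂ (g' z.2) (g z.2)) := by
      filter_upwards [coeFn_mulProd u g', coeFn_mulProd u g, coeFn_mulOp F hF (mulProd u g)]
        with z h1 h2 h3
      rw [h1, h3, h2]
      have h4 : (starRingEnd ℂ) (u z.1) * u z.1 = (‖u z.1‖ ^ 2 : ℝ) := by
        rw [Complex.conj_mul', Complex.ofReal_pow]
      simp only [RCLike.inner_apply, map_mul]
      rw [← h4]; ring
    rw [L2.inner_def, L2.inner_def, integral_congr_ae hae,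
      integral_prod_symm _ ((L2.integrable_inner _ _).congr hae)]
    apply integral_congr_ae
    filter_upwards [coeFn_mulOp G hG g] with z h1
    rw [integral_mul_const, ← hFG, h1]
    simp only [RCLike.inner_apply]
    ring
  have key' : ∀ g, ampl e he (rankOne ℂ u u) (mulOp _ hF' (tens e he u g))
      = mulOp _ hG' (tens e he u g) := fun g => by
    have h1 : mulOp _ hG' (tens e he u g) = tens e he u (mulOp G hG g) := by
      apply Lp.ext
      have h5 := he.quasiMeasurePreserving.ae (ae_snd (μ := ν) (coeFn_mulOp G hG g))
      filter_upwards [coeFn_mulOp _ hG' (tens e he u g), coeFn_tens e he u g,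
        coeFn_tens e he u (mulOp G hG g), h5] with x h1 h2 h3 h4
      rw [h1, h2, h3, h4]; ring
    rw [h1]
    refine ext_inner_right ℂ fun y => ?_
    have : innerSL ℂ (ampl e he (rankOne ℂ u u) (mulOp _ hF' (tens e he u g)))
        = innerSL ℂ (tens e he u (mulOp G hG g)) := by
      refine ext_tens e he fun f' g' => ?_
      have key2 := congrArg (starRingEnd ℂ) (key g g')
      simp only [inner_conj_symm] at key2
      rw [innerSL_apply_apply, innerSL_apply_apply, inner_tens, inner_ampl_left, adjoint_rankOne,
        ampl_tens, rankOne_apply, tens_smul_left, inner_smul_right, tens, tens,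
        ← pull_mulOp e he hF, LinearIsometryEquiv.inner_map_map, key2]
    simpa using DFunLike.congr_fun this y
  have : ampl e he (rankOne ℂ u u) ∘L mulOp _ hF' ∘L ampl e he (rankOne ℂ u u)
      = mulOp _ hG' ∘L ampl e he (rankOne ℂ u u) := by
    refine ext_tens e he fun f g => ?_
    simp only [ContinuousLinearMap.comp_apply, ampl_tens, rankOne_apply, tens_smul_left, map_smul,
      key']
  exact DFunLike.congr_fun this x

end pull

/-! ### Product functions and one-particle operators -/

section config
open InnerProductSpace

theorem memLp_prodFun {N : ℕ} (f : Fin N → L2Space) :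
    MemLp (fun x : Config N => ∏ i, f i (particle i x)) 2 volume := by
  induction N with
  | zero =>
    have : IsFiniteMeasure (volume : Measure (Config 0)) := by
      rw [volume_euclideanSpace_eq_dirac]; infer_instance
    simp
  | succ n ih =>
    have h := (memLp_mul_prod (ih fun i => f i.castSucc)
      ((Lp.memLp (f (Fin.last n))).comp_measurePreserving
        measurePreserving_particle_one)).comp_measurePreserving (measurePreserving_splitConfig n 1)
    refine h.ae_eq (Eventually.of_forall fun x => ?_)
    symm
    dsimp only
    rw [Fin.prod_univ_castSucc]
    rfl

/-- The function `(x_1, …, x_N) ↦ f_1(x_1) ⋯ f_N(x_N)`. -/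
def prodFun {N : ℕ} (f : Fin N → L2Space) : L2Config N := (memLp_prodFun f).toLp _

theorem coeFn_prodFun {N : ℕ} (f : Fin N → L2Space) :
    prodFun f =ᵐ[volume] fun x : Config N => ∏ i, f i (particle i x) := MemLp.coeFn_toLp _

theorem coe_productState (ψ : L2Space) (N : ℕ) :
    (productState ψ N : L2Config N) = prodFun fun _ => ψ := rfl

/-- The identification `ℝ^{3(n+1)} = ℝ³ × ℝ^{3n}` singling out the `j`-th particle. -/
def singleOut {n : ℕ} (j : Fin (n + 1)) : Config (n + 1) ≃ᵐ Space × Config n where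
  toFun x := (particle j x, WithLp.toLp 2 fun ik => x (j.succAbove ik.1, ik.2))
  invFun z := WithLp.toLp 2 fun lk =>
    j.insertNth (α := fun _ => ℝ) (z.1 lk.2) (fun i => z.2 (i, lk.2)) lk.1
  left_inv x := by
    ext ⟨l, k⟩
    refine Fin.succAboveCases j ?_ (fun i => ?_) l <;> simp [particle]
  right_inv z := by
    ext <;> simp [particle]
  measurable_toFun := by
    simp only [Equiv.coe_fn_mk, particle]
    fun_prop
  measurable_invFun := by
    simp only [Equiv.coe_fn_symm_mk]
    refine (WithLp.measurable_toLp 2 _).comp (measurable_pi_lambda _ fun ⟨l, k⟩ => ?_)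
    refine Fin.succAboveCases j ?_ (fun i => ?_) l <;> simp <;> fun_prop

/-- The relabelling of coordinates underlying `singleOut`. -/
def singleOutIndex {n : ℕ} (j : Fin (n + 1)) : Fin 3 ⊕ (Fin n × Fin 3) ≃ Fin (n + 1) × Fin 3 where
  toFun := Sum.elim (fun k => (j, k)) (fun ik => (j.succAbove ik.1, ik.2))
  invFun lk := j.insertNth (α := fun _ => Fin 3 ⊕ (Fin n × Fin 3)) (Sum.inl lk.2)
    (fun i => Sum.inr (i, lk.2)) lk.1
  left_inv := by
    rintro (k | ⟨i, k⟩) <;> simp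
  right_inv := by
    rintro ⟨l, k⟩
    refine Fin.succAboveCases j ?_ (fun i => ?_) l <;> simp

theorem measurePreserving_singleOut {n : ℕ} (j : Fin (n + 1)) :
    MeasurePreserving (singleOut j) := by
  have h1 := (LinearIsometryEquiv.piLpCongrLeft 2 ℝ ℝ (singleOutIndex j).symm).measurePreserving
  have h2 := (PiLp.sumPiLpEquivProdLpPiLp 2 (𝕜 := ℝ)
    (fun _ : (Fin 3) ⊕ (Fin n × Fin 3) => ℝ)).measurePreserving
  exact (WithLp.volume_preserving_ofLp _ _).comp (h2.comp h1)

theorem measurable_particle {N : ℕ} (i : Fin N) : Measurable (particle i : Config N → Space) := by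
  unfold particle
  fun_prop

theorem quasiMeasurePreserving_particle {n : ℕ} (j : Fin (n + 1)) :
    Measure.QuasiMeasurePreserving (particle j : Config (n + 1) → Space) :=
  Measure.quasiMeasurePreserving_fst.comp (measurePreserving_singleOut j).quasiMeasurePreserving

theorem prodFun_eq_tens {n : ℕ} (j : Fin (n + 1)) (f : Fin (n + 1) → L2Space) :
    prodFun f = tens (singleOut j) (measurePreserving_singleOut j) (f j)
      (prodFun fun i => f (j.succAbove i)) := by
  apply Lp.ext
  filter_upwards [coeFn_prodFun f, coeFn_tens (singleOut j) (measurePreserving_singleOut j) (f j)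
    (prodFun fun i => f (j.succAbove i)),
    (measurePreserving_singleOut j).quasiMeasurePreserving.ae (ae_snd (μ := volume)
      (coeFn_prodFun fun i => f (j.succAbove i)))] with x h1 h2 h3
  rw [h1, h2, h3, Fin.prod_univ_succAbove _ j]
  rfl

theorem prodFun_eq_tens_split {p m : ℕ} (f : Fin (p + m) → L2Space) :
    prodFun f = tens (splitConfig p m) (measurePreserving_splitConfig p m)
      (prodFun fun i => f (Fin.castAdd m i)) (prodFun fun i => f (Fin.natAdd p i)) := by
  apply Lp.ext
  filter_upwards [coeFn_prodFun f, coeFn_tens (splitConfig p m) (measurePreserving_splitConfig p m)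
    (prodFun fun i => f (Fin.castAdd m i)) (prodFun fun i => f (Fin.natAdd p i)),
    (measurePreserving_splitConfig p m).quasiMeasurePreserving.ae (ae_snd (μ := volume)
      (coeFn_prodFun fun i => f (Fin.natAdd p i))),
    (measurePreserving_splitConfig p m).quasiMeasurePreserving.ae (ae_fst (ν := volume)
      (coeFn_prodFun fun i => f (Fin.castAdd m i)))] with x h1 h2 h3 h4
  rw [h1, h2, h3, h4, Fin.prod_univ_add]
  rfl

theorem amplify_eq_ampl (p m : ℕ) (a : L2Config p →L[ℂ] L2Config p) :
    amplify p m a = ampl (splitConfig p m) (measurePreserving_splitConfig p m) a := rfl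

theorem norm_prodFun {N : ℕ} (f : Fin N → L2Space) : ‖prodFun f‖ = ∏ i, ‖f i‖ := by
  induction N with
  | zero =>
    rw [Fin.prod_univ_zero, Lp.norm_def, eLpNorm_congr_ae (coeFn_prodFun f)]
    simp only [Finset.univ_eq_empty, Finset.prod_empty]
    rw [volume_euclideanSpace_eq_dirac, eLpNorm_const _ (by norm_num) (by simp)]
    simp
  | succ n ih => rw [prodFun_eq_tens 0, norm_tens, ih, Fin.prod_univ_succ]; rfl

theorem continuous_prodFun {N : ℕ} : Continuous (prodFun : (Fin N → L2Space) → L2Config N) := by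
  induction N with
  | zero => exact continuous_of_const fun f g => congrArg _ (Subsingleton.elim f g)
  | succ n ih =>
    have : (prodFun : (Fin (n + 1) → L2Space) → L2Config (n + 1)) = fun f =>
        tensL (singleOut 0) (measurePreserving_singleOut 0) (f 0)
          (prodFun fun i => f (Fin.succAbove 0 i)) := by
      funext f; rw [prodFun_eq_tens 0, tensL_apply]
    rw [this]
    fun_prop

/-- Bounded operators that agree on product functions are equal. -/
theorem ext_prodFun {N : ℕ} {X : Type*} [NormedAddCommGroup X] [NormedSpace ℂ X]
    {S T : L2Config N →L[ℂ] X} (h : ∀ f, S (prodFun f) = T (prodFun f)) : S = T := by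
  induction N with
  | zero =>
    ext1 g
    -- The configuration space of no particles is a single point, so its L² is spanned by the empty
    -- product.
    have hg : g = g 0 • prodFun (Fin.elim0 : Fin 0 → L2Space) := by
      apply Lp.ext
      filter_upwards [Lp.coeFn_smul (g 0) (prodFun (Fin.elim0 : Fin 0 → L2Space)),
        coeFn_prodFun (Fin.elim0 : Fin 0 → L2Space)] with x h1 h2
      rw [h1, Pi.smul_apply, h2, Subsingleton.elim x 0]
      simp
    rw [hg, map_smul, map_smul, h]
  | succ n ih =>
    refine ext_tens (singleOut 0) (measurePreserving_singleOut 0) fun f g => ?_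
    have : S ∘L tensL (singleOut 0) (measurePreserving_singleOut 0) f
        = T ∘L tensL (singleOut 0) (measurePreserving_singleOut 0) f := ih fun g => by
      have := h (Fin.cons f g)
      rw [prodFun_eq_tens 0] at this
      simpa [tensL_apply] using this
    exact DFunLike.congr_fun this g

/-- The one-particle operator `b`, acting on the `j`-th particle. -/
def onBody {n : ℕ} (j : Fin (n + 1)) (b : L2Space →L[ℂ] L2Space) :
    L2Config (n + 1) →L[ℂ] L2Config (n + 1) :=
  ampl (singleOut j) (measurePreserving_singleOut j) b

theorem onBody_prodFun {n : ℕ} (j : Fin (n + 1)) (b : L2Space →L[ℂ] L2Space)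
    (f : Fin (n + 1) → L2Space) :
    onBody j b (prodFun f) = prodFun (Function.update f j (b (f j))) := by
  rw [prodFun_eq_tens j, onBody, ampl_tens, prodFun_eq_tens j (Function.update _ _ _)]
  simp

theorem onBody_comm {n : ℕ} {j k : Fin (n + 1)} (hjk : j ≠ k) (b c : L2Space →L[ℂ] L2Space)
    (x : L2Config (n + 1)) : onBody j b (onBody k c x) = onBody k c (onBody j b x) := by
  have : onBody j b ∘L onBody k c = onBody k c ∘L onBody j b := ext_prodFun fun f => by
    simp only [ContinuousLinearMap.comp_apply, onBody_prodFun]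
    rw [Function.update_comm hjk, Function.update_of_ne hjk, Function.update_of_ne hjk.symm]
  exact DFunLike.congr_fun this x

theorem inner_onBody_left {n : ℕ} (j : Fin (n + 1)) (b : L2Space →L[ℂ] L2Space)
    (x y : L2Config (n + 1)) :
    inner ℂ (onBody j b x) y = inner ℂ x (onBody j (ContinuousLinearMap.adjoint b) y) :=
  inner_ampl_left _ _ b x y

/-- Relabelling of the particles as an isometry of `L²(ℝ^{3N})`. -/
def permOp {N : ℕ} (σ : Equiv.Perm (Fin N)) : L2Config N →ₗᵢ[ℂ] L2Config N :=
  Lp.compMeasurePreservingₗᵢ ℂ (permute σ) (measurePreserving_permute σ)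

theorem mem_L2S_iff {N : ℕ} {f : L2Config N} : f ∈ L2S N ↔ ∀ σ, permOp σ f = f := Iff.rfl

theorem permOp_prodFun {N : ℕ} (σ : Equiv.Perm (Fin N)) (f : Fin N → L2Space) :
    permOp σ (prodFun f) = prodFun fun i => f (σ.symm i) := by
  apply Lp.ext
  filter_upwards [Lp.coeFn_compMeasurePreserving (prodFun f) (measurePreserving_permute σ),
    (measurePreserving_permute σ).quasiMeasurePreserving.ae (coeFn_prodFun f),
    coeFn_prodFun fun i => f (σ.symm i)] with x h1 h2 h3
  refine h1.trans (h2.trans ?_)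
  have h4 := Equiv.prod_comp σ fun i => f (σ.symm i) (particle i x)
  simp only [Equiv.symm_apply_apply] at h4
  rw [h3, ← h4]
  rfl

/-- Relabelling turns f_1 ⊗ ⋯ ⊗ f_N into the product whose factor in slot σ j is f_j, so an operator
on slot j is carried to slot σ j. -/
theorem permOp_onBody {n : ℕ} (σ : Equiv.Perm (Fin (n + 1))) (j : Fin (n + 1))
    (b : L2Space →L[ℂ] L2Space) (x : L2Config (n + 1)) :
    permOp σ (onBody j b x) = onBody (σ j) b (permOp σ x) := by
  have : (permOp σ).toContinuousLinearMap ∘L onBody j b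
      = onBody (σ j) b ∘L (permOp σ).toContinuousLinearMap := ext_prodFun fun f => by
    simp only [ContinuousLinearMap.comp_apply, LinearIsometry.coe_toContinuousLinearMap,
      onBody_prodFun, permOp_prodFun]
    congr 1
    funext i
    simp only [Function.update_apply, Equiv.symm_apply_apply, Equiv.symm_apply_eq]
  exact DFunLike.congr_fun this x

end config

/-! ### Unitary groups of multiplication operators -/

section phase
variable {α : Type*} [MeasurableSpace α] {μ : Measure α}

theorem norm_sq_eq_integral (f : L2 μ) : ‖f‖ ^ 2 = ∫ x, ‖f x‖ ^ 2 ∂μ := by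
  have h := inner_self_eq_norm_sq_to_K (𝕜 := ℂ) f
  rw [L2.inner_def] at h
  have h2 : ∫ x, inner ℂ (f x) (f x) ∂μ = ((∫ x, ‖f x‖ ^ 2 ∂μ : ℝ) : ℂ) := by
    rw [← integral_complex_ofReal]
    congr 1
    funext x
    simp [inner_self_eq_norm_sq_to_K]
  rw [h2] at h
  apply Complex.ofReal_injective
  rw [h]
  push_cast
  rfl

/-- Dominated convergence in `L²`. -/
theorem tendsto_L2_of_dominated {ι : Type*} {l : Filter ι} [l.IsCountablyGenerated] {g : ι → L2 μ}
    {g₀ : L2 μ} {D : ι → α → ℂ} (bound : L2 μ) (hD : ∀ i, ⇑(g i - g₀) =ᵐ[μ] D i)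
    (hb : ∀ i, ∀ᵐ x ∂μ, ‖D i x‖ ≤ ‖bound x‖)
    (hlim : ∀ᵐ x ∂μ, Tendsto (fun i => D i x) l (𝓝 0)) : Tendsto g l (𝓝 g₀) := by
  rw [tendsto_iff_norm_sub_tendsto_zero]
  have hsq : Tendsto (fun i => ‖g i - g₀‖ ^ 2) l (𝓝 0) := by
    have e : ∀ i, ‖g i - g₀‖ ^ 2 = ∫ x, ‖D i x‖ ^ 2 ∂μ := fun i => by
      rw [norm_sq_eq_integral]
      apply integral_congr_ae
      filter_upwards [hD i] with x hx
      rw [hx]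
    simp only [e]
    have h0 : (0 : ℝ) = ∫ x, (0 : ℝ) ∂μ := by simp
    rw [h0]
    refine tendsto_integral_filter_of_dominated_convergence (fun x => ‖bound x‖ ^ 2)
      (Eventually.of_forall fun i => ?_) (Eventually.of_forall fun i => ?_) ?_ ?_
    · exact (((Lp.aestronglyMeasurable _).congr (hD i)).norm.pow 2)
    · filter_upwards [hb i] with x hx
      rw [Real.norm_of_nonneg (by positivity)]
      gcongr
    · exact (memLp_two_iff_integrable_sq_norm (Lp.aestronglyMeasurable _)).1 (Lp.memLp bound)
    · filter_upwards [hlim] with x hx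
      simpa using hx.norm.pow 2
  have := hsq.sqrt
  simpa [Real.sqrt_sq] using this

/-- The phase `exp(-i t θ)`. -/
def phase (θ : α → ℝ) (t : ℝ) (x : α) : ℂ := Complex.exp (Complex.I * (-(t * θ x) : ℝ))

theorem norm_phase (θ : α → ℝ) (t : ℝ) (x : α) : ‖phase θ t x‖ = 1 :=
  Complex.norm_exp_I_mul_ofReal _

theorem phase_add (θ : α → ℝ) (s t : ℝ) (x : α) :
    phase θ (s + t) x = phase θ s x * phase θ t x := by
  rw [phase, phase, phase, ← Complex.exp_add]
  congr 1
  push_cast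
  ring

theorem phase_zero (θ : α → ℝ) (x : α) : phase θ 0 x = 1 := by simp [phase]

theorem hasDerivAt_phase (θ : α → ℝ) (x : α) (t : ℝ) :
    HasDerivAt (fun t => phase θ t x) (-Complex.I * θ x * phase θ t x) t := by
  have h1 : HasDerivAt (fun t : ℝ => Complex.I * (-(t * θ x) : ℝ)) (-Complex.I * θ x) t := by
    have := (((hasDerivAt_id t).mul_const (θ x)).neg.ofReal_comp).const_mul Complex.I
    refine this.congr_deriv ?_
    push_cast
    ring
  exact h1.cexp.congr_deriv (mul_comm _ _)

theorem memLp_phase {θ : α → ℝ} (hθ : Measurable θ) (t : ℝ) : MemLp (phase θ t) ∞ μ := by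
  refine memLp_top_of_bound (C := 1) ?_ (Eventually.of_forall fun x => (norm_phase θ t x).le)
  unfold phase
  fun_prop

/-- The unitary group of multiplication by `exp(-i t θ)`. -/
def phaseGroup {θ : α → ℝ} (hθ : Measurable θ) (t : ℝ) : L2 μ →L[ℂ] L2 μ :=
  mulOp (phase θ t) (memLp_phase hθ t)

variable {θ : α → ℝ} (hθ : Measurable θ)

theorem isUnitaryGroup_phaseGroup : IsUnitaryGroup (phaseGroup (μ := μ) hθ) := by
  have hn : ∀ t (f : L2 μ), ‖phaseGroup hθ t f‖ = ‖f‖ := fun t f => by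
    have h : ∀ᵐ x ∂μ, ‖phaseGroup hθ t f x‖ = ‖f x‖ := by
      filter_upwards [coeFn_mulOp (phase θ t) (memLp_phase hθ t) f] with x hx
      rw [phaseGroup, hx, norm_mul, norm_phase, one_mul]
    exact le_antisymm (Lp.norm_le_norm_of_ae_le (h.mono fun x hx => hx.le))
      (Lp.norm_le_norm_of_ae_le (h.mono fun x hx => hx.ge))
  refine IsUnitaryGroup.of_isometry (fun f => ?_) hn (fun s t f => ?_) (fun f => ?_)
  · apply Lp.ext
    filter_upwards [coeFn_mulOp (phase θ 0) (memLp_phase hθ 0) f] with x hx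
    rw [phaseGroup, hx, phase_zero, one_mul]
  · apply Lp.ext
    filter_upwards [coeFn_mulOp _ (memLp_phase hθ (s + t)) f,
      coeFn_mulOp _ (memLp_phase hθ s) (mulOp _ (memLp_phase hθ t) f),
      coeFn_mulOp _ (memLp_phase hθ t) f] with x h1 h2 h3
    rw [phaseGroup, phaseGroup, phaseGroup, h1, h2, h3, phase_add, mul_assoc]
  · refine continuous_iff_continuousAt.2 fun t => ?_
    refine tendsto_L2_of_dominated (D := fun s x => (phase θ s x - phase θ t x) * f x)
      ((2 : ℂ) • f) (fun s => ?_) (fun s => ?_) (Eventually.of_forall fun x => ?_)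
    · filter_upwards [Lp.coeFn_sub (phaseGroup hθ s f) (phaseGroup hθ t f),
        coeFn_mulOp _ (memLp_phase hθ s) f, coeFn_mulOp _ (memLp_phase hθ t) f] with x h1 h2 h3
      rw [h1, Pi.sub_apply, phaseGroup, phaseGroup, h2, h3, sub_mul]
    · filter_upwards [Lp.coeFn_smul (2 : ℂ) f] with x h1
      rw [h1, Pi.smul_apply, norm_mul, norm_smul]
      refine mul_le_mul_of_nonneg_right ((norm_sub_le _ _).trans ?_) (norm_nonneg _)
      rw [norm_phase, norm_phase]
      norm_num
    · have h1 := (hasDerivAt_phase θ x t).continuousAt.tendsto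
      have h2 := (h1.sub_const (phase θ t x)).mul_const (f x)
      simpa using h2

/-- The generator of `phaseGroup` is the multiplication by `-i θ` with its maximal domain. -/
theorem hasDerivAt_phaseGroup_iff (f g : L2 μ) :
    HasDerivAt (fun t => phaseGroup hθ t f) g 0 ↔ ∀ᵐ x ∂μ, g x = -Complex.I * θ x * f x := by
  have hq : ∀ t : ℝ, ⇑(t⁻¹ • (phaseGroup hθ (0 + t) f - phaseGroup hθ 0 f))
      =ᵐ[μ] fun x => (t⁻¹ : ℂ) * (phase θ t x - 1) * f x := fun t => by
    rw [(isUnitaryGroup_phaseGroup hθ).zero_apply, zero_add]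
    have e : t⁻¹ • (phaseGroup hθ t f - f) = (t⁻¹ : ℂ) • (phaseGroup hθ t f - f) := by
      rw [RCLike.real_smul_eq_coe_smul (K := ℂ)]; simp
    rw [e]
    filter_upwards [Lp.coeFn_smul (t⁻¹ : ℂ) (phaseGroup hθ t f - f),
      Lp.coeFn_sub (phaseGroup hθ t f) f, coeFn_mulOp _ (memLp_phase hθ t) f] with x h1 h2 h3
    rw [h1, Pi.smul_apply, h2, Pi.sub_apply, phaseGroup, h3, smul_eq_mul]
    ring
  have hpt : ∀ x, Tendsto (fun t : ℝ => (t⁻¹ : ℂ) * (phase θ t x - 1) * f x) (𝓝[≠] 0)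
      (𝓝 (-Complex.I * θ x * f x)) := fun x => by
    have h1 := (hasDerivAt_phase θ x 0).tendsto_slope_zero
    simp only [zero_add, phase_zero, mul_one, Complex.real_smul, Complex.ofReal_inv] at h1
    exact h1.mul_const (f x)
  rw [hasDerivAt_iff_tendsto_slope_zero]
  constructor
  · intro h
    -- Convergence in L² gives almost everywhere convergence along a sequence, and the pointwise
    -- limit of the quotients is known.
    obtain ⟨ns, hns, hae⟩ := (tendstoInMeasure_of_tendsto_Lp h).exists_seq_tendsto_ae'
    filter_upwards [hae, ae_all_iff.2 fun n => hq (ns n)] with x h1 h2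
    refine tendsto_nhds_unique h1 ?_
    simp only [h2]
    exact (hpt x).comp hns
  · intro h
    -- Since |exp(-itθ) - 1| ≤ |tθ|, the quotient is at most |θ f| = |g|; together with its limit it
    -- is dominated by 2|g|.
    refine tendsto_L2_of_dominated
      (D := fun t x => (t⁻¹ : ℂ) * (phase θ t x - 1) * f x - -Complex.I * θ x * f x)
      ((2 : ℂ) • g) (fun t => ?_) (fun t => ?_) (Eventually.of_forall fun x => ?_)
    · filter_upwards [hq t, Lp.coeFn_sub (t⁻¹ • (phaseGroup hθ (0 + t) f - phaseGroup hθ 0 f)) g,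
        h] with x h1 h2 h3
      rw [h2, Pi.sub_apply, h1, h3]
    · filter_upwards [Lp.coeFn_smul (2 : ℂ) g, h] with x h1 h2
      rw [h1, Pi.smul_apply, h2, norm_smul, Complex.norm_ofNat, two_mul]
      refine (norm_sub_le _ _).trans (add_le_add_left ?_ _)
      rw [norm_mul, norm_mul (-Complex.I * θ x)]
      refine mul_le_mul_of_nonneg_right ?_ (norm_nonneg _)
      rw [norm_mul, norm_mul, norm_neg, Complex.norm_I, one_mul, norm_inv, Complex.norm_real,
        Complex.norm_real]
      rcases eq_or_ne t 0 with rfl | ht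
      · simp
      rw [inv_mul_le_iff₀ (norm_pos_iff.2 ht)]
      refine (Real.norm_exp_I_mul_ofReal_sub_one_le (x := -(t * θ x))).trans_eq ?_
      rw [norm_neg, norm_mul]
    · simpa using (hpt x).sub_const (-Complex.I * θ x * f x)

end phase

/-! ### The free Schrödinger group -/

section free
open FourierTransform TemperedDistribution Real

variable {E : Type*} [NormedAddCommGroup E] [InnerProductSpace ℝ E] [FiniteDimensional ℝ E]
  [MeasurableSpace E] [BorelSpace E]

theorem integrable_schwartz_mul (φ : 𝓢(E, ℂ)) (f : L2 (volume : Measure E)) :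
    Integrable fun x => φ x * f x :=
  (φ.memLp 2 volume).integrable_mul (Lp.memLp f)

/-- A locally integrable function is determined almost everywhere by its pairings with smooth
compactly supported functions. This turns the distributional conditions on the domain into pointwise
ones on the Fourier side. -/
theorem toTemperedDistribution_eq_smulLeftCLM_iff {a : E → ℂ} (ha : a.HasTemperateGrowth)
    (f g : L2 (volume : Measure E)) :
    (g : 𝓢'(E, ℂ)) = smulLeftCLM ℂ a (f : 𝓢'(E, ℂ)) ↔ ∀ᵐ x, g x = a x * f x := by
  constructor
  · intro h
    have hloc : LocallyIntegrable (fun x => g x - a x * f x) (volume : Measure E) := by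
      refine ((Lp.memLp g).locallyIntegrable (by norm_num)).sub ?_
      have hf := (Lp.memLp f).locallyIntegrable (by norm_num : (1 : ℝ≥0∞) ≤ 2)
      rw [← locallyIntegrableOn_univ] at hf ⊢
      exact hf.continuousOn_mul ha.1.continuous.continuousOn isOpen_univ.isLocallyClosed
    have := ae_eq_zero_of_integral_contDiff_smul_eq_zero hloc fun φ hφ hc => by
      have hg₁ : HasCompactSupport (Complex.ofRealCLM ∘ φ) := hc.comp_left rfl
      have hg₂ : ContDiff ℝ (⊤ : ℕ∞) (Complex.ofRealCLM ∘ φ) :=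
        Complex.ofRealCLM.contDiff.comp hφ
      have h1 := DFunLike.congr_fun h (hg₁.toSchwartzMap hg₂)
      rw [smulLeftCLM_apply_apply, Lp.toTemperedDistribution_apply,
        Lp.toTemperedDistribution_apply] at h1
      have h2 : ∫ x, ((hg₁.toSchwartzMap hg₂) x * g x
          - (SchwartzMap.smulLeftCLM ℂ a (hg₁.toSchwartzMap hg₂)) x * f x) = 0 := by
        rw [integral_sub (integrable_schwartz_mul _ _) (integrable_schwartz_mul _ _)]
        exact sub_eq_zero.2 h1
      rw [← h2]
      congr 1
      funext x
      rw [SchwartzMap.smulLeftCLM_apply_apply ha]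
      simp
      ring
    filter_upwards [this] with x hx
    exact sub_eq_zero.1 hx
  · intro h
    ext φ
    rw [smulLeftCLM_apply_apply, Lp.toTemperedDistribution_apply, Lp.toTemperedDistribution_apply]
    apply integral_congr_ae
    filter_upwards [h] with x hx
    rw [SchwartzMap.smulLeftCLM_apply_apply ha, hx, smul_eq_mul, smul_eq_mul, smul_eq_mul]
    ring

/-- The kinetic energy symbol divided by `ħ`. -/
def kinetic (ħ : ℝ) (ξ : E) : ℝ := 2 * π ^ 2 * ħ * ‖ξ‖ ^ 2

theorem measurable_kinetic (ħ : ℝ) : Measurable (kinetic (E := E) ħ) := by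
  unfold kinetic; fun_prop

/-- The free Schrödinger group `exp(i t (ħ/2) Δ)`. -/
def freeGroup (ħ t : ℝ) : L2 (volume : Measure E) →L[ℂ] L2 (volume : Measure E) :=
  (Lp.fourierTransformₗᵢ E ℂ).symm.toContinuousLinearEquiv.toContinuousLinearMap ∘L
    phaseGroup (measurable_kinetic ħ) t ∘L
    (Lp.fourierTransformₗᵢ E ℂ).toContinuousLinearEquiv.toContinuousLinearMap

theorem freeGroup_apply (ħ t : ℝ) (f : L2 (volume : Measure E)) :
    freeGroup ħ t f = 𝓕⁻ (phaseGroup (measurable_kinetic ħ) t (𝓕 f)) := rfl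

theorem fourier_freeGroup (ħ t : ℝ) (f : L2 (volume : Measure E)) :
    𝓕 (freeGroup ħ t f) = phaseGroup (measurable_kinetic ħ) t (𝓕 f) := by
  rw [freeGroup_apply, fourier_fourierInv_eq]

theorem isUnitaryGroup_freeGroup (ħ : ℝ) : IsUnitaryGroup (freeGroup (E := E) ħ) := by
  have h := isUnitaryGroup_phaseGroup (μ := (volume : Measure E)) (measurable_kinetic ħ)
  refine IsUnitaryGroup.of_isometry (fun f => ?_) (fun t f => ?_) (fun s t f => ?_) (fun f => ?_)
  · rw [freeGroup_apply, h.zero_apply]; exact (Lp.fourierTransformₗᵢ E ℂ).symm_apply_apply f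
  · rw [← Lp.norm_fourier_eq, fourier_freeGroup, h.norm_map, Lp.norm_fourier_eq]
  · rw [freeGroup_apply, h.add_apply, freeGroup_apply, fourier_freeGroup]
  · exact (Lp.fourierTransformₗᵢ E ℂ).symm.continuous.comp (h.strong_continuity (𝓕 f))

/-- Plancherel's unitary carries the free group to `phaseGroup`, where the generator with its exact
domain is known. -/
theorem hasDerivAt_freeGroup_iff_fourier (ħ : ℝ) (f g : L2 (volume : Measure E)) :
    HasDerivAt (fun t => freeGroup ħ t f) g 0 ↔
      ∀ᵐ ξ, (𝓕 g : L2 (volume : Measure E)) ξ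
        = -Complex.I * kinetic ħ ξ * (𝓕 f : L2 (volume : Measure E)) ξ := by
  rw [← hasDerivAt_phaseGroup_iff (measurable_kinetic ħ)]
  constructor
  · intro h
    have := ((Lp.fourierTransformₗᵢ E ℂ).toContinuousLinearEquiv.toContinuousLinearMap.restrictScalars
      ℝ).hasFDerivAt.comp_hasDerivAt (0 : ℝ) h
    refine HasDerivAt.congr_of_eventuallyEq this (Eventually.of_forall fun t => ?_)
    exact (fourier_freeGroup ħ t f).symm
  · intro h
    have := ((Lp.fourierTransformₗᵢ E ℂ).symm.toContinuousLinearEquiv.toContinuousLinearMap.restrictScalars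
      ℝ).hasFDerivAt.comp_hasDerivAt (0 : ℝ) h
    refine HasDerivAt.congr_deriv (f := fun t => freeGroup ħ t f) this ?_
    exact (Lp.fourierTransformₗᵢ E ℂ).symm_apply_apply g

/-- The Laplacian is the Fourier multiplier -(2π)²|ξ|², and the Fourier transform is injective on
tempered distributions and extends the one on L². -/
theorem toTemperedDistribution_eq_laplacian_iff (f k : L2 (volume : Measure E)) :
    (k : 𝓢'(E, ℂ)) = Δ (f : 𝓢'(E, ℂ)) ↔
      ∀ᵐ ξ, (𝓕 k : L2 (volume : Measure E)) ξ
        = (-(2 * π) ^ 2 * ‖ξ‖ ^ 2 : ℝ) * (𝓕 f : L2 (volume : Measure E)) ξ := by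
  have ha : (fun ξ : E => ((-(2 * π) ^ 2 * ‖ξ‖ ^ 2 : ℝ) : ℂ)).HasTemperateGrowth := by fun_prop
  rw [← toTemperedDistribution_eq_smulLeftCLM_iff ha, ← Lp.fourier_toTemperedDistribution_eq,
    ← Lp.fourier_toTemperedDistribution_eq, laplacian_eq_fourierMultiplierCLM,
    fourierMultiplierCLM_apply]
  have e : smulLeftCLM ℂ (fun ξ : E => ((-(2 * π) ^ 2 * ‖ξ‖ ^ 2 : ℝ) : ℂ)) (𝓕 (f : 𝓢'(E, ℂ)))
      = ((-(2 * π) ^ 2 : ℝ) : ℂ) •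
        smulLeftCLM ℂ (fun ξ : E => ((‖ξ‖ ^ 2 : ℝ) : ℂ)) (𝓕 (f : 𝓢'(E, ℂ))) := by
    have h1 := smulLeftCLM_smul (F := ℂ)
      (show (fun ξ : E => ((‖ξ‖ ^ 2 : ℝ) : ℂ)).HasTemperateGrowth by fun_prop)
      ((-(2 * π) ^ 2 : ℝ) : ℂ)
    have h2 : (fun ξ : E => ((-(2 * π) ^ 2 * ‖ξ‖ ^ 2 : ℝ) : ℂ))
        = ((-(2 * π) ^ 2 : ℝ) : ℂ) • fun ξ : E => ((‖ξ‖ ^ 2 : ℝ) : ℂ) := by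
      funext ξ; simp
    rw [h2, h1]
    rfl
  have hr : ∀ T : 𝓢'(E, ℂ), -(2 * π) ^ 2 • T = ((-(2 * π) ^ 2 : ℝ) : ℂ) • T := fun T => by
    ext φ
    exact (Complex.coe_smul (-(2 * π) ^ 2) (T φ)).symm
  rw [e, hr]
  constructor
  · intro h
    rw [h, fourier_smul, fourier_fourierInv_eq]
  · intro h
    have hk : 𝓕⁻ (𝓕 (k : 𝓢'(E, ℂ)) : 𝓢'(E, ℂ)) = (k : 𝓢'(E, ℂ)) := fourierInv_fourier_eq _
    rw [← hk, h, fourierInv_smul]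

/-- The generator of the free group is `(i ħ / 2) Δ` with domain `H²`. -/
theorem hasDerivAt_freeGroup_iff {ħ : ℝ} (hħ : 0 < ħ) (f g : L2 (volume : Measure E)) :
    HasDerivAt (fun t => freeGroup ħ t f) g 0 ↔
      MemSobolev 2 2 (f : 𝓢'(E, ℂ)) ∧ ∃ k : L2 (volume : Measure E),
        (k : 𝓢'(E, ℂ)) = Δ (f : 𝓢'(E, ℂ)) ∧ g = (Complex.I * ħ / 2) • k := by
  rw [hasDerivAt_freeGroup_iff_fourier]
  have hc : (Complex.I * ħ / 2 : ℂ) ≠ 0 := by simp [hħ.ne']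
  have hħ' : (ħ : ℂ) ≠ 0 := by simp [hħ.ne']
  have hπ : (π : ℂ) ≠ 0 := by simp [pi_ne_zero]
  constructor
  · intro h
    -- The H² witness must be (1 + |ξ|²) 𝓕f. Since 𝓕g = -i · 2π²ħ |ξ|² 𝓕f, the part |ξ|² 𝓕f is
    -- recovered as (i / (2π²ħ)) 𝓕g, which is in L².
    refine ⟨memSobolev_iff_exists_smulLeftCLM_fourier.2
      ⟨𝓕 f + (Complex.I / (2 * π ^ 2 * ħ)) • 𝓕 g, ?_⟩, (Complex.I * ħ / 2)⁻¹ • g, ?_, ?_⟩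
    · rw [Lp.fourier_toTemperedDistribution_eq]
      symm
      rw [toTemperedDistribution_eq_smulLeftCLM_iff (by fun_prop)]
      filter_upwards [h, Lp.coeFn_add (𝓕 f) ((Complex.I / (2 * π ^ 2 * ħ)) • 𝓕 g),
        Lp.coeFn_smul (Complex.I / (2 * π ^ 2 * ħ) : ℂ) (𝓕 g : L2 (volume : Measure E))]
        with ξ h1 h2 h3
      rw [h2, Pi.add_apply, h3, Pi.smul_apply, h1, kinetic, smul_eq_mul, div_self two_ne_zero,
        rpow_one]
      push_cast
      field_simp
      rw [Complex.I_sq]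
      ring
    · rw [toTemperedDistribution_eq_laplacian_iff, fourier_smul]
      filter_upwards [h, Lp.coeFn_smul (Complex.I * ħ / 2 : ℂ)⁻¹ (𝓕 g : L2 (volume : Measure E))]
        with ξ h1 h2
      rw [h2, Pi.smul_apply, h1, kinetic, smul_eq_mul]
      push_cast
      field_simp
    · rw [smul_smul, mul_inv_cancel₀ hc, one_smul]
  · rintro ⟨-, k, hk, rfl⟩
    rw [toTemperedDistribution_eq_laplacian_iff] at hk
    rw [fourier_smul]
    filter_upwards [hk, Lp.coeFn_smul (Complex.I * ħ / 2 : ℂ) (𝓕 k : L2 (volume : Measure E))]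
      with ξ h1 h2
    rw [h2, Pi.smul_apply, h1, kinetic, smul_eq_mul]
    push_cast
    ring

end free

/-! ### The free group and tensor products -/

section freeProd
open FourierTransform TemperedDistribution Real

/-- On L¹ ∩ L² the Plancherel transform is the Fourier integral: both have the same pairings with
test functions, by moving the transform onto the test function. It makes Fubini available for
transforms of products. -/
theorem fourier_toLp {E : Type*} [NormedAddCommGroup E] [InnerProductSpace ℝ E]
    [FiniteDimensional ℝ E] [MeasurableSpace E] [BorelSpace E] {h : E → ℂ} (h₁ : Integrable h)
    (h₂ : MemLp h 2 volume) : ⇑(𝓕 (h₂.toLp h) : L2 (volume : Measure E)) =ᵐ[volume] 𝓕 h := by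
  have hcont : Continuous (𝓕 h) :=
    VectorFourier.fourierIntegral_continuous Real.continuous_fourierChar continuous_inner h₁
  have hloc : LocallyIntegrable (fun x => (𝓕 (h₂.toLp h) : L2 (volume : Measure E)) x - 𝓕 h x)
      (volume : Measure E) :=
    ((Lp.memLp (𝓕 (h₂.toLp h))).locallyIntegrable (by norm_num)).sub hcont.locallyIntegrable
  have := ae_eq_zero_of_integral_contDiff_smul_eq_zero hloc fun φ hφ hc => by
    have hg₁ : HasCompactSupport (Complex.ofRealCLM ∘ φ) := hc.comp_left rfl
    have hg₂ : ContDiff ℝ (⊤ : ℕ∞) (Complex.ofRealCLM ∘ φ) := Complex.ofRealCLM.contDiff.comp hφ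
    set Φ := hg₁.toSchwartzMap hg₂ with hΦ
    have h1 := DFunLike.congr_fun (Lp.fourier_toTemperedDistribution_eq (h₂.toLp h)) Φ
    rw [TemperedDistribution.fourier_apply, Lp.toTemperedDistribution_apply,
      Lp.toTemperedDistribution_apply] at h1
    have h2 : ∫ x, (𝓕 Φ) x • (h₂.toLp h) x = ∫ x, (𝓕 Φ) x • h x := by
      apply integral_congr_ae
      filter_upwards [h₂.coeFn_toLp] with x hx
      rw [hx]
    have h3 : ∫ x, (𝓕 Φ) x • h x = ∫ x, Φ x • 𝓕 h x := by
      have := VectorFourier.integral_fourierIntegral_smul_eq_flip (μ := volume) (ν := volume)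
        (L := innerₗ E) Real.continuous_fourierChar continuous_inner (Φ.integrable) h₁
      rw [flip_innerₗ] at this
      exact this
    have i1 : Integrable fun x => Φ x * 𝓕 h x := by
      have hb : ∀ x, ‖𝓕 h x‖ ≤ ∫ v, ‖h v‖ := fun x =>
        VectorFourier.norm_fourierIntegral_le_integral_norm _ _ _ _ _
      exact Φ.integrable.mul_bdd (c := ∫ v, ‖h v‖) hcont.aestronglyMeasurable
        (Eventually.of_forall hb)
    have h4 : ∫ x, (Φ x * (𝓕 (h₂.toLp h) : L2 (volume : Measure E)) x - Φ x * 𝓕 h x) = 0 := by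
      rw [integral_sub (integrable_schwartz_mul _ _) i1]
      rw [h2, h3] at h1
      exact sub_eq_zero.2 h1.symm
    rw [← h4]
    congr 1
    funext x
    simp [hΦ]
    ring
  filter_upwards [this] with x hx
  exact sub_eq_zero.1 hx

theorem integrable_prod_particle {N : ℕ} {f : Fin N → Space → ℂ} (hf : ∀ i, Integrable (f i)) :
    Integrable fun x : Config N => ∏ i, f i (particle i x) := by
  induction N with
  | zero =>
    have : IsFiniteMeasure (volume : Measure (Config 0)) := by
      rw [volume_euclideanSpace_eq_dirac]; infer_instance
    simp
  | succ n ih =>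
    have h1 := (hf 0).mul_prod (ih fun i => hf i.succ)
    have h2 := (measurePreserving_singleOut (n := n) 0).integrable_comp_of_integrable h1
    refine h2.congr (Eventually.of_forall fun x => ?_)
    dsimp only [Function.comp]
    rw [Fin.prod_univ_succ]
    rfl

theorem inner_config_succ {n : ℕ} (x ξ : Config (n + 1)) :
    inner ℝ x ξ = inner ℝ (singleOut 0 x).1 (singleOut 0 ξ).1
      + inner ℝ (singleOut 0 x).2 (singleOut 0 ξ).2 := by
  simp only [PiLp.inner_apply]
  rw [Fintype.sum_prod_type, Fin.sum_univ_succ, Fintype.sum_prod_type]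
  rfl

/-- The character exp(-2πi x·ξ) is a product over particles, so Fubini separates one particle at a
time. -/
theorem fourier_prod_particle {N : ℕ} (f : Fin N → Space → ℂ) (ξ : Config N) :
    𝓕 (fun x : Config N => ∏ i, f i (particle i x)) ξ = ∏ i, 𝓕 (f i) (particle i ξ) := by
  induction N with
  | zero => simp [fourier_eq, volume_euclideanSpace_eq_dirac]
  | succ n ih =>
    have h := ih (fun i => f i.succ) (singleOut 0 ξ).2
    rw [Fin.prod_univ_succ]
    have e : ∏ i : Fin n, 𝓕 (f i.succ) (particle i.succ ξ)
        = ∏ i : Fin n, 𝓕 (f i.succ) (particle i (singleOut 0 ξ).2) := rfl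
    rw [e, ← h, fourier_eq, fourier_eq, fourier_eq, ← integral_prod_mul,
      ← Measure.volume_eq_prod,
      ← (measurePreserving_singleOut (n := n) 0).integral_comp (singleOut 0).measurableEmbedding]
    congr 1
    funext x
    rw [inner_config_succ, neg_add, AddChar.map_add_eq_mul, Fin.prod_univ_succ]
    simp only [Circle.smul_def, Circle.coe_mul, smul_eq_mul]
    have e1 : ∀ i : Fin n, particle i.succ x = particle i (singleOut 0 x).2 := fun i => rfl
    have e2 : ∀ y : Config (n + 1), particle 0 y = (singleOut 0 y).1 := fun i => rfl
    simp only [e1, e2]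
    ring

theorem ae_particle {N : ℕ} (i : Fin N) {P : Space → Prop} (h : ∀ᵐ y, P y) :
    ∀ᵐ x : Config N, P (particle i x) := by
  cases N with
  | zero => exact i.elim0
  | succ n => exact (quasiMeasurePreserving_particle i).ae h

/-- Both sides depend continuously on the factors, so it is enough to take Schwartz factors, for
which the transforms are integrals. -/
theorem fourier_prodFun {N : ℕ} (f : Fin N → L2Space) :
    (𝓕 (prodFun f) : L2Config N) = prodFun fun i => 𝓕 (f i) := by
  have hd : DenseRange (fun φ : Fin N → 𝓢(Space, ℂ) => fun i => SchwartzMap.toLpCLM ℂ ℂ 2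
      (volume : Measure Space) (φ i)) :=
    DenseRange.piMap fun i => SchwartzMap.denseRange_toLpCLM (by norm_num)
  refine hd.induction_on (p := fun f => (𝓕 (prodFun f) : L2Config N) = prodFun fun i => 𝓕 (f i)) f
    (isClosed_eq ?_ ?_) fun φ => ?_
  · exact (Lp.fourierTransformₗᵢ (Config N) ℂ).continuous.comp continuous_prodFun
  · refine continuous_prodFun.comp (continuous_pi fun i => ?_)
    exact (Lp.fourierTransformₗᵢ Space ℂ).continuous.comp (continuous_apply i)
  · have hφ : ∀ i, Integrable (φ i) := fun i => (φ i).integrable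
    have hae : prodFun (fun i => (φ i).toLp 2 volume) =ᵐ[volume]
        fun x : Config N => ∏ i, φ i (particle i x) := by
      filter_upwards [coeFn_prodFun fun i => (φ i).toLp 2 volume,
        ae_all_iff.2 fun i => ae_particle i ((φ i).coeFn_toLp 2 volume)] with x h1 h2
      rw [h1]
      exact Finset.prod_congr rfl fun i _ => h2 i
    have h₂ : MemLp (fun x : Config N => ∏ i, φ i (particle i x)) 2 volume :=
      (Lp.memLp (prodFun fun i => (φ i).toLp 2 volume)).ae_eq hae
    have e : prodFun (fun i => (φ i).toLp 2 volume) = h₂.toLp _ :=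
      Lp.ext (hae.trans h₂.coeFn_toLp.symm)
    simp only [SchwartzMap.toLpCLM_apply, SchwartzMap.toLp_fourier_eq]
    rw [e]
    apply Lp.ext
    filter_upwards [fourier_toLp (integrable_prod_particle hφ) h₂,
      coeFn_prodFun fun i => (𝓕 (φ i)).toLp 2 volume,
      ae_all_iff.2 fun i => ae_particle i ((𝓕 (φ i)).coeFn_toLp 2 volume)] with x h1 h2 h3
    rw [h1, h2, fourier_prod_particle]
    refine Finset.prod_congr rfl fun i _ => ?_
    rw [h3 i, SchwartzMap.fourier_coe]

theorem norm_sq_config {N : ℕ} (x : Config N) : ‖x‖ ^ 2 = ∑ i, ‖particle i x‖ ^ 2 := by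
  simp only [EuclideanSpace.norm_sq_eq, particle]
  rw [Fintype.sum_prod_type]

/-- |ξ|² is the sum of the one-particle |ξ_i|², so the kinetic phase is the product of the
one-particle phases. -/
theorem phaseGroup_prodFun {N : ℕ} (ħ t : ℝ) (f : Fin N → L2Space) :
    phaseGroup (measurable_kinetic ħ) t (prodFun f)
      = prodFun fun i => phaseGroup (measurable_kinetic ħ) t (f i) := by
  apply Lp.ext
  filter_upwards [coeFn_mulOp _ (memLp_phase (measurable_kinetic ħ) t) (prodFun f),
    coeFn_prodFun f, coeFn_prodFun fun i => phaseGroup (measurable_kinetic ħ) t (f i),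
    ae_all_iff.2 fun i => ae_particle i
      (coeFn_mulOp _ (memLp_phase (measurable_kinetic ħ) t) (f i))] with x h1 h2 h3 h4
  rw [phaseGroup, h1, h2, h3]
  simp only [phaseGroup, h4]
  rw [Finset.prod_mul_distrib]
  congr 1
  simp only [phase, kinetic]
  rw [← Complex.exp_sum, ← Finset.mul_sum, norm_sq_config]
  congr 2
  rw [← Complex.ofReal_sum, Finset.sum_neg_distrib, Finset.mul_sum, Finset.mul_sum]

/-- The free evolution of a product function is the product of the free evolutions. -/
theorem freeGroup_prodFun {N : ℕ} (ħ t : ℝ) (f : Fin N → L2Space) :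
    freeGroup ħ t (prodFun f) = prodFun fun i => freeGroup ħ t (f i) := by
  have h : (𝓕 (freeGroup ħ t (prodFun f)) : L2Config N)
      = 𝓕 (prodFun fun i => freeGroup ħ t (f i)) := by
    rw [fourier_freeGroup, fourier_prodFun, phaseGroup_prodFun, fourier_prodFun]
    simp only [fourier_freeGroup]
  exact (Lp.fourierTransformₗᵢ (Config N) ℂ).injective h

theorem freeGroup_permOp {N : ℕ} (ħ t : ℝ) (σ : Equiv.Perm (Fin N)) (f : L2Config N) :
    permOp σ (freeGroup ħ t f) = freeGroup ħ t (permOp σ f) := by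
  have : (permOp σ).toContinuousLinearMap ∘L freeGroup ħ t
      = freeGroup ħ t ∘L (permOp σ).toContinuousLinearMap := ext_prodFun fun f => by
    simp only [ContinuousLinearMap.comp_apply, LinearIsometry.coe_toContinuousLinearMap,
      freeGroup_prodFun, permOp_prodFun]
  exact DFunLike.congr_fun this f

theorem freeGroup_mem_L2S {N : ℕ} (ħ t : ℝ) {f : L2Config N} (hf : f ∈ L2S N) :
    freeGroup ħ t f ∈ L2S N :=
  mem_L2S_iff.2 fun σ => by rw [freeGroup_permOp, mem_L2S_iff.1 hf σ]

/-- Free particles do not interact: conjugating an operator on particle j by the N-body free flow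
only conjugates it by the one-particle flow. -/
theorem freeGroup_onBody {n : ℕ} (ħ t : ℝ) (j : Fin (n + 1)) (b : L2Space →L[ℂ] L2Space)
    (x : L2Config (n + 1)) :
    freeGroup ħ t (onBody j b x)
      = onBody j (freeGroup ħ t ∘L b ∘L freeGroup ħ (-t)) (freeGroup ħ t x) := by
  have : freeGroup ħ t ∘L onBody j b
      = onBody j (freeGroup ħ t ∘L b ∘L freeGroup ħ (-t)) ∘L freeGroup ħ t :=
    ext_prodFun fun f => by
      simp only [ContinuousLinearMap.comp_apply, onBody_prodFun, freeGroup_prodFun,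
        (isUnitaryGroup_freeGroup ħ).neg_apply_apply]
      congr 1
      funext i
      by_cases hi : i = j
      · subst hi; simp
      · simp [Function.update_of_ne hi]
  exact DFunLike.congr_fun this x

/-- The restriction of the free group to symmetric functions. -/
def freeGroupS (N : ℕ) (ħ t : ℝ) : L2S N →L[ℂ] L2S N :=
  ((freeGroup ħ t).comp (L2S N).subtypeL).codRestrict (L2S N)
    fun f => freeGroup_mem_L2S ħ t f.2

theorem isUnitaryGroup_freeGroupS (N : ℕ) (ħ : ℝ) : IsUnitaryGroup (freeGroupS N ħ) := by
  have h := isUnitaryGroup_freeGroup (E := Config N) ħ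
  refine IsUnitaryGroup.of_isometry (fun f => Subtype.ext ?_) (fun t f => ?_)
    (fun s t f => Subtype.ext ?_) (fun f => ?_)
  · exact h.zero_apply f
  · exact h.norm_map t f
  · exact h.add_apply s t f
  · exact (h.strong_continuity f).subtype_mk _

end freeProd

/-- A curve in a subspace is differentiable if and only if it is so in the ambient space. -/
theorem hasDerivAt_coe_iff {H : Type*} [NormedAddCommGroup H] [InnerProductSpace ℂ H]
    {K : Submodule ℂ H} {f : ℝ → K} {f' : K} {t : ℝ} :
    HasDerivAt (fun s => (f s : H)) (f' : H) t ↔ HasDerivAt f f' t := by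
  rw [hasDerivAt_iff_tendsto_slope_zero, hasDerivAt_iff_tendsto_slope_zero,
    Topology.IsInducing.subtypeVal.tendsto_nhds_iff (f := fun s : ℝ => s⁻¹ • (f (t + s) - f t))]
  rfl

/-! ### The interaction -/

section interaction

/-- A measurable, bounded and even potential. -/
structure IsRegular (w : Space → ℝ) (M : ℝ) : Prop where
  measurable : Measurable w
  bound : ∀ x, ‖w x‖ ≤ M
  even : ∀ x, w (-x) = w x

/-- Truncate a measurable representative at ±M and average it with its reflection. The Hamiltonian
and the Hartree equation depend only on the class of w, so bounds and evenness may be assumed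
everywhere. -/
theorem exists_isRegular {w : Space → ℝ} (hw : MemLp w ∞ volume)
    (hw_even : ∀ᵐ x, w (-x) = w x) : ∃ w' M, IsRegular w' M ∧ w =ᵐ[volume] w' := by
  obtain ⟨M, hM⟩ : ∃ M : ℝ, ∀ᵐ x, ‖w x‖ ≤ M := by
    refine ⟨(eLpNorm w ∞ volume).toReal, ?_⟩
    filter_upwards [ae_le_eLpNormEssSup (f := w) (μ := volume)] with x hx
    rw [← toReal_enorm]
    exact ENNReal.toReal_mono hw.2.ne (by simpa using hx)
  obtain ⟨x₀, hx₀⟩ := hM.exists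
  have hM0 : 0 ≤ M := (norm_nonneg _).trans hx₀
  set w₀ := hw.1.mk w
  have hw₀ : w =ᵐ[volume] w₀ := hw.1.ae_eq_mk
  have hmw₀ : Measurable w₀ := hw.1.stronglyMeasurable_mk.measurable
  set w₁ : Space → ℝ := fun x => max (-M) (min M (w₀ x))
  have hw₁ : ∀ᵐ x, w₁ x = w x := by
    filter_upwards [hw₀, hM] with x h1 h2
    rw [Real.norm_eq_abs, abs_le] at h2
    simp only [w₁, ← h1]
    rw [min_eq_right h2.2, max_eq_right h2.1]
  have hb₁ : ∀ x, ‖w₁ x‖ ≤ M := fun x => by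
    rw [Real.norm_eq_abs, abs_le]
    exact ⟨le_max_left _ _, max_le (by linarith) (min_le_left _ _)⟩
  refine ⟨fun x => (w₁ x + w₁ (-x)) / 2, M, ⟨?_, fun x => ?_, fun x => ?_⟩, ?_⟩
  · fun_prop
  · rw [norm_div, Real.norm_two, div_le_iff₀ two_pos]
    exact (norm_add_le _ _).trans (by linarith [hb₁ x, hb₁ (-x)])
  · simp only [neg_neg]; rw [add_comm]
  · filter_upwards [hw₁, (Measure.measurePreserving_neg
      (volume : Measure Space)).quasiMeasurePreserving.ae hw₁, hw_even] with x h1 h2 h3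
    rw [h1, h2, h3]; ring

/-- For i ≠ j, subtracting x_j from x_i is a measure preserving shear, so null sets pull back to
null sets. -/
theorem ae_particle_sub {N : ℕ} {i j : Fin N} (hij : i ≠ j) {P : Space → Prop}
    (h : ∀ᵐ y, P y) : ∀ᵐ x : Config N, P (particle i x - particle j x) := by
  cases N with
  | zero => exact i.elim0
  | succ n =>
    obtain ⟨k, rfl⟩ := Fin.exists_succAbove_eq hij.symm
    have h1 : MeasurePreserving (fun z : Config n × Space => (z.1, z.2 - particle k z.1))
        (volume.prod volume) (volume.prod volume) := by
      refine (MeasurePreserving.id volume).skew_product (g := fun z y => y - particle k z) ?_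
        (Eventually.of_forall fun z => (measurePreserving_sub_right volume (particle k z)).map_eq)
      have := measurable_particle k
      fun_prop
    have h2 := ((Measure.quasiMeasurePreserving_snd.comp h1.quasiMeasurePreserving).comp
      Measure.measurePreserving_swap.quasiMeasurePreserving).comp
      (measurePreserving_singleOut i).quasiMeasurePreserving
    exact h2.ae h

variable {w w' : Space → ℝ} {M : ℝ}

theorem interaction_congr (h : w =ᵐ[volume] w') (N : ℕ) :
    interaction w N =ᵐ[volume] interaction w' N := by
  have h1 : ∀ᵐ x : Config N, ∀ i j : Fin N, i ≠ j →
      w (particle i x - particle j x) = w' (particle i x - particle j x) := by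
    simp only [ae_all_iff]
    exact fun i j hij => ae_particle_sub hij h
  filter_upwards [h1] with x hx
  unfold interaction
  congr 1
  exact Finset.sum_congr rfl fun i _ => Finset.sum_congr rfl fun j hj =>
    hx i j (Finset.mem_Ioi.1 hj).ne

theorem hartreePotential_congr (h : w =ᵐ[volume] w') (f : L2Space) :
    hartreePotential w f = hartreePotential w' f := by
  funext x
  apply integral_congr_ae
  filter_upwards [((volume : Measure Space).measurePreserving_sub_left x).quasiMeasurePreserving.ae h] with y hy
  rw [hy]

theorem hamiltonianGraph_congr (h : w =ᵐ[volume] w') (ħ : ℝ) (N : ℕ) (f g : L2S N) :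
    HamiltonianGraph ħ w N f g ↔ HamiltonianGraph ħ w' N f g := by
  unfold HamiltonianGraph
  refine and_congr_right fun _ => exists_congr fun k => and_congr_right fun _ =>
    eventually_congr ?_
  filter_upwards [interaction_congr h N] with x hx
  rw [hx]

theorem isSchrodingerGroup_congr (h : w =ᵐ[volume] w') {ħ : ℝ} {N : ℕ}
    {U : ℝ → L2S N →L[ℂ] L2S N} :
    IsSchrodingerGroup ħ w N U ↔ IsSchrodingerGroup ħ w' N U :=
  ⟨fun hU => ⟨hU.1, hU.2, hU.3, fun f g => (hamiltonianGraph_congr h ħ N f g).symm.trans (hU.4 f g)⟩,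
    fun hU => ⟨hU.1, hU.2, hU.3, fun f g => (hamiltonianGraph_congr h ħ N f g).trans (hU.4 f g)⟩⟩

theorem isHartreeSolution_congr (h : w =ᵐ[volume] w') {ħ T : ℝ} {ψ : L2Space} {u : ℝ → L2Space} :
    IsHartreeSolution ħ w ψ T u ↔ IsHartreeSolution ħ w' ψ T u := by
  constructor <;> intro hu <;> refine ⟨hu.1, hu.2, fun φ s hs => ?_⟩
  · rw [← hartreePotential_congr h]; exact hu.3 φ s hs
  · rw [hartreePotential_congr h]; exact hu.3 φ s hs

theorem IsRegular.memLp_pair (hw : IsRegular w M) {N : ℕ} (i j : Fin N) :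
    MemLp (fun x : Config N => (w (particle i x - particle j x) : ℂ)) ∞ volume := by
  refine memLp_top_of_bound (C := M) (Measurable.aestronglyMeasurable ?_)
    (Eventually.of_forall fun x => by rw [Complex.norm_real]; exact hw.bound _)
  have h1 := measurable_particle i
  have h2 := measurable_particle j
  have h3 := hw.measurable
  fun_prop

/-- Multiplication by `w (x_i - x_j)`. -/
def pairOp (hw : IsRegular w M) {N : ℕ} (i j : Fin N) : L2Config N →L[ℂ] L2Config N :=
  mulOp _ (hw.memLp_pair i j)

theorem pairOp_comm (hw : IsRegular w M) {N : ℕ} (i j : Fin N) : pairOp hw i j = pairOp hw j i :=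
  mulOp_congr _ _ (Eventually.of_forall fun x => by
    show (w (particle i x - particle j x) : ℂ) = w (particle j x - particle i x)
    rw [← neg_sub, hw.even])

theorem inner_pairOp (hw : IsRegular w M) {N : ℕ} (i j : Fin N) (f g : L2Config N) :
    inner ℂ (pairOp hw i j f) g = inner ℂ f (pairOp hw i j g) :=
  inner_mulOp_ofReal _ f g

theorem norm_pairOp_le (hw : IsRegular w M) {N : ℕ} (i j : Fin N) (f : L2Config N) :
    ‖pairOp hw i j f‖ ≤ M * ‖f‖ :=
  norm_mulOp_apply_le _ (Eventually.of_forall fun x => by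
    rw [Complex.norm_real]; exact hw.bound _) f

theorem permOp_pairOp (hw : IsRegular w M) {N : ℕ} (σ : Equiv.Perm (Fin N)) (i j : Fin N)
    (f : L2Config N) : permOp σ (pairOp hw i j f) = pairOp hw (σ i) (σ j) (permOp σ f) := by
  apply Lp.ext
  filter_upwards [Lp.coeFn_compMeasurePreserving (pairOp hw i j f) (measurePreserving_permute σ),
    (measurePreserving_permute σ).quasiMeasurePreserving.ae (coeFn_mulOp _ (hw.memLp_pair i j) f),
    coeFn_mulOp _ (hw.memLp_pair (σ i) (σ j)) (permOp σ f),
    Lp.coeFn_compMeasurePreserving f (measurePreserving_permute σ)] with x h1 h2 h3 h4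
  refine h1.trans (h2.trans ?_)
  refine Eq.trans ?_ h3.symm
  have h4' : permOp σ f x = f (permute σ x) := h4
  rw [h4']
  rfl

theorem sum_sum_Ioi {A : Type*} [AddCommGroup A] {N : ℕ} (F : Fin N → Fin N → A)
    (hF : ∀ i j, F i j = F j i) :
    ∑ i, ∑ j, (if i = j then 0 else F i j) = 2 • ∑ i, ∑ j ∈ Finset.Ioi i, F i j := by
  have h1 : ∀ i : Fin N, ∑ j, (if i = j then 0 else F i j)
      = ∑ j ∈ Finset.Ioi i, F i j + ∑ j ∈ Finset.Iio i, F j i := fun i => by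
    have e1 : ∑ j ∈ Finset.Ioi i, F i j = ∑ j, if i < j then F i j else 0 := by
      rw [← Finset.sum_filter]; congr 1; ext; simp
    have e2 : ∑ j ∈ Finset.Iio i, F j i = ∑ j, if j < i then F i j else 0 := by
      rw [← Finset.sum_filter]
      refine Finset.sum_congr (by ext; simp) fun j _ => hF j i
    rw [e1, e2, ← Finset.sum_add_distrib]
    refine Finset.sum_congr rfl fun j _ => ?_
    rcases lt_trichotomy i j with h | h | h
    · simp [h, h.ne, h.not_gt]
    · simp [h]
    · simp [h, h.ne', h.not_gt]
  rw [Finset.sum_congr rfl fun i _ => h1 i, Finset.sum_add_distrib, two_smul]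
  congr 1
  refine Finset.sum_comm' fun i j => ?_
  simp

/-- Multiplication by `W_N`. -/
def interactionOp (hw : IsRegular w M) (N : ℕ) : L2Config N →L[ℂ] L2Config N :=
  (1 / N : ℂ) • ∑ i, ∑ j ∈ Finset.Ioi i, pairOp hw i j

theorem coeFn_finset_sum {ι α : Type*} [MeasurableSpace α] {μ : Measure α} (s : Finset ι)
    (f : ι → L2 μ) : ⇑(∑ i ∈ s, f i) =ᵐ[μ] fun x => ∑ i ∈ s, f i x := by
  classical
  induction s using Finset.induction_on with
  | empty =>
    rw [Finset.sum_empty]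
    filter_upwards [Lp.coeFn_zero ℂ 2 μ] with x hx
    rw [hx]
    simp
  | insert i s hi ih =>
    rw [Finset.sum_insert hi]
    filter_upwards [Lp.coeFn_add (f i) (∑ i ∈ s, f i), ih] with x h1 h2
    rw [h1, Pi.add_apply, h2, Finset.sum_insert hi]

theorem coeFn_interactionOp (hw : IsRegular w M) {N : ℕ} (f : L2Config N) :
    interactionOp hw N f =ᵐ[volume] fun x => interaction w N x * f x := by
  have h0 : interactionOp hw N f
      = (1 / N : ℂ) • ∑ i, ∑ j ∈ Finset.Ioi i, pairOp hw i j f := by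
    simp [interactionOp]
  rw [h0]
  filter_upwards [Lp.coeFn_smul (1 / N : ℂ) (∑ i, ∑ j ∈ Finset.Ioi i, pairOp hw i j f),
    coeFn_finset_sum Finset.univ fun i => ∑ j ∈ Finset.Ioi i, pairOp hw i j f,
    ae_all_iff.2 fun i => coeFn_finset_sum (Finset.Ioi i) fun j => pairOp hw i j f,
    ae_all_iff.2 fun i => ae_all_iff.2 fun j => coeFn_mulOp _ (hw.memLp_pair i j) f]
    with x h1 h2 h3 h4
  rw [h1, Pi.smul_apply, h2]
  have e : ∀ i j, (pairOp hw i j f) x = (w (particle i x - particle j x) : ℂ) * f x := fun i j =>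
    h4 i j
  simp_rw [h3, e, ← Finset.sum_mul]
  rw [smul_eq_mul, ← mul_assoc, interaction, Complex.ofReal_mul, Complex.ofReal_sum]
  simp_rw [Complex.ofReal_sum]
  simp

/-- The sum over ordered pairs ignores the order of the labels, so relabelling, or isolating the
pairs containing one particle, becomes a reindexing. Clearing the denominator 2N covers N = 0. -/
theorem interactionOp_eq (hw : IsRegular w M) (N : ℕ) :
    (2 * N : ℂ) • interactionOp hw N = ∑ i, ∑ j, if i = j then 0 else pairOp hw i j := by
  rcases Nat.eq_zero_or_pos N with rfl | hN
  · simp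
  · have : (N : ℂ) ≠ 0 := by exact_mod_cast hN.ne'
    rw [sum_sum_Ioi _ (pairOp_comm hw), interactionOp, smul_smul, mul_assoc,
      mul_one_div_cancel this, mul_one, two_smul, two_smul]

theorem inner_interactionOp (hw : IsRegular w M) {N : ℕ} (f g : L2Config N) :
    inner ℂ (interactionOp hw N f) g = inner ℂ f (interactionOp hw N g) := by
  simp [interactionOp, inner_smul_left, inner_smul_right, sum_inner,
    inner_sum, inner_pairOp]

theorem permOp_interactionOp (hw : IsRegular w M) {N : ℕ} (σ : Equiv.Perm (Fin N))
    (f : L2Config N) : permOp σ (interactionOp hw N f) = interactionOp hw N (permOp σ f) := by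
  rcases Nat.eq_zero_or_pos N with rfl | hN
  · simp [interactionOp]
  have hN' : (2 * N : ℂ) ≠ 0 := by exact_mod_cast (by omega : 2 * N ≠ 0)
  have h1 : ∀ g, (2 * N : ℂ) • interactionOp hw N g
      = ∑ i, ∑ j, if i = j then 0 else pairOp hw i j g := fun g => by
    have := DFunLike.congr_fun (interactionOp_eq hw N) g
    simp only [smul_apply, sum_apply] at this
    rw [this]
    refine Finset.sum_congr rfl fun i _ => Finset.sum_congr rfl fun j _ => ?_
    split_ifs <;> rfl
  refine smul_right_injective _ hN' ?_
  dsimp only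
  rw [← map_smul, h1, h1, map_sum, ← Equiv.sum_comp σ (fun i => ∑ j, if i = j then 0 else _)]
  refine Finset.sum_congr rfl fun i _ => ?_
  rw [map_sum, ← Equiv.sum_comp σ (fun j => if σ i = j then 0 else _)]
  refine Finset.sum_congr rfl fun j _ => ?_
  simp only [EmbeddingLike.apply_eq_iff_eq]
  split_ifs
  · exact map_zero _
  · exact permOp_pairOp hw σ i j f

/-- The interaction as an operator on symmetric functions. -/
def interactionOpS (hw : IsRegular w M) (N : ℕ) : L2S N →L[ℂ] L2S N :=
  ((interactionOp hw N).comp (L2S N).subtypeL).codRestrict (L2S N) fun f =>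
    mem_L2S_iff.2 fun σ => by
      rw [ContinuousLinearMap.comp_apply, permOp_interactionOp]
      congr 1
      exact mem_L2S_iff.1 f.2 σ

theorem re_inner_interactionOpS (hw : IsRegular w M) (ħ : ℝ) {N : ℕ} (f : L2S N) :
    (inner ℂ f (((-Complex.I / ħ : ℂ) • interactionOpS hw N) f)).re = 0 := by
  have h1 : (inner ℂ (f : L2Config N) (interactionOp hw N f)).im = 0 := by
    have := inner_conj_symm (𝕜 := ℂ) (f : L2Config N) (interactionOp hw N f)
    rw [inner_interactionOp] at this
    exact Complex.conj_eq_iff_im.1 this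
  have h2 : inner ℂ f (((-Complex.I / ħ : ℂ) • interactionOpS hw N) f)
      = (-Complex.I / ħ : ℂ) * inner ℂ (f : L2Config N) (interactionOp hw N f) := by
    rw [smul_apply, inner_smul_right]; rfl
  rw [h2, show (-Complex.I / ħ : ℂ) = ((-1 / ħ : ℝ) : ℂ) * Complex.I by push_cast; ring, mul_assoc,
    Complex.re_ofReal_mul, Complex.I_mul_re, h1]
  simp

/-- W_N is bounded, so it leaves the domain H² unchanged and can be moved to the other side; the
rest is the free generator, as (-i/ħ)(-ħ²/2) = iħ/2. -/
theorem hamiltonianGraph_iff (hw : IsRegular w M) {ħ : ℝ} (hħ : 0 < ħ) {N : ℕ} (f g : L2S N) :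
    HamiltonianGraph ħ w N f g ↔ HasDerivAt (fun t => freeGroupS N ħ t f)
      ((-Complex.I / ħ : ℂ) • g - ((-Complex.I / ħ : ℂ) • interactionOpS hw N) f) 0 := by
  have hħ' : (ħ : ℂ) ≠ 0 := by simp [hħ.ne']
  refine Iff.trans ?_ (hasDerivAt_coe_iff (f := fun t => freeGroupS N ħ t f))
  refine Iff.trans ?_ (hasDerivAt_freeGroup_iff hħ (f : L2Config N) _).symm
  unfold HamiltonianGraph
  refine and_congr_right fun _ => exists_congr fun k => and_congr_right fun _ => ?_
  have e : ((((-Complex.I / ħ : ℂ) • g - ((-Complex.I / ħ : ℂ) • interactionOpS hw N) f : L2S N))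
      : L2Config N) = (-Complex.I / ħ : ℂ) • ((g : L2Config N) - interactionOp hw N f) := by
    rw [smul_sub]; rfl
  rw [e]
  have e2 : (Complex.I * ħ / 2 : ℂ) • k = (-Complex.I / ħ : ℂ) • ((-(ħ ^ 2 / 2 : ℝ) : ℂ) • k) := by
    rw [smul_smul]; congr 1; push_cast; field_simp
  rw [e2, (smul_right_injective _ (show (-Complex.I / ħ : ℂ) ≠ 0 by simp [hħ'])).eq_iff,
    sub_eq_iff_eq_add]
  have hae : ⇑((-(ħ ^ 2 / 2 : ℝ) : ℂ) • k + interactionOp hw N f) =ᵐ[volume] fun x =>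
      -(ħ ^ 2 / 2 : ℝ) * k x + interaction w N x * (f : L2Config N) x := by
    filter_upwards [Lp.coeFn_add ((-(ħ ^ 2 / 2 : ℝ) : ℂ) • k) (interactionOp hw N f),
      Lp.coeFn_smul (-(ħ ^ 2 / 2 : ℝ) : ℂ) k, coeFn_interactionOp hw (f : L2Config N)]
      with x h1 h2 h3
    rw [h1, Pi.add_apply, h2, Pi.smul_apply, h3, smul_eq_mul]
  constructor
  · intro h
    apply Lp.ext
    filter_upwards [h, hae] with x h1 h2
    rw [h1, h2]
  · intro h
    rw [h]
    exact hae

theorem IsSchrodingerGroup.isUnitaryGroup {ħ : ℝ} {N : ℕ} {U : ℝ → L2S N →L[ℂ] L2S N}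
    (hU : IsSchrodingerGroup ħ w N U) : IsUnitaryGroup U :=
  ⟨hU.mem_unitary, hU.group_law, hU.strong_continuity⟩

/-- The interaction is a bounded skew perturbation of the free generator. The derivative in the
second conclusion exists for every f, which matters because ψ^{⊗N} need not lie in the domain of
H_N. -/
theorem exists_isSchrodingerGroup (hw : IsRegular w M) {ħ : ℝ} (hħ : 0 < ħ) (N : ℕ) :
    ∃ U : ℝ → L2S N →L[ℂ] L2S N, IsSchrodingerGroup ħ w N U ∧ ∀ f t,
      HasDerivAt (fun s => freeGroupS N ħ (-s) (U s f))
        (freeGroupS N ħ (-t) (((-Complex.I / ħ : ℂ) • interactionOpS hw N) (U t f))) t := by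
  obtain ⟨V, hV, hgen, hder⟩ := (isUnitaryGroup_freeGroupS N ħ).exists_perturbation
    ((-Complex.I / ħ : ℂ) • interactionOpS hw N) (re_inner_interactionOpS hw ħ)
  exact ⟨V, ⟨hV.mem_unitary, hV.group_law, hV.strong_continuity, fun f g =>
    (hamiltonianGraph_iff hw hħ f g).trans (hgen f _).symm⟩, hder⟩

theorem IsSchrodingerGroup.unique {ħ : ℝ} (hħ : 0 < ħ) {N : ℕ} {U V : ℝ → L2S N →L[ℂ] L2S N}
    (hU : IsSchrodingerGroup ħ w N U) (hV : IsSchrodingerGroup ħ w N V) : U = V := by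
  refine hU.isUnitaryGroup.eq_of_generator hV.isUnitaryGroup fun f g hg => ?_
  have hc : (-Complex.I / ħ : ℂ) ≠ 0 := by simp [hħ.ne']
  have e : g = (-Complex.I / ħ : ℂ) • ((-Complex.I / ħ : ℂ)⁻¹ • g) := by
    rw [smul_smul, mul_inv_cancel₀ hc, one_smul]
  rw [e] at hg ⊢
  exact (hV.generator f _).1 ((hU.generator f _).2 hg)

/-- The many-body evolution in the interaction picture. -/
theorem IsSchrodingerGroup.hasDerivAt (hw : IsRegular w M) {ħ : ℝ} (hħ : 0 < ħ) {N : ℕ}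
    {U : ℝ → L2S N →L[ℂ] L2S N} (hU : IsSchrodingerGroup ħ w N U) (f : L2S N) (t : ℝ) :
    HasDerivAt (fun s => freeGroup ħ (-s) (U s f : L2Config N))
      ((-Complex.I / ħ : ℂ) • freeGroup ħ (-t) (interactionOp hw N (U t f))) t := by
  obtain ⟨V, hV, hder⟩ := exists_isSchrodingerGroup hw hħ N
  -- The generator condition says nothing about vectors outside the domain. Uniqueness identifies U
  -- with the constructed group, for which the formula is known on all vectors.
  obtain rfl := hU.unique hħ hV
  have := hasDerivAt_coe_iff.2 (hder f t)
  rw [← map_smul]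
  exact this

end interaction

/-! ### The Hartree potential -/

section hartree
open FourierTransform TemperedDistribution

variable {w : Space → ℝ} {M : ℝ}

theorem IsRegular.nonneg (hw : IsRegular w M) : 0 ≤ M := (norm_nonneg _).trans (hw.bound 0)

theorem IsRegular.memLp_translate (hw : IsRegular w M) (x : Space) :
    MemLp (fun y => (w (x - y) : ℂ)) ∞ volume := by
  refine memLp_top_of_bound (C := M) (Measurable.aestronglyMeasurable ?_)
    (Eventually.of_forall fun y => by rw [Complex.norm_real]; exact hw.bound _)
  have := hw.measurable
  fun_prop

/-- At fixed x the potential is the quadratic form of an operator of norm at most M; its bound and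
its Lipschitz estimate in f, both uniform in x, come from this. -/
theorem hartreePotential_eq_inner (hw : IsRegular w M) (f : L2Space) (x : Space) :
    (hartreePotential w f x : ℂ) = inner ℂ f (mulOp _ (hw.memLp_translate x) f) := by
  rw [L2.inner_def, hartreePotential, ← integral_complex_ofReal]
  apply integral_congr_ae
  filter_upwards [coeFn_mulOp _ (hw.memLp_translate x) f] with y hy
  rw [hy, RCLike.inner_apply, mul_assoc, Complex.mul_conj, Complex.normSq_eq_norm_sq]
  push_cast
  ring

theorem norm_translateOp_le (hw : IsRegular w M) (x : Space) (f : L2Space) :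
    ‖mulOp _ (hw.memLp_translate x) f‖ ≤ M * ‖f‖ :=
  norm_mulOp_apply_le _ (Eventually.of_forall fun y => by
    rw [Complex.norm_real]; exact hw.bound _) f

theorem norm_hartreePotential_le (hw : IsRegular w M) (f : L2Space) (x : Space) :
    ‖(hartreePotential w f x : ℂ)‖ ≤ M * ‖f‖ ^ 2 := by
  rw [hartreePotential_eq_inner hw]
  refine (norm_inner_le_norm _ _).trans ?_
  have := mul_le_mul_of_nonneg_left (norm_translateOp_le hw x f) (norm_nonneg f)
  linarith

theorem norm_hartreePotential_sub_le (hw : IsRegular w M) (f g : L2Space) (x : Space) :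
    ‖(hartreePotential w f x : ℂ) - hartreePotential w g x‖ ≤ M * (‖f‖ + ‖g‖) * ‖f - g‖ := by
  rw [hartreePotential_eq_inner hw, hartreePotential_eq_inner hw]
  set A := mulOp _ (hw.memLp_translate x)
  have e : inner ℂ f (A f) - inner ℂ g (A g) = inner ℂ (f - g) (A f) + inner ℂ g (A (f - g)) := by
    simp only [map_sub, inner_sub_left, inner_sub_right]; ring
  rw [e]
  have h1 := (norm_inner_le_norm (𝕜 := ℂ) (f - g) (A f)).trans
    (mul_le_mul_of_nonneg_left (norm_translateOp_le hw x f) (norm_nonneg _))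
  have h2 := (norm_inner_le_norm (𝕜 := ℂ) g (A (f - g))).trans
    (mul_le_mul_of_nonneg_left (norm_translateOp_le hw x (f - g)) (norm_nonneg _))
  refine (norm_add_le _ _).trans ((add_le_add h1 h2).trans (le_of_eq ?_))
  ring

theorem measurable_hartreePotential (hw : IsRegular w M) (f : L2Space) :
    Measurable (hartreePotential w f) := by
  have h1 : StronglyMeasurable (fun z : Space × Space => w (z.1 - z.2) * ‖f z.2‖ ^ 2) := by
    have h2 := hw.measurable
    have h3 := (Lp.stronglyMeasurable f).measurable
    exact Measurable.stronglyMeasurable (by fun_prop)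
  exact h1.integral_prod_right.measurable

theorem memLp_hartreePotential (hw : IsRegular w M) (f : L2Space) :
    MemLp (fun x => (hartreePotential w f x : ℂ)) ∞ volume :=
  memLp_top_of_bound (C := M * ‖f‖ ^ 2)
    (Complex.measurable_ofReal.comp (measurable_hartreePotential hw f)).aestronglyMeasurable
    (Eventually.of_forall (norm_hartreePotential_le hw f))

/-- Multiplication by `w ∗ |f|²`. -/
def hartreeOp (hw : IsRegular w M) (f : L2Space) : L2Space →L[ℂ] L2Space :=
  mulOp _ (memLp_hartreePotential hw f)

theorem norm_hartreeOp_le (hw : IsRegular w M) (f g : L2Space) :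
    ‖hartreeOp hw f g‖ ≤ M * ‖f‖ ^ 2 * ‖g‖ :=
  norm_mulOp_apply_le _ (Eventually.of_forall (norm_hartreePotential_le hw f)) g

theorem norm_hartreeOp_sub_le (hw : IsRegular w M) (f g h : L2Space) :
    ‖hartreeOp hw f h - hartreeOp hw g h‖ ≤ M * (‖f‖ + ‖g‖) * ‖f - g‖ * ‖h‖ := by
  refine Lp.norm_le_mul_norm_of_ae_le_mul ?_
  filter_upwards [coeFn_mulOp _ (memLp_hartreePotential hw f) h,
    coeFn_mulOp _ (memLp_hartreePotential hw g) h,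
    Lp.coeFn_sub (hartreeOp hw f h) (hartreeOp hw g h)] with x h1 h2 h3
  rw [h3, Pi.sub_apply, hartreeOp, hartreeOp, h1, h2, ← sub_mul, norm_mul]
  exact mul_le_mul_of_nonneg_right (norm_hartreePotential_sub_le hw f g x) (norm_nonneg _)

/-- The cubic nonlinearity is Lipschitz on balls of L²: change first the function multiplied, then
the potential. -/
theorem norm_hartreeOp_self_sub_le (hw : IsRegular w M) (f g : L2Space) :
    ‖hartreeOp hw f f - hartreeOp hw g g‖
      ≤ M * (‖f‖ ^ 2 + (‖f‖ + ‖g‖) * ‖g‖) * ‖f - g‖ := by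
  have e : hartreeOp hw f f - hartreeOp hw g g
      = hartreeOp hw f (f - g) + (hartreeOp hw f g - hartreeOp hw g g) := by
    rw [map_sub]; abel
  rw [e]
  refine (norm_add_le _ _).trans ((add_le_add (norm_hartreeOp_le hw f (f - g))
    (norm_hartreeOp_sub_le hw f g g)).trans (le_of_eq ?_))
  ring

theorem continuous_hartreeOp_self (hw : IsRegular w M) :
    Continuous fun f : L2Space => hartreeOp hw f f := by
  rw [continuous_iff_continuousAt]
  intro g
  rw [ContinuousAt, tendsto_iff_norm_sub_tendsto_zero]
  refine squeeze_zero (fun _ => norm_nonneg _) (fun f => norm_hartreeOp_self_sub_le hw f g) ?_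
  have : Continuous fun f : L2Space => M * (‖f‖ ^ 2 + (‖f‖ + ‖g‖) * ‖g‖) * ‖f - g‖ := by fun_prop
  simpa using this.tendsto g

theorem inner_hartreeOp (hw : IsRegular w M) (u f g : L2Space) :
    inner ℂ (hartreeOp hw u f) g = inner ℂ f (hartreeOp hw u g) :=
  inner_mulOp_ofReal _ f g

/-- The nonlinear part of the Hartree equation, `-(i/ħ) (w ∗ |u|²) u`. -/
def hartreeField (hw : IsRegular w M) (ħ : ℝ) (u : L2Space) : L2Space :=
  (-Complex.I / ħ : ℂ) • hartreeOp hw u u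

theorem continuous_hartreeField (hw : IsRegular w M) (ħ : ℝ) : Continuous (hartreeField hw ħ) := by
  unfold hartreeField
  exact (continuous_hartreeOp_self hw).const_smul (-Complex.I / ħ : ℂ)

/-- The potential is real. This is the skewness behind mass conservation and global existence. -/
theorem re_inner_hartreeField (hw : IsRegular w M) (ħ : ℝ) (u : L2Space) :
    (inner ℂ u (hartreeField hw ħ u)).re = 0 := by
  have h1 : (inner ℂ u (hartreeOp hw u u)).im = 0 := by
    have := inner_conj_symm (𝕜 := ℂ) u (hartreeOp hw u u)
    rw [inner_hartreeOp] at this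
    exact Complex.conj_eq_iff_im.1 this
  rw [hartreeField, inner_smul_right,
    show (-Complex.I / ħ : ℂ) = ((-1 / ħ : ℝ) : ℂ) * Complex.I by push_cast; ring, mul_assoc,
    Complex.re_ofReal_mul, Complex.I_mul_re, h1]
  simp

/-! ### The free group on Schwartz functions -/

/-- All derivatives have modulus 1. Composition with a quadratic polynomial in ξ makes the free
phases multipliers of the Schwartz space. -/
theorem hasTemperateGrowth_cexp_I_mul :
    (fun x : ℝ => Complex.exp (Complex.I * x)).HasTemperateGrowth := by
  have hd : ∀ x : ℝ, HasDerivAt (fun x : ℝ => Complex.exp (Complex.I * x))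
      (Complex.I * Complex.exp (Complex.I * x)) x := fun x => by
    have := ((Complex.ofRealCLM.hasDerivAt (x := x)).const_mul Complex.I).cexp
    simp only [Complex.ofRealCLM_apply, Complex.ofReal_one, mul_one] at this
    rw [mul_comm]
    exact this
  have hn : ∀ n, iteratedDeriv n (fun x : ℝ => Complex.exp (Complex.I * x))
      = fun x : ℝ => Complex.I ^ n * Complex.exp (Complex.I * x) := by
    intro n
    induction n with
    | zero => simp
    | succ n ih =>
      funext x
      rw [iteratedDeriv_succ, ih, ((hd x).const_mul _).deriv]
      ring
  refine ⟨?_, fun n => ⟨0, 1, fun x => ?_⟩⟩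
  · exact Complex.contDiff_exp.comp (contDiff_const.mul Complex.ofRealCLM.contDiff)
  · rw [norm_iteratedFDeriv_eq_norm_iteratedDeriv, hn, norm_mul, mul_comm Complex.I,
      Complex.norm_exp_ofReal_mul_I]
    simp

variable {E : Type*} [NormedAddCommGroup E] [InnerProductSpace ℝ E] [FiniteDimensional ℝ E]
  [MeasurableSpace E] [BorelSpace E]

theorem hasTemperateGrowth_phase_kinetic (ħ t : ℝ) :
    (phase (kinetic (E := E) ħ) t).HasTemperateGrowth := by
  have h : (fun ξ : E => -(t * (2 * Real.pi ^ 2 * ħ * ‖ξ‖ ^ 2))).HasTemperateGrowth := by fun_prop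
  exact hasTemperateGrowth_cexp_I_mul.comp h

/-- A test function moved by the free flow remains a test function, hence remains admissible in the
weak Hartree equation. -/
theorem exists_freeGroup_toLp_eq (ħ t : ℝ) (φ : 𝓢(E, ℂ)) :
    ∃ χ : 𝓢(E, ℂ), freeGroup ħ t (φ.toLp 2 volume) = χ.toLp 2 volume := by
  refine ⟨𝓕⁻ (SchwartzMap.smulLeftCLM ℂ (phase (kinetic (E := E) ħ) t) (𝓕 φ)), ?_⟩
  rw [freeGroup_apply, ← SchwartzMap.toLp_fourierInv_eq, SchwartzMap.toLp_fourier_eq]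
  congr 1
  apply Lp.ext
  filter_upwards [coeFn_mulOp _ (memLp_phase (measurable_kinetic ħ) t) ((𝓕 φ).toLp 2 volume),
    (𝓕 φ).coeFn_toLp 2 volume, (SchwartzMap.smulLeftCLM ℂ (phase (kinetic (E := E) ħ) t)
      (𝓕 φ)).coeFn_toLp 2 volume] with x h1 h2 h3
  rw [phaseGroup, h1, h2, h3,
    SchwartzMap.smulLeftCLM_apply_apply (hasTemperateGrowth_phase_kinetic ħ t), smul_eq_mul]

theorem hasDerivAt_freeGroup_toLp {ħ : ℝ} (hħ : 0 < ħ) (φ : 𝓢(E, ℂ)) :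
    HasDerivAt (fun t => freeGroup ħ t (φ.toLp 2 volume))
      ((Complex.I * ħ / 2 : ℂ) • (Δ φ).toLp 2 volume) 0 := by
  refine (hasDerivAt_freeGroup_iff hħ _ _).2 ⟨?_, _, ?_, rfl⟩
  · rw [Lp.toTemperedDistribution_toLp_eq]
    exact φ.memSobolev
  · rw [Lp.toTemperedDistribution_toLp_eq, Lp.toTemperedDistribution_toLp_eq,
      laplacian_toTemperedDistributionCLM_eq]

/-- The complex conjugate of a Schwartz function. -/
def conjSchwartz (φ : 𝓢(E, ℂ)) : 𝓢(E, ℂ) :=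
  SchwartzMap.postcompCLM (Complex.conjCLE : ℂ →L[ℝ] ℂ) φ

theorem conjSchwartz_apply (φ : 𝓢(E, ℂ)) (x : E) : conjSchwartz φ x = starRingEnd ℂ (φ x) := rfl

theorem conjSchwartz_conjSchwartz (φ : 𝓢(E, ℂ)) : conjSchwartz (conjSchwartz φ) = φ := by
  ext x; simp [conjSchwartz_apply]

theorem laplacian_conjSchwartz (φ : 𝓢(E, ℂ)) : Δ (conjSchwartz φ) = conjSchwartz (Δ φ) := by
  ext x
  rw [conjSchwartz_apply, SchwartzMap.laplacian_apply, SchwartzMap.laplacian_apply]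
  exact (φ.contDiffAt 2).laplacian_CLM_comp_left (l := (Complex.conjCLE : ℂ →L[ℝ] ℂ))

theorem integral_mul_eq_inner (φ : 𝓢(E, ℂ)) (f : L2 (volume : Measure E)) :
    ∫ x, φ x * f x = inner ℂ ((conjSchwartz φ).toLp 2 volume) f := by
  rw [L2.inner_def]
  apply integral_congr_ae
  filter_upwards [(conjSchwartz φ).coeFn_toLp 2 volume] with x hx
  rw [hx, RCLike.inner_apply, conjSchwartz_apply, Complex.conj_conj, mul_comm]

theorem eq_zero_of_inner_schwartz {f : L2 (volume : Measure E)}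
    (h : ∀ χ : 𝓢(E, ℂ), inner ℂ (χ.toLp 2 volume) f = 0) : f = 0 := by
  have hd : DenseRange (SchwartzMap.toLpCLM ℂ ℂ (E := E) 2 volume) :=
    SchwartzMap.denseRange_toLpCLM (by norm_num)
  have h1 : ∀ g, inner ℂ g f = 0 := fun g =>
    hd.induction_on (p := fun g => inner ℂ g f = 0) g
      (isClosed_eq (continuous_id.inner continuous_const) continuous_const) h
  exact inner_self_eq_zero.1 (h1 f)

/-! ### The Hartree equation in the interaction picture -/

/-- Divide by iħ and rewrite the bilinear pairings as inner products, which are antilinear in the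
first slot; hence the conjugate test function. The Laplacian stays on it, where (iħ/2)Δ is the
generator of the free flow. -/
theorem hartree_weak_iff (hw : IsRegular w M) {ħ : ℝ} (hħ : 0 < ħ) (u : ℝ → L2Space)
    (S : Set ℝ) (s : ℝ) (φ : 𝓢(Space, ℂ)) :
    HasDerivWithinAt (fun r => Complex.I * ħ * ∫ x, φ x * u r x)
      (-(ħ ^ 2 / 2 : ℝ) * (∫ x, Δ φ x * u s x) + ∫ x, φ x * (hartreePotential w (u s) x * u s x))
      S s ↔
    HasDerivWithinAt (fun r => inner ℂ ((conjSchwartz φ).toLp 2 volume) (u r))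
      (-inner ℂ ((Complex.I * ħ / 2 : ℂ) • (Δ (conjSchwartz φ)).toLp 2 volume) (u s)
        + inner ℂ ((conjSchwartz φ).toLp 2 volume) (hartreeField hw ħ (u s))) S s := by
  have hħ' : (ħ : ℂ) ≠ 0 := by simp [hħ.ne']
  have hc : (Complex.I * ħ : ℂ) ≠ 0 := by simp [hħ']
  have e1 : ∫ x, φ x * (hartreePotential w (u s) x * u s x)
      = inner ℂ ((conjSchwartz φ).toLp 2 volume) (hartreeOp hw (u s) (u s)) := by
    rw [← integral_mul_eq_inner]
    apply integral_congr_ae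
    filter_upwards [coeFn_mulOp _ (memLp_hartreePotential hw (u s)) (u s)] with x hx
    rw [hartreeOp, hx]
  simp only [e1, integral_mul_eq_inner, laplacian_conjSchwartz, hartreeField, inner_smul_left,
    inner_smul_right]
  set a := inner ℂ ((conjSchwartz (Δ φ)).toLp 2 volume) (u s)
  set b := inner ℂ ((conjSchwartz φ).toLp 2 volume) (hartreeOp hw (u s) (u s))
  have e2 : -((starRingEnd ℂ) (Complex.I * ħ / 2) * a) + -Complex.I / ħ * b
      = (Complex.I * ħ)⁻¹ * (-(ħ ^ 2 / 2 : ℝ) * a + b) := by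
    rw [mul_inv, Complex.inv_I]
    simp only [map_div₀, map_mul, Complex.conj_I, Complex.conj_ofReal, map_ofNat]
    push_cast
    field_simp
    ring
  rw [e2]
  constructor
  · intro h
    have := h.const_mul (Complex.I * ħ : ℂ)⁻¹
    simpa only [inv_mul_cancel_left₀ hc] using this
  · intro h
    have := h.const_mul (Complex.I * ħ : ℂ)
    simpa only [mul_inv_cancel_left₀ hc] using this

theorem hasDerivAt_freeGroup_neg {ħ : ℝ} {f g : L2 (volume : Measure E)}
    (h : HasDerivAt (fun t => freeGroup ħ t f) g 0) (t : ℝ) :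
    HasDerivAt (fun s => freeGroup ħ (-s) f) (-freeGroup ħ (-t) g) t := by
  have := ((isUnitaryGroup_freeGroup ħ).hasDerivAt_apply h (-t)).scomp t (hasDerivAt_neg t)
  rw [neg_smul, one_smul] at this
  exact this

theorem isHartreeSolution_of_interaction_picture (hw : IsRegular w M) {ħ : ℝ} (hħ : 0 < ħ)
    {v : ℝ → L2Space}
    (hv : ∀ s, HasDerivAt v (freeGroup ħ (-s) (hartreeField hw ħ (freeGroup ħ s (v s)))) s)
    (T : ℝ) : IsHartreeSolution ħ w (v 0) T fun s => freeGroup ħ s (v s) := by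
  have hg := isUnitaryGroup_freeGroup (E := Space) ħ
  refine ⟨?_, hg.zero_apply _, fun φ s _ => ?_⟩
  · exact (hg.continuous_apply continuous_id
      (continuous_iff_continuousAt.2 fun s => (hv s).continuousAt)).continuousOn
  · rw [hartree_weak_iff hw hħ (fun s => freeGroup ħ s (v s))]
    refine HasDerivAt.hasDerivWithinAt ?_
    simp only [hg.inner_apply_right]
    have h1 := (hasDerivAt_freeGroup_neg
      (hasDerivAt_freeGroup_toLp hħ (conjSchwartz φ)) s).inner ℂ (hv s)
    refine h1.congr_deriv ?_
    rw [inner_neg_left, hg.inner_apply_left, hg.inner_apply_left, hg.neg_apply_apply, neg_neg,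
      add_comm]

/-- Weak solutions become strong in the interaction picture. Their weak derivative is a
norm-continuous curve, whose integral is C¹ and has the same pairings with the dense set of Schwartz
functions. -/
theorem IsHartreeSolution.hasDerivWithinAt (hw : IsRegular w M) {ħ : ℝ} (hħ : 0 < ħ)
    {ψ : L2Space} {T : ℝ} (hT : 0 ≤ T) {u : ℝ → L2Space} (hu : IsHartreeSolution ħ w ψ T u)
    {s : ℝ} (hs : s ∈ Set.Icc 0 T) :
    HasDerivWithinAt (fun r => freeGroup ħ (-r) (u r)) (freeGroup ħ (-s) (hartreeField hw ħ (u s)))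
      (Set.Icc 0 T) s := by
  have hg := isUnitaryGroup_freeGroup (E := Space) ħ
  set v : ℝ → L2Space := fun r => freeGroup ħ (-r) (u r)
  set F : ℝ → L2Space := fun r => freeGroup ħ (-r) (hartreeField hw ħ (u r))
  have hF : ContinuousOn F (Set.Icc 0 T) :=
    hg.continuous_apply₂ continuous_neg.continuousOn
      ((continuous_hartreeField hw ħ).comp_continuousOn hu.continuousOn)
  -- the weak form in the interaction picture
  have hweak : ∀ χ : 𝓢(Space, ℂ), ∀ r ∈ Set.Icc 0 T,
      HasDerivWithinAt (fun r => inner ℂ (χ.toLp 2 volume) (v r))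
        (inner ℂ (χ.toLp 2 volume) (F r)) (Set.Icc 0 T) r := by
    intro χ r hr
    obtain ⟨η, hη⟩ := exists_freeGroup_toLp_eq ħ r χ
    have h1 := (hartree_weak_iff hw hħ u (Set.Icc 0 T) r (conjSchwartz η)).1
      (hu.equation (conjSchwartz η) r hr)
    rw [conjSchwartz_conjSchwartz] at h1
    set g := (Complex.I * ħ / 2 : ℂ) • (Δ η).toLp 2 volume
    have h2 : HasDerivAt (fun s => freeGroup ħ s (χ.toLp 2 volume)) g r := by
      have h3 := hasDerivAt_freeGroup_toLp hħ η
      rw [← hη] at h3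
      have h4 : (fun t => freeGroup ħ t (freeGroup ħ r (χ.toLp 2 volume)))
          = fun t => freeGroup ħ (r + t) (χ.toLp 2 volume) := by
        funext t; rw [add_comm, hg.add_apply]
      rw [h4] at h3
      have h5 := HasDerivAt.comp_sub_const (x := r) (a := r)
        (f := fun t => freeGroup ħ (r + t) (χ.toLp 2 volume)) (by rw [sub_self]; exact h3)
      simpa only [add_sub_cancel] using h5
    -- The test function moves with s. It is frozen at time r as η, to which the equation applies,
    -- and the motion is left to a remainder.
    have e : ∀ s, inner ℂ (χ.toLp 2 volume) (v s)
        = inner ℂ (η.toLp 2 volume) (u s)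
          + inner ℂ (freeGroup ħ s (χ.toLp 2 volume) - freeGroup ħ r (χ.toLp 2 volume)) (u s) :=
      fun s => by
        simp only [v]
        rw [hg.inner_apply_right, neg_neg, inner_sub_left, hη]
        ring
    simp only [e]
    have h6 : HasDerivWithinAt (fun s => inner ℂ
        (freeGroup ħ s (χ.toLp 2 volume) - freeGroup ħ r (χ.toLp 2 volume)) (u s))
        (inner ℂ g (u r)) (Set.Icc 0 T) r := by
      -- The remainder vanishes at s = r, so its slope is the slope of the test function paired with
      -- u s, and continuity of u is enough for the limit.
      rw [hasDerivWithinAt_iff_tendsto_slope]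
      have h7 := (hasDerivWithinAt_iff_tendsto_slope.1 (h2.hasDerivWithinAt (s := Set.Icc 0 T)))
      have h8 := (hu.continuousOn r hr).mono_left (nhdsWithin_mono r
        (Set.sdiff_subset (s := Set.Icc 0 T) (t := {r})))
      refine (h7.inner h8).congr fun s => ?_
      simp only [slope_def_module, sub_self, inner_zero_left, sub_zero]
      rw [RCLike.real_smul_eq_coe_smul (K := ℂ), inner_smul_left, RCLike.real_smul_eq_coe_smul (K := ℂ)]
      simp
    refine (h1.add h6).congr_deriv ?_
    simp only [F]
    rw [hg.inner_apply_right, neg_neg, hη]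
    ring
  -- integrate
  set G : ℝ → L2Space := Set.IccExtend hT ((Set.Icc 0 T).domRestrict F)
  have hG : Continuous G := hF.domRestrict.Icc_extend'
  have hGF : ∀ r ∈ Set.Icc 0 T, G r = F r := fun r hr => by
    simp only [G]
    rw [Set.IccExtend_of_mem _ _ hr]; rfl
  set I : ℝ → L2Space := fun r => v 0 + ∫ x in (0 : ℝ)..r, G x
  have hI : ∀ r, HasDerivAt I (G r) r := fun r =>
    (hG.integral_hasStrictDerivAt 0 r).hasDerivAt.const_add _
  have h0 : (0 : ℝ) ∈ Set.Icc 0 T := ⟨le_rfl, hT⟩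
  have heq : ∀ r ∈ Set.Icc 0 T, v r = I r := by
    intro r hr
    rw [← sub_eq_zero]
    refine eq_zero_of_inner_schwartz fun χ => ?_
    have hd : ∀ x ∈ Set.Icc 0 T, HasDerivWithinAt (fun x => inner ℂ (χ.toLp 2 volume) (v x - I x))
        0 (Set.Icc 0 T) x := fun x hx => by
      simp only [inner_sub_right]
      refine ((hweak χ x hx).sub ((hasDerivAt_const x (χ.toLp 2 volume)).inner ℂ
        (hI x)).hasDerivWithinAt).congr_deriv ?_
      rw [hGF x hx, inner_zero_left, add_zero, sub_self]
    have hc := (convex_Icc 0 T).norm_image_sub_le_of_norm_hasDerivWithin_le (C := 0) hd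
      (fun x _ => by simp) h0 hr
    have hI0 : I 0 = v 0 := by simp [I]
    rw [hI0, sub_self, inner_zero_right, sub_zero, zero_mul] at hc
    exact norm_le_zero_iff.1 hc
  have := (hI s).hasDerivWithinAt (s := Set.Icc 0 T)
  rw [hGF s hs] at this
  exact this.congr heq (heq s hs)

theorem IsHartreeSolution.norm_eq (hw : IsRegular w M) {ħ : ℝ} (hħ : 0 < ħ)
    {ψ : L2Space} {T : ℝ} (hT : 0 ≤ T) {u : ℝ → L2Space} (hu : IsHartreeSolution ħ w ψ T u)
    {s : ℝ} (hs : s ∈ Set.Icc 0 T) : ‖u s‖ = ‖ψ‖ := by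
  have hg := isUnitaryGroup_freeGroup (E := Space) ħ
  have h := norm_eq_of_skew (t₀ := 0) ⟨le_rfl, hT⟩
    (fun t ht => hu.hasDerivWithinAt hw hħ hT ht) (fun t _ => by
      rw [hg.inner_map_map, re_inner_hartreeField]) hs
  simp only [hg.norm_map] at h
  rw [h, hu.initial]

theorem exists_isHartreeSolution (hw : IsRegular w M) {ħ : ℝ} (hħ : 0 < ħ) (ψ : L2Space) (T : ℝ) :
    ∃ u, IsHartreeSolution ħ w ψ T u := by
  have hg := isUnitaryGroup_freeGroup (E := Space) ħ
  set R : ℝ := ‖ψ‖ + 1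
  have hR : 0 < R := by positivity
  have hM := hw.nonneg
  -- On the ball of radius R the factor ‖f‖² + (‖f‖ + ‖g‖)‖g‖ is at most 3R²; the prefactor of the
  -- field contributes ħ⁻¹.
  obtain ⟨v, hv0, hv⟩ := exists_skew_solution
    (F := fun s v => freeGroup ħ (-s) (hartreeField hw ħ (freeGroup ħ s v))) (R := R)
    (K := (ħ⁻¹ * (M * (3 * R ^ 2))).toNNReal) (x₀ := ψ) hR
    (fun x => hg.continuous_apply continuous_neg
      ((continuous_hartreeField hw ħ).comp (hg.strong_continuity x)))
    (fun t => by
      refine LipschitzOnWith.of_dist_le_mul fun x hx y hy => ?_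
      rw [mem_closedBall_zero_iff] at hx hy
      rw [dist_eq_norm, dist_eq_norm, ← map_sub, hg.norm_map, hartreeField, hartreeField,
        ← smul_sub, norm_smul, Real.coe_toNNReal _ (by positivity), mul_assoc]
      have h1 := norm_hartreeOp_self_sub_le hw (freeGroup ħ t x) (freeGroup ħ t y)
      rw [← map_sub, hg.norm_map, hg.norm_map, hg.norm_map] at h1
      have h2 : ‖(-Complex.I / ħ : ℂ)‖ = ħ⁻¹ := by simp [abs_of_pos hħ]
      rw [h2]
      refine mul_le_mul_of_nonneg_left (h1.trans ?_) (by positivity)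
      refine mul_le_mul_of_nonneg_right (mul_le_mul_of_nonneg_left ?_ hM) (norm_nonneg _)
      have := norm_nonneg x
      have := norm_nonneg y
      nlinarith)
    (fun t x => by rw [hg.inner_apply_right, neg_neg, re_inner_hartreeField])
    (by simp [R])
  refine ⟨_, hv0 ▸ isHartreeSolution_of_interaction_picture hw hħ (fun s => (hv s).1) T⟩

end hartree

/-! ### The energy exchange estimate for the counting functional -/

section pairSystem
variable {ι H : Type*} [Fintype ι] [DecidableEq ι] [NormedAddCommGroup H] [InnerProductSpace ℂ H]

/-- Particles labelled by `ι` with one-particle projections `p j`, pair interactions `w j k` and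
mean-field potentials `V j`, where `V j` is the average of `w j k` over the range of `p k`. -/
structure PairSystem (ι H : Type*) [NormedAddCommGroup H] [InnerProductSpace ℂ H] (M : ℝ) where
  p : ι → H →L[ℂ] H
  w : ι → ι → H →L[ℂ] H
  V : ι → H →L[ℂ] H
  p_idem : ∀ j x, p j (p j x) = p j x
  inner_p : ∀ j x y, inner ℂ (p j x) y = inner ℂ x (p j y)
  p_comm : ∀ j k x, p j (p k x) = p k (p j x)
  w_symm : ∀ j k, w j k = w k j
  norm_w_le : ∀ j k x, ‖w j k x‖ ≤ M * ‖x‖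
  inner_V : ∀ j x y, inner ℂ (V j x) y = inner ℂ x (V j y)
  norm_V_le : ∀ j x, ‖V j x‖ ≤ M * ‖x‖
  p_w : ∀ j k l, l ≠ j → l ≠ k → ∀ x, p l (w j k x) = w j k (p l x)
  p_w_p : ∀ j k, j ≠ k → ∀ x, p k (w j k (p k x)) = V j (p k x)

namespace PairSystem
variable {M : ℝ} (S : PairSystem ι H M)

/-- The complementary projection. -/
def q (j : ι) : H →L[ℂ] H := ContinuousLinearMap.id ℂ H - S.p j

theorem q_apply (j : ι) (x : H) : S.q j x = x - S.p j x := rfl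

theorem q_idem (j : ι) (x : H) : S.q j (S.q j x) = S.q j x := by
  simp [q_apply, S.p_idem]

theorem q_p (j : ι) (x : H) : S.q j (S.p j x) = 0 := by simp [q_apply, S.p_idem]

theorem inner_q (j : ι) (x y : H) : inner ℂ (S.q j x) y = inner ℂ x (S.q j y) := by
  simp only [q_apply, inner_sub_left, inner_sub_right, S.inner_p]

theorem q_comm (j k : ι) (x : H) : S.q j (S.q k x) = S.q k (S.q j x) := by
  simp only [q_apply, map_sub, S.p_comm j k]; abel

theorem q_p_comm (j k : ι) (x : H) : S.q j (S.p k x) = S.p k (S.q j x) := by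
  simp only [q_apply, map_sub, S.p_comm j k]

theorem q_w {j k l : ι} (hj : l ≠ j) (hk : l ≠ k) (x : H) :
    S.q l (S.w j k x) = S.w j k (S.q l x) := by
  simp only [q_apply, map_sub, S.p_w j k l hj hk]

theorem norm_p_le (j : ι) (x : H) : ‖S.p j x‖ ≤ ‖x‖ := by
  have h : ‖S.p j x‖ ^ 2 ≤ ‖S.p j x‖ * ‖x‖ := by
    have h1 : inner ℂ (S.p j x) (S.p j x) = inner ℂ (S.p j x) x := by
      rw [← S.inner_p, S.p_idem]
    have h2 := norm_inner_le_norm (𝕜 := ℂ) (S.p j x) x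
    rw [← h1, inner_self_eq_norm_sq_to_K] at h2
    simpa using h2
  rcases eq_or_lt_of_le (norm_nonneg (S.p j x)) with h0 | h0
  · rw [← h0]; exact norm_nonneg x
  · rw [pow_two] at h
    exact le_of_mul_le_mul_left h h0

theorem norm_q_le (j : ι) (x : H) : ‖S.q j x‖ ≤ ‖x‖ := by
  have h : ‖S.q j x‖ ^ 2 ≤ ‖S.q j x‖ * ‖x‖ := by
    have h1 : inner ℂ (S.q j x) (S.q j x) = inner ℂ (S.q j x) x := by
      rw [← S.inner_q, S.q_idem]
    have h2 := norm_inner_le_norm (𝕜 := ℂ) (S.q j x) x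
    rw [← h1, inner_self_eq_norm_sq_to_K] at h2
    simpa using h2
  rcases eq_or_lt_of_le (norm_nonneg (S.q j x)) with h0 | h0
  · rw [← h0]; exact norm_nonneg x
  · rw [pow_two] at h
    exact le_of_mul_le_mul_left h h0

theorem norm_sq_q (j : ι) (x : H) : ‖S.q j x‖ ^ 2 = ‖x‖ ^ 2 - (inner ℂ x (S.p j x)).re := by
  have h1 : inner ℂ (S.q j x) (S.q j x) = inner ℂ x x - inner ℂ x (S.p j x) := by
    rw [S.inner_q, S.q_idem, q_apply, inner_sub_right]
  have h2 := congrArg Complex.re h1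
  rw [inner_self_eq_norm_sq_to_K, inner_self_eq_norm_sq_to_K, Complex.sub_re] at h2
  exact_mod_cast h2

/-- The vector `∑_{k ≠ j} q_k w_{jk} p_j p_k Ψ`. -/
def pairVector (Ψ : H) (j : ι) : H :=
  ∑ k, if j = k then 0 else S.q k (S.w j k (S.p j (S.p k Ψ)))

/-- The terms are almost orthogonal. Distinct k, l contribute M² ‖q_k Ψ‖ ‖q_l Ψ‖ and the diagonal
only M² each, so Cauchy–Schwarz gives order n(β + 1) instead of n². -/
theorem norm_pairVector_sq_le (hM : 0 ≤ M) {Ψ : H} (hΨ : ‖Ψ‖ = 1) (j : ι) :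
    ‖S.pairVector Ψ j‖ ^ 2
      ≤ M ^ 2 * (Fintype.card ι * (∑ k, ‖S.q k Ψ‖ ^ 2 + 1)) := by
  set y : ι → H := fun k => if j = k then 0 else S.q k (S.w j k (S.p j (S.p k Ψ)))
  have hwp : ∀ k x, ‖S.w j k (S.p j (S.p k x))‖ ≤ M * ‖x‖ := fun k x =>
    (S.norm_w_le _ _ _).trans (mul_le_mul_of_nonneg_left
      ((S.norm_p_le _ _).trans (S.norm_p_le _ _)) hM)
  have hdiag : ∀ k, ‖y k‖ ≤ M := fun k => by
    simp only [y]
    split_ifs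
    · simpa using hM
    · refine (S.norm_q_le _ _).trans ((hwp k Ψ).trans ?_)
      rw [hΨ, mul_one]
  have hoff : ∀ k l, k ≠ l → ‖inner ℂ (y k) (y l)‖ ≤ M ^ 2 * (‖S.q k Ψ‖ * ‖S.q l Ψ‖) := by
    intro k l hkl
    by_cases hk : j = k
    · simp only [y, if_pos hk, inner_zero_left, norm_zero]; positivity
    by_cases hl : j = l
    · simp only [y, if_pos hl, inner_zero_right, norm_zero]; positivity
    -- q_l commutes with everything in the k-th vector, so it passes from the l-th vector through to
    -- Ψ on the left; q_k passes to the right in the same way.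
    have e : inner ℂ (y k) (y l) = inner ℂ (S.w j k (S.p j (S.p k (S.q l Ψ))))
        (S.w j l (S.p j (S.p l (S.q k Ψ)))) := by
      simp only [y, if_neg hk, if_neg hl]
      rw [← S.inner_q l, S.q_comm l k, S.q_w (Ne.symm hl) hkl.symm, S.q_p_comm l j,
        S.q_p_comm l k, S.inner_q k, S.q_w (Ne.symm hk) hkl, S.q_p_comm k j, S.q_p_comm k l]
    rw [e]
    refine (norm_inner_le_norm _ _).trans ?_
    refine (mul_le_mul (hwp k _) (hwp l _) (norm_nonneg _) (by positivity)).trans (le_of_eq ?_)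
    ring
  have hpt : ∀ k l, ‖inner ℂ (y k) (y l)‖
      ≤ M ^ 2 * (‖S.q k Ψ‖ * ‖S.q l Ψ‖) + if k = l then M ^ 2 else 0 := by
    intro k l
    by_cases hkl : k = l
    · subst hkl
      rw [if_pos rfl]
      have h1 : ‖inner ℂ (y k) (y k)‖ ≤ M ^ 2 := by
        refine (norm_inner_le_norm _ _).trans ?_
        rw [pow_two]
        exact mul_le_mul (hdiag k) (hdiag k) (norm_nonneg _) hM
      have h2 : 0 ≤ M ^ 2 * (‖S.q k Ψ‖ * ‖S.q k Ψ‖) := by positivity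
      linarith
    · rw [if_neg hkl, add_zero]
      exact hoff k l hkl
  have h1 : ‖S.pairVector Ψ j‖ ^ 2 = ‖inner ℂ (∑ k, y k) (∑ k, y k)‖ := by
    rw [inner_self_eq_norm_sq_to_K]
    simp [pairVector, y]
  rw [h1, sum_inner]
  refine (norm_sum_le _ _).trans ?_
  have h2 : ∀ k, ‖inner ℂ (y k) (∑ l, y l)‖
      ≤ M ^ 2 * (‖S.q k Ψ‖ * ∑ l, ‖S.q l Ψ‖) + M ^ 2 := fun k => by
    rw [inner_sum]
    refine (norm_sum_le _ _).trans ((Finset.sum_le_sum fun l _ => hpt k l).trans (le_of_eq ?_))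
    rw [Finset.sum_add_distrib, Finset.sum_ite_eq, if_pos (Finset.mem_univ k), Finset.mul_sum,
      Finset.mul_sum]
  refine (Finset.sum_le_sum fun k _ => h2 k).trans ?_
  rw [Finset.sum_add_distrib, ← Finset.mul_sum, ← Finset.sum_mul, Finset.sum_const,
    Finset.card_univ, nsmul_eq_mul]
  have h3 := sq_sum_le_card_mul_sum_sq (s := Finset.univ) (f := fun k => ‖S.q k Ψ‖)
  rw [Finset.card_univ] at h3
  nlinarith [mul_le_mul_of_nonneg_left h3 (sq_nonneg M)]

/-- Pairs avoiding j commute with q_j and die because q_j p_j = 0. Each pair containing j occurs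
twice among the ordered pairs. -/
theorem card_mul_inner_interaction {W : H →L[ℂ] H}
    (hW : (2 * Fintype.card ι : ℂ) • W = ∑ i, ∑ j, if i = j then 0 else S.w i j) (Ψ : H) (j : ι) :
    (Fintype.card ι : ℂ) * inner ℂ (S.q j Ψ) (W (S.p j Ψ))
      = ∑ k, if j = k then 0 else inner ℂ (S.q j Ψ) (S.w j k (S.p j Ψ)) := by
  set f : ι → ι → ℂ := fun a b => if a = b then 0 else inner ℂ (S.q j Ψ) (S.w a b (S.p j Ψ))
  have hf : ∀ a b, f a b = (if a = j then f j b else 0) + if b = j then f j a else 0 := by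
    intro a b
    by_cases ha : a = j
    · subst ha
      by_cases hb : b = a
      · subst hb; simp [f]
      · simp [hb]
    · by_cases hb : b = j
      · subst hb
        simp only [ha, if_false, if_true, zero_add, f, Ne.symm ha, S.w_symm b a]
      · simp only [ha, hb, if_false, add_zero, f]
        split_ifs
        · rfl
        · rw [S.inner_q, S.q_w (Ne.symm ha) (Ne.symm hb), S.q_p, map_zero, inner_zero_right]
  have h1 : (2 * Fintype.card ι : ℂ) * inner ℂ (S.q j Ψ) (W (S.p j Ψ)) = ∑ a, ∑ b, f a b := by
    have := congrArg (inner ℂ (S.q j Ψ)) (DFunLike.congr_fun hW (S.p j Ψ))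
    rw [smul_apply, inner_smul_right] at this
    rw [this, sum_apply, inner_sum]
    refine Finset.sum_congr rfl fun a _ => ?_
    rw [sum_apply, inner_sum]
    refine Finset.sum_congr rfl fun b _ => ?_
    simp only [f]
    split_ifs <;> simp
  have h2 : ∑ a, ∑ b, f a b = 2 * ∑ b, f j b := by
    have e0 : ∑ a, ∑ b, f a b
        = ∑ a, ∑ b, ((if a = j then f j b else 0) + if b = j then f j a else 0) :=
      Finset.sum_congr rfl fun a _ => Finset.sum_congr rfl fun b _ => hf a b
    have e1 : ∑ a, ∑ b, (if a = j then f j b else 0) = ∑ b, f j b := by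
      rw [Finset.sum_eq_single_of_mem j (Finset.mem_univ j) fun a _ ha => by simp [ha]]
      simp
    have e2 : ∑ a, ∑ b, (if b = j then f j a else 0) = ∑ b, f j b := by simp
    rw [e0]
    simp only [Finset.sum_add_distrib]
    rw [e1, e2, two_mul]
  rw [h2, mul_assoc] at h1
  exact mul_left_cancel₀ two_ne_zero h1

/-- The condensate average of w_jk cancels V_j. There remain the creation term `pairVector`, terms
with an extra q_k Ψ, and one uncancelled V_j, since j has only n - 1 partners. -/
theorem norm_card_mul_inner_le (hM : 0 ≤ M) {W : H →L[ℂ] H}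
    (hW : (2 * Fintype.card ι : ℂ) • W = ∑ i, ∑ j, if i = j then 0 else S.w i j) (Ψ : H) (j : ι)
    (hΨ : ‖Ψ‖ = 1) :
    Fintype.card ι * ‖inner ℂ (S.q j Ψ) (W (S.p j Ψ) - S.V j (S.p j Ψ))‖
      ≤ ‖S.q j Ψ‖ * ‖S.pairVector Ψ j‖ + 2 * M * (‖S.q j Ψ‖ * ∑ k, ‖S.q k Ψ‖)
        + M * ‖S.q j Ψ‖ := by
  set X : ι → ℂ := fun k => if j = k then 0 else
    inner ℂ (S.q j Ψ) (S.w j k (S.q k (S.p j Ψ)) - S.V j (S.q k (S.p j Ψ)))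
  -- Insert p_k + q_k on both sides of w_jk: p_k w_jk p_k = V_j p_k, and V_j p_k p_j = V_j p_j - V_j
  -- q_k p_j, so X k collects w_jk - V_j on q_k p_j Ψ.
  have key : ∀ k, (if j = k then 0 else inner ℂ (S.q j Ψ) (S.w j k (S.p j Ψ)))
      = (inner ℂ (S.q j Ψ) (if j = k then 0 else S.q k (S.w j k (S.p j (S.p k Ψ)))) + X k)
        + if j = k then 0 else inner ℂ (S.q j Ψ) (S.V j (S.p j Ψ)) := by
    intro k
    by_cases hk : j = k
    · simp [hk, X]
    · simp only [X, if_neg hk]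
      have e0 : S.p j (S.p k Ψ) = S.p k (S.p j Ψ) := S.p_comm j k Ψ
      have e1 : S.q k (S.p j Ψ) = S.p j Ψ - S.p k (S.p j Ψ) := rfl
      have e2 : S.q k (S.w j k (S.p k (S.p j Ψ)))
          = S.w j k (S.p k (S.p j Ψ)) - S.V j (S.p k (S.p j Ψ)) := by
        rw [q_apply, S.p_w_p j k hk]
      rw [e0, e2, e1, map_sub, map_sub, ← inner_add_right, ← inner_add_right]
      congr 1
      abel
  have hcard : ∑ k, (if j = k then 0 else inner ℂ (S.q j Ψ) (S.V j (S.p j Ψ)))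
      = (Fintype.card ι : ℂ) * inner ℂ (S.q j Ψ) (S.V j (S.p j Ψ))
        - inner ℂ (S.q j Ψ) (S.V j (S.p j Ψ)) := by
    set c := inner ℂ (S.q j Ψ) (S.V j (S.p j Ψ))
    have : ∀ k, (if j = k then 0 else c) = c - if j = k then c else 0 := fun k => by
      split_ifs <;> simp
    simp_rw [this]
    rw [Finset.sum_sub_distrib, Finset.sum_ite_eq, if_pos (Finset.mem_univ j), Finset.sum_const,
      Finset.card_univ, nsmul_eq_mul]
  have h1 : (Fintype.card ι : ℂ) * inner ℂ (S.q j Ψ) (W (S.p j Ψ) - S.V j (S.p j Ψ))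
      = inner ℂ (S.q j Ψ) (S.pairVector Ψ j) + ∑ k, X k
        - inner ℂ (S.q j Ψ) (S.V j (S.p j Ψ)) := by
    rw [inner_sub_right, mul_sub, S.card_mul_inner_interaction hW]
    simp_rw [key]
    rw [Finset.sum_add_distrib, hcard, Finset.sum_add_distrib, pairVector, inner_sum]
    ring
  have h2 : (Fintype.card ι : ℝ) * ‖inner ℂ (S.q j Ψ) (W (S.p j Ψ) - S.V j (S.p j Ψ))‖
      = ‖(Fintype.card ι : ℂ) * inner ℂ (S.q j Ψ) (W (S.p j Ψ) - S.V j (S.p j Ψ))‖ := by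
    rw [norm_mul, Complex.norm_natCast]
  rw [h2, h1]
  have hX : ∀ k, ‖X k‖ ≤ 2 * M * (‖S.q j Ψ‖ * ‖S.q k Ψ‖) := fun k => by
    simp only [X]
    split_ifs
    · rw [norm_zero]; positivity
    · refine (norm_inner_le_norm _ _).trans ?_
      have e : ‖S.q k (S.p j Ψ)‖ ≤ ‖S.q k Ψ‖ := by
        rw [S.q_p_comm]; exact S.norm_p_le _ _
      have e1 : ‖S.w j k (S.q k (S.p j Ψ)) - S.V j (S.q k (S.p j Ψ))‖
          ≤ 2 * M * ‖S.q k Ψ‖ := by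
        refine (norm_sub_le _ _).trans ((add_le_add (S.norm_w_le _ _ _) (S.norm_V_le _ _)).trans ?_)
        nlinarith [mul_le_mul_of_nonneg_left e hM]
      calc _ ≤ ‖S.q j Ψ‖ * (2 * M * ‖S.q k Ψ‖) := mul_le_mul_of_nonneg_left e1 (norm_nonneg _)
        _ = _ := by ring
  have h3 : ‖∑ k, X k‖ ≤ 2 * M * (‖S.q j Ψ‖ * ∑ k, ‖S.q k Ψ‖) := by
    refine (norm_sum_le _ _).trans ((Finset.sum_le_sum fun k _ => hX k).trans (le_of_eq ?_))
    rw [Finset.mul_sum, Finset.mul_sum]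
  have h4 : ‖inner ℂ (S.q j Ψ) (S.V j (S.p j Ψ))‖ ≤ M * ‖S.q j Ψ‖ := by
    refine (norm_inner_le_norm _ _).trans ?_
    have : ‖S.V j (S.p j Ψ)‖ ≤ M := by
      refine (S.norm_V_le _ _).trans ?_
      have := (S.norm_p_le j Ψ).trans_eq hΨ
      nlinarith
    rw [mul_comm]
    exact mul_le_mul_of_nonneg_right this (norm_nonneg _)
  refine (norm_sub_le _ _).trans (add_le_add ((norm_add_le _ _).trans (add_le_add ?_ h3)) h4)
  exact norm_inner_le_norm _ _

/-- The rate of change of the number of particles outside the condensate is controlled by that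
number. -/
theorem abs_sum_im_inner_le [Nonempty ι] (hM : 0 ≤ M) {W : H →L[ℂ] H}
    (hW : (2 * Fintype.card ι : ℂ) • W = ∑ i, ∑ j, if i = j then 0 else S.w i j)
    (hWs : ∀ x y, inner ℂ (W x) y = inner ℂ x (W y)) {Ψ : H} (hΨ : ‖Ψ‖ = 1) :
    |∑ j, (inner ℂ Ψ (W (S.p j Ψ) - S.V j (S.p j Ψ))).im|
      ≤ 4 * M * (∑ j, ‖S.q j Ψ‖ ^ 2 + 1) := by
  -- W and V_j are symmetric, so the expectation in p_j Ψ is real and only the component q_j Ψ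
  -- contributes.
  have him : ∀ j, (inner ℂ Ψ (W (S.p j Ψ) - S.V j (S.p j Ψ))).im
      = (inner ℂ (S.q j Ψ) (W (S.p j Ψ) - S.V j (S.p j Ψ))).im := fun j => by
    rw [q_apply, inner_sub_left, Complex.sub_im, eq_comm, sub_eq_self]
    have := inner_conj_symm (𝕜 := ℂ) (S.p j Ψ) (W (S.p j Ψ) - S.V j (S.p j Ψ))
    rw [inner_sub_left, hWs, S.inner_V, ← inner_sub_right] at this
    exact Complex.conj_eq_iff_im.1 this
  simp_rw [him]
  set n : ℝ := (Fintype.card ι : ℝ)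
  have hn : 0 < n := Nat.cast_pos.2 Fintype.card_pos
  set β := ∑ j, ‖S.q j Ψ‖ ^ 2
  have hβ : 0 ≤ β := Finset.sum_nonneg fun j _ => sq_nonneg _
  set s := ∑ j, ‖S.q j Ψ‖
  have hs : 0 ≤ s := Finset.sum_nonneg fun j _ => norm_nonneg _
  have hs2 : s ^ 2 ≤ n * β := by
    have h3 := sq_sum_le_card_mul_sum_sq (s := Finset.univ) (f := fun k => ‖S.q k Ψ‖)
    rwa [Finset.card_univ] at h3
  have hsn : s ≤ n := by
    have h1 : ∀ j ∈ Finset.univ, ‖S.q j Ψ‖ ≤ 1 := fun j _ => (S.norm_q_le j Ψ).trans_eq hΨ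
    have := Finset.sum_le_sum h1
    simpa [s, n] using this
  set r := √(n * (β + 1))
  have hr : r ^ 2 = n * (β + 1) := Real.sq_sqrt (by positivity)
  have hr0 : 0 ≤ r := Real.sqrt_nonneg _
  have hsr : s ≤ r := by
    refine abs_le_of_sq_le_sq' (by nlinarith) hr0 |>.2
  have hY : ∀ j, ‖S.pairVector Ψ j‖ ≤ M * r := fun j => by
    refine (abs_le_of_sq_le_sq' ?_ (by positivity)).2
    rw [mul_pow, hr]
    exact S.norm_pairVector_sq_le hM hΨ j
  have hj : ∀ j, n * |(inner ℂ (S.q j Ψ) (W (S.p j Ψ) - S.V j (S.p j Ψ))).im|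
      ≤ ‖S.q j Ψ‖ * (M * r + 2 * M * s + M) := fun j => by
    have h1 := S.norm_card_mul_inner_le hM hW Ψ j hΨ
    have h2 := mul_le_mul_of_nonneg_left (Complex.abs_im_le_norm
      (inner ℂ (S.q j Ψ) (W (S.p j Ψ) - S.V j (S.p j Ψ)))) hn.le
    have h3 := mul_le_mul_of_nonneg_left (hY j) (norm_nonneg (S.q j Ψ))
    refine h2.trans (h1.trans ?_)
    nlinarith
  have hsum : n * |∑ j, (inner ℂ (S.q j Ψ) (W (S.p j Ψ) - S.V j (S.p j Ψ))).im|
      ≤ s * (M * r + 2 * M * s + M) := by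
    refine (mul_le_mul_of_nonneg_left (Finset.abs_sum_le_sum_abs _ _) hn.le).trans ?_
    rw [Finset.mul_sum, Finset.sum_mul]
    exact Finset.sum_le_sum fun j _ => hj j
  refine le_of_mul_le_mul_left (hsum.trans ?_) hn
  have h1 : s * r ≤ n * (β + 1) := by
    rw [← hr, pow_two]; exact mul_le_mul_of_nonneg_right hsr hr0
  have h2 : s * (M * r + 2 * M * s + M) = M * (s * r + 2 * s ^ 2 + s) := by ring
  rw [h2]
  -- The three terms are at most n(β + 1), 2nβ and n; dividing by n leaves the factor 4.
  have h3 : s * r + 2 * s ^ 2 + s ≤ 4 * (n * (β + 1)) := by nlinarith [mul_nonneg hn.le hβ]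
  calc _ ≤ M * (4 * (n * (β + 1))) := mul_le_mul_of_nonneg_left h3 hM
    _ = _ := by ring

end PairSystem
end pairSystem

/-! ### Control of the number of particles outside the condensate -/

section condensate
open InnerProductSpace

variable {w : Space → ℝ} {M : ℝ} {n : ℕ}

theorem onBody_comp (j : Fin (n + 1)) (b c : L2Space →L[ℂ] L2Space) (x : L2Config (n + 1)) :
    onBody j (b ∘L c) x = onBody j b (onBody j c x) := by
  rw [onBody, ampl_comp]; rfl

theorem adjoint_hartreeOp (hw : IsRegular w M) (u : L2Space) :
    ContinuousLinearMap.adjoint (hartreeOp hw u) = hartreeOp hw u := by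
  refine ((ContinuousLinearMap.eq_adjoint_iff _ _).2 fun x y => ?_).symm
  exact inner_hartreeOp hw u x y

theorem norm_hartreeOp_le_of_norm_eq_one (hw : IsRegular w M) {u : L2Space} (hu : ‖u‖ = 1) :
    ‖hartreeOp hw u‖ ≤ M :=
  ContinuousLinearMap.opNorm_le_bound _ hw.nonneg fun f =>
    (norm_hartreeOp_le hw u f).trans_eq (by rw [hu]; ring)

/-- The projections onto the condensate wave function `u`, together with the interaction. -/
def condensateSystem (hw : IsRegular w M) (n : ℕ) {u : L2Space} (hu : ‖u‖ = 1) :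
    PairSystem (Fin (n + 1)) (L2Config (n + 1)) M where
  p j := onBody j (rankOne ℂ u u)
  w j k := pairOp hw j k
  V j := onBody j (hartreeOp hw u)
  p_idem j x := by
    rw [← onBody_comp]
    congr 2
    ext1 f
    simp only [ContinuousLinearMap.comp_apply, rankOne_apply, map_smul]
    rw [inner_self_eq_norm_sq_to_K, hu]
    simp
  inner_p j x y := by rw [inner_onBody_left, adjoint_rankOne]
  p_comm j k x := by
    by_cases h : j = k
    · rw [h]
    · exact onBody_comm h _ _ x
  w_symm := pairOp_comm hw
  norm_w_le := norm_pairOp_le hw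
  inner_V j x y := by rw [inner_onBody_left, adjoint_hartreeOp]
  norm_V_le j x := (norm_ampl_apply_le _ _ _ x).trans (mul_le_mul_of_nonneg_right
    (norm_hartreeOp_le_of_norm_eq_one hw hu) (norm_nonneg x))
  p_w j k l hj hk x := by
    -- Once particle l is singled out, w(x_j - x_k) is a function of the other particles only.
    obtain ⟨j, rfl⟩ := Fin.exists_succAbove_eq hj.symm
    obtain ⟨k, rfl⟩ := Fin.exists_succAbove_eq hk.symm
    exact ampl_mulOp_comm (singleOut l) (measurePreserving_singleOut l) (rankOne ℂ u u)
      (hw.memLp_pair j k) (hw.memLp_pair (l.succAbove j) (l.succAbove k)) x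
  p_w_p j k h x := by
    -- Averaging w(x_j - y) over |u(y)|² in the variable of particle k gives (w ∗ |u|²)(x_j).
    obtain ⟨j, rfl⟩ := Fin.exists_succAbove_eq h
    have hm : Measurable (hartreePotential w u) := measurable_hartreePotential hw u
    have hmw := hw.measurable
    have hmj := measurable_particle j
    have hmjk := measurable_particle (k.succAbove j)
    have hV : MemLp (fun x : Config (n + 1) =>
        (hartreePotential w u (particle (k.succAbove j) x) : ℂ)) ∞ volume :=
      memLp_top_of_bound (C := M * ‖u‖ ^ 2) (Measurable.aestronglyMeasurable (by fun_prop))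
        (Eventually.of_forall fun x => norm_hartreePotential_le hw u _)
    have e := ampl_mulOp (singleOut (k.succAbove j)) (measurePreserving_singleOut (k.succAbove j))
      (memLp_hartreePotential hw u) hV
    show _ = ampl _ _ (mulOp _ (memLp_hartreePotential hw u)) _
    rw [e]
    refine ampl_rankOne_mulOp_ampl_rankOne (singleOut k) (measurePreserving_singleOut k) u
      (F := fun z => (w (particle j z.2 - z.1) : ℂ))
      (G := fun z => (hartreePotential w u (particle j z) : ℂ)) ?_ ?_ ?_ hV ?_ x
    · refine memLp_top_of_bound (C := M) (Measurable.aestronglyMeasurable (by fun_prop))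
        (Eventually.of_forall fun x => by rw [Complex.norm_real]; exact hw.bound _)
    · exact memLp_top_of_bound (C := M * ‖u‖ ^ 2) (Measurable.aestronglyMeasurable (by fun_prop))
        (Eventually.of_forall fun x => norm_hartreePotential_le hw u _)
    · intro z
      simp only [hartreePotential]
      rw [← integral_complex_ofReal]
      congr 1
      funext y
      push_cast
      rfl

/-- The overlap of the state with the condensate is the same in the interaction picture, so the
N-body and Hartree kinetic energies cancel before anything is differentiated. -/
theorem freeGroup_onBody_rankOne (ħ s : ℝ) (j : Fin (n + 1)) (x y : L2Space)
    (Ψ : L2Config (n + 1)) :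
    freeGroup ħ s (onBody j (rankOne ℂ (freeGroup ħ (-s) x) (freeGroup ħ (-s) y))
      (freeGroup ħ (-s) Ψ)) = onBody j (rankOne ℂ x y) Ψ := by
  have hg := isUnitaryGroup_freeGroup (E := Space) ħ
  rw [freeGroup_onBody, (isUnitaryGroup_freeGroup (E := Config (n + 1)) ħ).apply_neg_apply]
  congr 2
  ext1 f
  simp only [ContinuousLinearMap.comp_apply, rankOne_apply, map_smul]
  rw [hg.inner_map_map, hg.apply_neg_apply]

/-- `rankOne` as a real bilinear map. -/
def rankOneℝ : L2Space →L[ℝ] L2Space →L[ℝ] (L2Space →L[ℂ] L2Space) :=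
  LinearMap.mkContinuous₂ (LinearMap.mk₂ ℝ (fun x y => rankOne ℂ x y)
    (fun x x' y => by simp)
    (fun c x y => by
      ext1 f
      show inner ℂ y f • (c • x) = c • (inner ℂ y f • x)
      rw [smul_comm])
    (fun x y y' => by simp)
    (fun c x y => by
      ext1 f
      show inner ℂ (c • y) f • x = c • (inner ℂ y f • x)
      rw [RCLike.real_smul_eq_coe_smul (K := ℂ) c y,
        RCLike.real_smul_eq_coe_smul (K := ℂ) c (inner ℂ y f • x), inner_smul_left, mul_smul]
      simp)) 1
    (fun x y => by simp)

/-- The product rule gives four terms, which pair into complex conjugates because |v⟩⟨v| is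
self-adjoint. -/
theorem hasDerivWithinAt_inner_onBody {Φ : ℝ → L2Config (n + 1)} {Φ' : L2Config (n + 1)}
    {v : ℝ → L2Space} {v' : L2Space} {S : Set ℝ} {s : ℝ} (j : Fin (n + 1))
    (hΦ : HasDerivWithinAt Φ Φ' S s) (hv : HasDerivWithinAt v v' S s) :
    HasDerivWithinAt (fun r => (inner ℂ (Φ r) (onBody j (rankOne ℂ (v r) (v r)) (Φ r))).re)
      (2 * ((inner ℂ Φ' (onBody j (rankOne ℂ (v s) (v s)) (Φ s))).re
        + (inner ℂ (Φ s) (onBody j (rankOne ℂ v' (v s)) (Φ s))).re)) S s := by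
  set A := amplL (singleOut j) (measurePreserving_singleOut j)
  have h1 : HasDerivWithinAt (fun r => rankOneℝ (v r) (v r))
      (rankOneℝ (v s) v' + rankOneℝ v' (v s)) S s :=
    rankOneℝ.hasDerivWithinAt_of_bilinear hv hv
  have h2 : HasDerivWithinAt (fun r => (onBody j (rankOne ℂ (v r) (v r))).restrictScalars ℝ)
      ((A (rankOneℝ (v s) v' + rankOneℝ v' (v s))).restrictScalars ℝ) S s :=
    ((ContinuousLinearMap.restrictScalarsL ℂ _ _ ℝ ℝ ∘L
      A.restrictScalars ℝ).hasFDerivAt.comp_hasDerivWithinAt s h1)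
  have h3 := hΦ.inner ℂ (h2.clm_apply hΦ)
  have h4 := Complex.reCLM.hasFDerivAt.comp_hasDerivWithinAt s h3
  refine HasDerivWithinAt.congr_deriv (f := fun r =>
    (inner ℂ (Φ r) (onBody j (rankOne ℂ (v r) (v r)) (Φ r))).re) h4 ?_
  have e1 : A (rankOneℝ (v s) v' + rankOneℝ v' (v s))
      = onBody j (rankOne ℂ (v s) v') + onBody j (rankOne ℂ v' (v s)) := by
    rw [map_add]; rfl
  have e2 : inner ℂ (Φ s) (onBody j (rankOne ℂ (v s) v') (Φ s))
      = starRingEnd ℂ (inner ℂ (Φ s) (onBody j (rankOne ℂ v' (v s)) (Φ s))) := by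
    rw [inner_conj_symm, inner_onBody_left, adjoint_rankOne]
  have e3 : inner ℂ (Φ s) (onBody j (rankOne ℂ (v s) (v s)) Φ')
      = starRingEnd ℂ (inner ℂ Φ' (onBody j (rankOne ℂ (v s) (v s)) (Φ s))) := by
    rw [inner_conj_symm, inner_onBody_left, adjoint_rankOne]
  simp only [Complex.reCLM_apply, ContinuousLinearMap.coe_restrictScalars', e1, inner_add_right,
    add_apply, e2, e3, Complex.add_re, Complex.conj_re]
  ring

/-- The rate of change of the overlap with the condensate. -/
theorem hasDerivWithinAt_condensate (hw : IsRegular w M) {ħ T : ℝ} (hħ : 0 < ħ) (hT : 0 ≤ T)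
    {ψ : L2Space} {u : ℝ → L2Space} (hu : IsHartreeSolution ħ w ψ T u)
    {U : ℝ → L2S (n + 1) →L[ℂ] L2S (n + 1)} (hU : IsSchrodingerGroup ħ w (n + 1) U)
    (f : L2S (n + 1)) (j : Fin (n + 1)) {s : ℝ} (hs : s ∈ Set.Icc 0 T) :
    HasDerivWithinAt (fun r => (inner ℂ (U r f : L2Config (n + 1))
        (onBody j (rankOne ℂ (u r) (u r)) (U r f : L2Config (n + 1)))).re)
      (-(2 / ħ) * (inner ℂ (U s f : L2Config (n + 1))
        (interactionOp hw (n + 1) (onBody j (rankOne ℂ (u s) (u s)) (U s f : L2Config (n + 1)))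
          - onBody j (hartreeOp hw (u s))
            (onBody j (rankOne ℂ (u s) (u s)) (U s f : L2Config (n + 1))))).im)
      (Set.Icc 0 T) s := by
  have hg := isUnitaryGroup_freeGroup (E := Config (n + 1)) ħ
  have hΦ := hU.hasDerivAt hw hħ f s
  rw [← map_smul] at hΦ
  have h := hasDerivWithinAt_inner_onBody j hΦ.hasDerivWithinAt (hu.hasDerivWithinAt hw hħ hT hs)
  have e : ∀ (r : ℝ) (x y : L2Space) (Ψ Ψ' : L2Config (n + 1)),
      inner ℂ (freeGroup ħ (-r) Ψ) (onBody j (rankOne ℂ (freeGroup ħ (-r) x) (freeGroup ħ (-r) y))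
        (freeGroup ħ (-r) Ψ')) = inner ℂ Ψ (onBody j (rankOne ℂ x y) Ψ') := by
    intro r x y Ψ Ψ'
    rw [hg.inner_apply_left, neg_neg, freeGroup_onBody_rankOne]
  simp only [e] at h
  refine h.congr_deriv ?_
  set Ψ : L2Config (n + 1) := (U s f : L2Config (n + 1))
  have e1 : onBody j (rankOne ℂ (hartreeField hw ħ (u s)) (u s)) Ψ
      = (-Complex.I / ħ : ℂ) • onBody j (hartreeOp hw (u s)) (onBody j (rankOne ℂ (u s) (u s)) Ψ) := by
    have : rankOne ℂ (hartreeField hw ħ (u s)) (u s)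
        = (-Complex.I / ħ : ℂ) • (hartreeOp hw (u s) ∘L rankOne ℂ (u s) (u s)) := by
      ext1 g
      simp only [hartreeField, rankOne_apply, smul_apply, ContinuousLinearMap.comp_apply,
        map_smul]
    rw [this, ← onBody_comp, onBody, ampl_smul]
    rfl
  rw [e1, inner_smul_left, inner_smul_right, inner_interactionOp, inner_sub_right]
  have e2 : (starRingEnd ℂ) (-Complex.I / ħ) = ((1 / ħ : ℝ) : ℂ) * Complex.I := by
    simp only [map_div₀, map_neg, Complex.conj_I, Complex.conj_ofReal]
    push_cast
    ring
  have e3 : (-Complex.I / ħ : ℂ) = ((-(1 / ħ) : ℝ) : ℂ) * Complex.I := by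
    push_cast
    ring
  rw [e2, e3, mul_assoc, mul_assoc, Complex.re_ofReal_mul, Complex.re_ofReal_mul,
    Complex.I_mul_re, Complex.I_mul_re, Complex.sub_im]
  ring

theorem onBody_rankOne_prodFun (j : Fin (n + 1)) {u : L2Space} (hu : ‖u‖ = 1) :
    onBody j (rankOne ℂ u u) (prodFun fun _ => u) = prodFun fun _ => u := by
  rw [onBody_prodFun, rankOne_apply, inner_self_eq_norm_sq_to_K, hu]
  simp

theorem norm_productState {u : L2Space} (hu : ‖u‖ = 1) (N : ℕ) : ‖productState u N‖ = 1 := by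
  show ‖(productState u N : L2Config N)‖ = 1
  rw [coe_productState, norm_prodFun]
  simp [hu]

/-- The expected number of particles outside the condensate is bounded uniformly in the total
number of particles. -/
theorem sum_norm_sq_sub_condensate_le (hw : IsRegular w M) {ħ T : ℝ} (hħ : 0 < ħ) (hT : 0 ≤ T)
    {ψ : L2Space} (hψ : ‖ψ‖ = 1) {u : ℝ → L2Space} (hu : IsHartreeSolution ħ w ψ T u)
    {U : ℝ → L2S (n + 1) →L[ℂ] L2S (n + 1)} (hU : IsSchrodingerGroup ħ w (n + 1) U) :
    ∑ j, ‖(U T (productState ψ (n + 1)) : L2Config (n + 1))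
        - onBody j (rankOne ℂ (u T) (u T)) (U T (productState ψ (n + 1)) : L2Config (n + 1))‖ ^ 2
      ≤ gronwallBound 0 (8 * M / ħ) (8 * M / ħ) T := by
  have hM := hw.nonneg
  have hUg := hU.isUnitaryGroup
  set Ψ : ℝ → L2Config (n + 1) := fun s => (U s (productState ψ (n + 1)) : L2Config (n + 1))
  have hΨ : ∀ s, ‖Ψ s‖ = 1 := fun s => by
    show ‖U s (productState ψ (n + 1))‖ = 1
    rw [hUg.norm_map, norm_productState hψ]
  have hun : ∀ s ∈ Set.Icc 0 T, ‖u s‖ = 1 := fun s hs => by rw [hu.norm_eq hw hħ hT hs, hψ]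
  -- The form that can be differentiated. It equals the sum of the ‖q_j Ψ‖² where ‖u s‖ = 1, which
  -- mass conservation ensures on [0, T].
  set β : ℝ → ℝ := fun s =>
    ∑ j, (1 - (inner ℂ (Ψ s) (onBody j (rankOne ℂ (u s) (u s)) (Ψ s))).re)
  have hβ : ∀ s ∈ Set.Icc 0 T,
      ∑ j, ‖Ψ s - onBody j (rankOne ℂ (u s) (u s)) (Ψ s)‖ ^ 2 = β s := fun s hs => by
    refine Finset.sum_congr rfl fun j _ => ?_
    have := (condensateSystem hw n (hun s hs)).norm_sq_q j (Ψ s)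
    rw [hΨ, one_pow] at this
    exact this
  set β' : ℝ → ℝ := fun s => ∑ j, (2 / ħ) * (inner ℂ (Ψ s)
        (interactionOp hw (n + 1) (onBody j (rankOne ℂ (u s) (u s)) (Ψ s))
          - onBody j (hartreeOp hw (u s)) (onBody j (rankOne ℂ (u s) (u s)) (Ψ s)))).im
  have hder : ∀ s ∈ Set.Icc 0 T, HasDerivWithinAt β (β' s) (Set.Icc 0 T) s := fun s hs => by
    refine HasDerivWithinAt.fun_sum fun j _ => ?_
    refine ((hasDerivWithinAt_condensate hw hħ hT hu hU (productState ψ (n + 1)) j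
      hs).const_sub 1).congr_deriv ?_
    ring
  -- The constant is the factor 2/ħ of the derivative times the 4M of the pair estimate.
  have hbound : ∀ s ∈ Set.Icc 0 T, ‖β' s‖ ≤ 8 * M / ħ * ‖β s‖ + 8 * M / ħ := fun s hs => by
    have h1 := (condensateSystem hw n (hun s hs)).abs_sum_im_inner_le hM
      (W := interactionOp hw (n + 1)) (by
        rw [Fintype.card_fin]; exact interactionOp_eq hw (n + 1)) (inner_interactionOp hw) (hΨ s)
    have h2 : ∑ j, ‖(condensateSystem hw n (hun s hs)).q j (Ψ s)‖ ^ 2 = β s := hβ s hs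
    rw [h2] at h1
    have h3 : ‖β' s‖ = 2 / ħ * |∑ j, (inner ℂ (Ψ s)
        (interactionOp hw (n + 1) (onBody j (rankOne ℂ (u s) (u s)) (Ψ s))
          - onBody j (hartreeOp hw (u s)) (onBody j (rankOne ℂ (u s) (u s)) (Ψ s)))).im| := by
      simp only [β']
      rw [← Finset.mul_sum, norm_mul, Real.norm_eq_abs, Real.norm_eq_abs,
        abs_of_pos (by positivity : (0 : ℝ) < 2 / ħ)]
    rw [h3]
    refine (mul_le_mul_of_nonneg_left h1 (by positivity)).trans ?_
    have h4 : 2 / ħ * (4 * M * (β s + 1)) = 8 * M / ħ * β s + 8 * M / ħ := by ring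
    rw [h4]
    have h5 : 8 * M / ħ * β s ≤ 8 * M / ħ * ‖β s‖ :=
      mul_le_mul_of_nonneg_left (le_abs_self _) (by positivity)
    linarith
  have hβ0 : ‖β 0‖ ≤ 0 := by
    have : β 0 = 0 := by
      rw [← hβ 0 ⟨le_rfl, hT⟩]
      refine Finset.sum_eq_zero fun j _ => ?_
      simp only [Ψ]
      rw [hUg.zero_apply, hu.initial, coe_productState, onBody_rankOne_prodFun j hψ, sub_self,
        norm_zero, zero_pow two_ne_zero]
    rw [this, norm_zero]
  have hG := norm_le_gronwallBound_of_norm_deriv_right_le (f := β) (f' := β') (δ := 0)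
    (K := 8 * M / ħ) (ε := 8 * M / ħ) (a := 0) (b := T)
    (fun s hs => (hder s hs).continuousWithinAt)
    (fun s hs => (hder s ⟨hs.1, hs.2.le⟩).mono_of_mem_nhdsWithin (Icc_mem_nhdsGE_of_mem hs))
    hβ0 (fun s hs => hbound s ⟨hs.1, hs.2.le⟩) T ⟨hT, le_rfl⟩
  rw [sub_zero] at hG
  rw [hβ T ⟨hT, le_rfl⟩]
  exact (le_abs_self _).trans hG

end condensate

/-! ### Convergence of the reduced observables -/

section limit
open InnerProductSpace

theorem permOp_eq_self {N : ℕ} (Ψ : L2S N) (σ : Equiv.Perm (Fin N)) :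
    permOp σ (Ψ : L2Config N) = Ψ := mem_L2S_iff.1 Ψ.2 σ

theorem norm_sub_onBody_eq {n : ℕ} (b : L2Space →L[ℂ] L2Space) (Ψ : L2S (n + 1))
    (j k : Fin (n + 1)) :
    ‖(Ψ : L2Config (n + 1)) - onBody j b Ψ‖ = ‖(Ψ : L2Config (n + 1)) - onBody k b Ψ‖ := by
  rw [← (permOp (Equiv.swap j k)).norm_map ((Ψ : L2Config (n + 1)) - onBody j b Ψ), map_sub,
    permOp_onBody, permOp_eq_self, Equiv.swap_apply_left]

theorem inner_prodFun {N : ℕ} (f g : Fin N → L2Space) :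
    inner ℂ (prodFun f) (prodFun g) = ∏ i, inner ℂ (f i) (g i) := by
  induction N with
  | zero =>
    have e : f = g := Subsingleton.elim _ _
    rw [e, inner_self_eq_norm_sq_to_K, norm_prodFun]
    simp
  | succ n ih =>
    rw [prodFun_eq_tens 0, prodFun_eq_tens 0, inner_tens, ih, Fin.prod_univ_succ]
    simp

theorem prodFun_smul {N : ℕ} (c : Fin N → ℂ) (f : Fin N → L2Space) :
    prodFun (fun i => c i • f i) = (∏ i, c i) • prodFun f := by
  apply Lp.ext
  filter_upwards [coeFn_prodFun fun i => c i • f i, coeFn_prodFun f,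
    Lp.coeFn_smul (∏ i, c i) (prodFun f),
    ae_all_iff.2 fun i => ae_particle i (Lp.coeFn_smul (c i) (f i))] with x h1 h2 h3 h4
  rw [h1, h3, Pi.smul_apply, h2, smul_eq_mul, ← Finset.prod_mul_distrib]
  exact Finset.prod_congr rfl fun i _ => h4 i

theorem rankOne_prodFun {N : ℕ} (u : L2Space) (f : Fin N → L2Space) :
    rankOne ℂ (prodFun fun _ : Fin N => u) (prodFun fun _ => u) (prodFun f)
      = prodFun fun i => rankOne ℂ u u (f i) := by
  simp only [rankOne_apply, inner_prodFun, prodFun_smul]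

/-- The product of the projections onto `u` for the particles in `s`. -/
theorem exists_prod_onBody {n : ℕ} {u : L2Space} (hu : ‖u‖ = 1) (s : Finset (Fin (n + 1))) :
    ∃ T : L2Config (n + 1) →L[ℂ] L2Config (n + 1), (∀ x, ‖T x‖ ≤ ‖x‖) ∧
      (∀ x, ‖x - T x‖ ≤ ∑ j ∈ s, ‖x - onBody j (rankOne ℂ u u) x‖) ∧
      ∀ f, T (prodFun f) = prodFun fun i => if i ∈ s then rankOne ℂ u u (f i) else f i := by
  have hb : ‖rankOne ℂ u u‖ ≤ 1 := by simp [hu]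
  induction s using Finset.induction_on with
  | empty => exact ⟨ContinuousLinearMap.id ℂ _, by simp, by simp, by simp⟩
  | insert j s hj ih =>
    obtain ⟨T, h1, h2, h3⟩ := ih
    refine ⟨T ∘L onBody j (rankOne ℂ u u), fun x => ?_, fun x => ?_, fun f => ?_⟩
    · refine (h1 _).trans ((norm_ampl_apply_le _ _ _ x).trans ?_)
      exact mul_le_of_le_one_left (norm_nonneg x) hb
    · rw [Finset.sum_insert hj]
      -- Telescoping: the first difference does not grow, because T is a contraction.
      have e : x - (T ∘L onBody j (rankOne ℂ u u)) x
          = T (x - onBody j (rankOne ℂ u u) x) + (x - T x) := by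
        rw [map_sub, ContinuousLinearMap.comp_apply]; abel
      rw [e]
      exact (norm_add_le _ _).trans (add_le_add (h1 _) (h2 x))
    · rw [ContinuousLinearMap.comp_apply, onBody_prodFun, h3]
      congr 1
      funext i
      by_cases hi : i = j
      · subst hi; simp [hj]
      · simp [hi]

/-- The projection onto u^{⊗p} is a product of p one-particle projections, so the defect is at most
p one-particle defects. By symmetry all N of these are equal, so each has square at most C/N. -/
theorem norm_sub_amplify_rankOne_le {p m : ℕ} {u : L2Space} (hu : ‖u‖ = 1) (Ψ : L2S (p + (m + 1)))
    {C : ℝ} (hC : ∑ j : Fin (p + m + 1), ‖(Ψ : L2Config (p + m + 1))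
      - onBody j (rankOne ℂ u u) (Ψ : L2Config (p + m + 1))‖ ^ 2 ≤ C) :
    ‖(Ψ : L2Config (p + (m + 1))) - amplify p (m + 1)
      (rankOne ℂ (prodFun fun _ => u) (prodFun fun _ => u)) Ψ‖
      ≤ p * √(C / ((p + m + 1 : ℕ) : ℝ)) := by
  obtain ⟨T, -, h2, h3⟩ := exists_prod_onBody (n := p + m) hu
    (Finset.univ.image (Fin.castAdd (m + 1) : Fin p → Fin (p + (m + 1))))
  have hT : T = amplify p (m + 1) (rankOne ℂ (prodFun fun _ => u) (prodFun fun _ => u)) := by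
    refine ext_prodFun fun f => ?_
    rw [h3, amplify_eq_ampl, prodFun_eq_tens_split (p := p) (m := m + 1) f, ampl_tens,
      rankOne_prodFun]
    refine (prodFun_eq_tens_split (p := p) (m := m + 1) _).trans ?_
    congr 2
    · funext i
      rw [if_pos (Finset.mem_image_of_mem _ (Finset.mem_univ i))]
    · funext i
      rw [if_neg]
      intro h
      obtain ⟨k, -, hk⟩ := Finset.mem_image.1 h
      have := congrArg Fin.val hk
      simp at this
      omega
  rw [← hT]
  refine (h2 (Ψ : L2Config (p + m + 1))).trans ?_
  have hn : (0 : ℝ) < ((p + m + 1 : ℕ) : ℝ) := by positivity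
  have hj : ∀ j : Fin (p + m + 1), ‖(Ψ : L2Config (p + m + 1))
      - onBody j (rankOne ℂ u u) (Ψ : L2Config (p + m + 1))‖ ≤ √(C / ((p + m + 1 : ℕ) : ℝ)) := by
    intro j
    refine Real.le_sqrt_of_sq_le ?_
    rw [le_div_iff₀ hn]
    refine le_trans (le_of_eq ?_) hC
    rw [Finset.sum_congr rfl fun k _ => by
      rw [norm_sub_onBody_eq (n := p + m) (rankOne ℂ u u) Ψ k j]]
    rw [Finset.sum_const, Finset.card_univ, Fintype.card_fin, nsmul_eq_mul, mul_comm]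
  refine (Finset.sum_le_card_nsmul _ _ _ fun j _ => hj j).trans ?_
  rw [nsmul_eq_mul]
  refine mul_le_mul_of_nonneg_right ?_ (Real.sqrt_nonneg _)
  exact_mod_cast Finset.card_image_le.trans (by simp)

/-- Expectations in a state close to the range of a projection `P` for which `P A P = c P`. -/
theorem norm_inner_sub_le {H : Type*} [NormedAddCommGroup H] [InnerProductSpace ℂ H]
    {P A : H →L[ℂ] H} {c : ℂ} {K ε : ℝ} (hP : ∀ x y, inner ℂ (P x) y = inner ℂ x (P y))
    (hP1 : ∀ x, ‖P x‖ ≤ ‖x‖) (hA : ∀ x, ‖A x‖ ≤ K * ‖x‖) (hK : 0 ≤ K) (hc : ‖c‖ ≤ K)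
    (hPA : ∀ x, P (A (P x)) = c • P x) {x : H} (hx : ‖x‖ = 1) (hε : ‖x - P x‖ ≤ ε) :
    ‖inner ℂ x (A x) - c‖ ≤ 3 * K * ε := by
  -- Each of the three terms contains the small vector x - P x once.
  have e : inner ℂ x (A x) - c
      = inner ℂ (x - P x) (A x) + inner ℂ (P x) (A (x - P x)) - c * inner ℂ x (x - P x) := by
    have h1 : inner ℂ (P x) (A (P x)) = c * inner ℂ x (P x) := by
      rw [hP, hPA, inner_smul_right]
    have h2 : inner ℂ x x = (1 : ℂ) := by rw [inner_self_eq_norm_sq_to_K, hx]; simp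
    simp only [map_sub, inner_sub_left, inner_sub_right, h1, h2]
    ring
  have h0 : 0 ≤ ε := (norm_nonneg _).trans hε
  have b1 : ‖inner ℂ (x - P x) (A x)‖ ≤ ε * K := by
    refine (norm_inner_le_norm _ _).trans (mul_le_mul hε ?_ (norm_nonneg _) h0)
    simpa [hx] using hA x
  have b2 : ‖inner ℂ (P x) (A (x - P x))‖ ≤ 1 * (K * ε) := by
    refine (norm_inner_le_norm _ _).trans (mul_le_mul ((hP1 x).trans_eq hx) ?_ (norm_nonneg _)
      zero_le_one)
    exact (hA _).trans (mul_le_mul_of_nonneg_left hε hK)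
  have b3 : ‖c * inner ℂ x (x - P x)‖ ≤ K * ε := by
    rw [norm_mul]
    refine mul_le_mul hc ((norm_inner_le_norm _ _).trans ?_) (norm_nonneg _) hK
    rw [hx, one_mul]; exact hε
  rw [e]
  refine (norm_sub_le _ _).trans ((add_le_add (norm_add_le _ _) le_rfl).trans ?_)
  linarith

theorem tendsto_descFactorial_div_pow (p : ℕ) :
    Tendsto (fun m : ℕ => ((p + m).descFactorial p : ℂ) / ((p + m : ℕ) : ℂ) ^ p) atTop (𝓝 1) := by
  have h1 : Tendsto (fun n : ℕ => ∏ i ∈ Finset.range p, (1 - (i : ℂ) / (n : ℂ))) atTop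
      (𝓝 (∏ i ∈ Finset.range p, (1 - 0))) :=
    tendsto_finsetProd _ fun i _ => tendsto_const_nhds.sub
      (tendsto_const_div_atTop_nhds_zero_nat (i : ℂ))
  have h2 := h1.comp (tendsto_add_atTop_nat p)
  rw [sub_zero, Finset.prod_const_one] at h2
  refine h2.congr' ?_
  filter_upwards [eventually_ge_atTop 1] with m hm
  have hne : ((p + m : ℕ) : ℂ) ≠ 0 := by exact_mod_cast (by omega : p + m ≠ 0)
  have e : ((p + m : ℕ) : ℂ) ^ p = ∏ _i ∈ Finset.range p, ((p + m : ℕ) : ℂ) := by simp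
  rw [Function.comp_apply, add_comm m p, Nat.descFactorial_eq_prod_range, Nat.cast_prod, e,
    ← Finset.prod_div_distrib]
  refine Finset.prod_congr rfl fun i hi => ?_
  have hi' : i ≤ p + m := (Finset.mem_range.1 hi).le.trans (Nat.le_add_right p m)
  rw [Nat.cast_sub hi', sub_div, div_self hne]

/-- The outer projection P_S drops out because the left vector is already symmetric. -/
theorem inner_observable {p m : ℕ} (a : L2S p →L[ℂ] L2S p) (Ψ : L2S (p + m)) :
    inner ℂ Ψ (observable p m a Ψ)
      = ((p + m).descFactorial p : ℂ) / ((p + m : ℕ) : ℂ) ^ p *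
        inner ℂ (Ψ : L2Config (p + m)) (amplify p m ((L2S p).subtypeL ∘L a ∘L symProj p) Ψ) := by
  rw [observable, smul_apply, inner_smul_right]
  congr 1
  exact (L2S (p + m)).inner_orthogonalProjectionOnto_eq_of_mem_left Ψ _

/-- Observables converge along symmetric states with a bounded number of particles outside the
condensate. -/
theorem tendsto_inner_observable {p : ℕ} (a : L2S p →L[ℂ] L2S p) {u : L2Space} (hu : ‖u‖ = 1)
    (Ψ : (m : ℕ) → L2S (p + m)) (hΨ : ∀ m, ‖Ψ m‖ = 1) {C : ℝ}
    (hC : ∀ m, ∑ j : Fin (p + m + 1), ‖(Ψ (m + 1) : L2Config (p + m + 1))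
      - onBody j (rankOne ℂ u u) (Ψ (m + 1) : L2Config (p + m + 1))‖ ^ 2 ≤ C) :
    Tendsto (fun m => inner ℂ (Ψ m) (observable p m a (Ψ m))) atTop
      (𝓝 (inner ℂ (productState u p) (a (productState u p)))) := by
  set Ω : L2Config p := prodFun fun _ => u
  have hΩ : ‖Ω‖ = 1 := by rw [norm_prodFun]; simp [hu]
  set b : L2Config p →L[ℂ] L2Config p := (L2S p).subtypeL ∘L a ∘L symProj p
  set c : ℂ := inner ℂ (productState u p) (a (productState u p))
  have hc : inner ℂ Ω (b Ω) = c := by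
    have : symProj p Ω = productState u p :=
      (L2S p).orthogonalProjectionOnto_mem_subspace_eq_self (productState u p)
    simp only [b, ContinuousLinearMap.comp_apply]
    rw [this]
    rfl
  have hcb : ‖c‖ ≤ ‖b‖ := by
    rw [← hc]
    refine (norm_inner_le_norm _ _).trans ?_
    rw [hΩ, one_mul]
    simpa [hΩ] using b.le_opNorm Ω
  have hlim : Tendsto (fun m : ℕ => inner ℂ (Ψ m : L2Config (p + m)) (amplify p m b (Ψ m))) atTop
      (𝓝 c) := by
    -- One-body operators need at least one particle, hence the shift of the index.
    rw [← tendsto_add_atTop_iff_nat 1, tendsto_iff_norm_sub_tendsto_zero]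
    refine squeeze_zero (fun _ => norm_nonneg _) (fun m => norm_inner_sub_le
      (P := amplify p (m + 1) (rankOne ℂ Ω Ω)) (A := amplify p (m + 1) b) (K := ‖b‖)
      (fun x y => ?_) (fun x => ?_) (fun x => ?_) (norm_nonneg b) hcb (fun x => ?_) (hΨ (m + 1))
      (norm_sub_amplify_rankOne_le hu (Ψ (m + 1)) (hC m))) ?_
    · rw [amplify_eq_ampl, inner_ampl_left, adjoint_rankOne]
    · refine (norm_ampl_apply_le _ _ _ x).trans ?_
      exact mul_le_of_le_one_left (norm_nonneg x) (by simp [hΩ])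
    · exact norm_ampl_apply_le _ _ _ x
    -- Compression to a line makes b the scalar c, and tensoring with the identity preserves this.
    · have : rankOne ℂ Ω Ω ∘L b ∘L rankOne ℂ Ω Ω = c • rankOne ℂ Ω Ω := by
        ext1 f
        simp only [ContinuousLinearMap.comp_apply, rankOne_apply, map_smul, smul_apply, hc]
        rw [smul_comm]
      have h2 := congrArg (fun T => amplify p (m + 1) T x) this
      simp only [amplify_eq_ampl, ampl_comp, ampl_smul] at h2
      exact h2
    · have h1 : Tendsto (fun m : ℕ => C / ((p + m + 1 : ℕ) : ℝ)) atTop (𝓝 0) := by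
        have := (tendsto_const_div_atTop_nhds_zero_nat C).comp (tendsto_add_atTop_nat (p + 1))
        refine this.congr fun m => ?_
        rw [Function.comp_apply]
        congr 2
        omega
      have h2 := (h1.sqrt.const_mul (p : ℝ)).const_mul (3 * ‖b‖)
      simpa using h2
  have := (tendsto_descFactorial_div_pow p).mul hlim
  rw [one_mul] at this
  refine this.congr fun m => ?_
  rw [inner_observable]

end limit

end MeanField

end

/-! ### The mean-field limit -/

theorem theorem1p1 (ħ t : ℝ) (hħ : 0 < ħ) (ht : 0 ≤ t)
    (w : Space → ℝ) (hw : MemLp w ∞ volume) (hw_even : ∀ᵐ x, w (-x) = w x)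
    (ψ : L2Space) (hψ : ‖ψ‖ = 1) (p : ℕ) (a : L2S p →L[ℂ] L2S p) :
    (∀ N : ℕ, ∃! U : ℝ → L2S N →L[ℂ] L2S N, IsSchrodingerGroup ħ w N U) ∧
    (∃ u : ℝ → L2Space, IsHartreeSolution ħ w ψ t u) ∧
    ∀ U : (N : ℕ) → ℝ → L2S N →L[ℂ] L2S N, (∀ N, IsSchrodingerGroup ħ w N (U N)) →
    ∀ u : ℝ → L2Space, IsHartreeSolution ħ w ψ t u →
      Tendsto (fun m : ℕ => inner ℂ (productState ψ (p + m))
          (U (p + m) (-t) (observable p m a (U (p + m) t (productState ψ (p + m))))))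
        atTop (𝓝 (inner ℂ (productState (u t) p) (a (productState (u t) p)))) ∧
      Tendsto (fun m : ℕ => inner ℂ (productState (u t) (p + m))
          (observable p m a (productState (u t) (p + m))))
        atTop (𝓝 (inner ℂ (productState (u t) p) (a (productState (u t) p)))) := by
  obtain ⟨w', M, hw', hww'⟩ := exists_isRegular hw hw_even
  refine ⟨fun N => ?_, ?_, fun U hU u hu => ?_⟩
  · obtain ⟨U, hU, -⟩ := exists_isSchrodingerGroup hw' hħ N
    refine ⟨U, (isSchrodingerGroup_congr hww').2 hU, fun V hV => ?_⟩
    exact ((isSchrodingerGroup_congr hww').1 hV).unique hħ hU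
  · obtain ⟨u, hu⟩ := exists_isHartreeSolution hw' hħ ψ t
    exact ⟨u, (isHartreeSolution_congr hww').2 hu⟩
  · replace hU := fun N => (isSchrodingerGroup_congr hww').1 (hU N)
    replace hu := (isHartreeSolution_congr hww').1 hu
    have hut : ‖u t‖ = 1 := by rw [hu.norm_eq hw' hħ ht ⟨ht, le_rfl⟩, hψ]
    constructor
    -- U (-t) is the adjoint of U t, so the expectation is one in the evolved state.
    · simp only [fun N => (hU N).isUnitaryGroup.inner_apply_right (-t), neg_neg]
      refine tendsto_inner_observable a hut (fun m => U (p + m) t (productState ψ (p + m)))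
        (fun m => ?_) fun m => sum_norm_sq_sub_condensate_le hw' hħ ht hψ hu (hU (p + m + 1))
      rw [(hU _).isUnitaryGroup.norm_map, norm_productState hψ]
    -- In the product state of u t no particle is outside the condensate, so C = 0 works.
    · refine tendsto_inner_observable a hut (fun m => productState (u t) (p + m))
        (fun m => norm_productState hut _) (C := 0) fun m => le_of_eq ?_
      refine Finset.sum_eq_zero fun j _ => ?_
      have h := sub_eq_zero.2 (onBody_rankOne_prodFun (n := p + m) j hut).symm
      exact (congrArg (fun x => ‖x‖ ^ 2) h).trans (by simp)
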